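/- Let $m\ge 2$ be an integer, let $\alpha>\max\{\tfrac12(2m-1),\tfrac12(m+3)\}$ be real, and set $\nu=\alpha-\tfrac12(m+1)$. Write $Y>0$ when $Y$ is a real symmetric positive definite $m\times m$ matrix, $\operatorname{etr}(Y)=\exp(\operatorname{tr}Y)$, and $dR=\prod_{i\le j}dr_{ij}$ for Lebesgue measure on symmetric matrices $R=(r_{ij})$. Let $\Gamma_m(a)=\int_{R>0}(\det R)^{a-\frac12(m+1)}\operatorname{etr}(-R)\,dR$ for $a>\tfrac12(m-1)$, and let $P_0$ be the Wishart distribution $W_m(\alpha,I_m)$, with density $\Gamma_m(\alpha)^{-1}(\det X)^{\alpha-\frac12(m+1)}\operatorname{etr}(-X)$ on $\{X>0\}$. For a partition $\kappa=(k_1\ge\dots\ge k_m\ge 0)$ let $|\kappa|=\sum_j k_j$, let $\ell=\ell(\kappa)$ be the number of its non-zero parts, and put $[a]_\kappa=\prod_{j=1}^m\big(a-\tfrac12(j-1)\big)_{k_j}$, where $(a)_k=a(a+1)\cdots(a+k-1)$. The zonal polynomial of $\kappa$ at a symmetric matrix $Y$ is $$C_\kappa(Y)=C_\kappa(I_m)\,(\det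 Y)^{k_m}\int_{O(m)}\prod_{j=1}^{m-1}\big(\det\nolimits_j(HYH^{-1})\big)^{k_j-k_{j+1}}\,dH,$$ where $\det_j$ is the leading principal minor of order $j$, $dH$ is the normalized Haar measure on the orthogonal group $O(m)$, and $$C_\kappa(I_m)=2^{2|\kappa|}\,|\kappa|!\,[m/2]_\kappa\,\frac{\prod_{1\le i<j\le\ell}(2k_i-2k_j-i+j)}{\prod_{i=1}^{\ell}(2k_i+\ell-i)!}.$$ For symmetric $X,Y$ let $$A_\nu(X,Y)=\frac{1}{\Gamma_m(\nu+\frac12(m+1))}\sum_{k=0}^\infty\frac{(-1)^k}{k!}\sum_{|\kappa|=k}\frac{C_\kappa(X)\,C_\kappa(Y)}{[\nu+\frac12(m+1)]_\kappa\,C_\kappa(I_m)},$$ and for $S,T>0$ let $$K_0(S,T)=\Gamma_m(\alpha)\operatorname{etr}(-\alpha^{-1}(S+T))\,A_\nu(-\alpha^{-2}S,T),$$ $$K(S,T)=\operatorname{etr}(-\alpha^{-1}(S+T))\Big[\Gamma_m(\alpha)A_\nu(-\alpha^{-2}S,T)-\frac{1}{\alpha^3m}(\operatorname{tr}S)(\operatorname{tr}T)-1\Big].$$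 Let $L^2=L^2(P_0)$ be the complex Hilbert space of ($P_0$-a.e. equivalence classes of) Borel measurable functions $f:\{X>0\}\to\mathbb C$ with $\int|f|^2\,dP_0<\infty$ that are orthogonally invariant, i.e. $f(HXH')=f(X)$ for all $X>0$ and $H\in O(m)$. Then the covariance operators $$\mathcal Sf(S)=\int_{T>0}K(S,T)f(T)\,dP_0(T),\qquad \mathcal S_0f(S)=\int_{T>0}K_0(S,T)f(T)\,dP_0(T)\qquad(S>0,\ f\in L^2)$$ are well-defined bounded linear operators $L^2\to L^2$ (the integrals converge absolutely for all $S>0$ and $f\in L^2$), and both are injective: for $f,g\in L^2$, $\mathcal Sf=\mathcal Sg$ if and only if $f=g$, and $\mathcal S_0f=\mathcal S_0g$ if and only if $f=g$. In particular, $0$ is not an eigenvalue of $\mathcal S$ or of $\mathcal S_0$. -/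

import Mathlib

open MeasureTheory
open scoped ENNReal Nat Matrix

namespace Wishart

noncomputable section

/-! ### Square matrices, symmetric matrices and the orthogonal group -/

/-- The Borel (= product) σ-algebra on real `m × m` matrices. -/
instance instMeasurableSpaceMat (m : ℕ) : MeasurableSpace (Matrix (Fin m) (Fin m) ℝ) :=
  inferInstanceAs (MeasurableSpace (Fin m → Fin m → ℝ))

instance instBorelSpaceMat (m : ℕ) : BorelSpace (Matrix (Fin m) (Fin m) ℝ) :=
  inferInstanceAs (BorelSpace (Fin m → Fin m → ℝ))

/-- The orthogonal group `O(m)` is compact. -/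
instance instCompactSpaceOrthogonal (m : ℕ) :
    CompactSpace (Matrix.orthogonalGroup (Fin m) ℝ) := by
  have hc : IsClosed (Matrix.orthogonalGroup (Fin m) ℝ : Set (Matrix (Fin m) (Fin m) ℝ)) :=
    isClosed_unitary
  have hK : IsCompact (Set.pi Set.univ fun _ : Fin m => Set.pi Set.univ fun _ : Fin m =>
      Set.Icc (-1 : ℝ) 1) :=
    isCompact_univ_pi fun _ => isCompact_univ_pi fun _ => isCompact_Icc
  refine isCompact_iff_compactSpace.mp (IsCompact.of_isClosed_subset hK hc ?_)
  intro U hU i _ j _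
  have h := entry_norm_bound_of_unitary (𝕜 := ℝ) hU i j
  rw [Real.norm_eq_abs] at h
  exact abs_le.mp h

/-- The normalized (total mass one) Haar measure `dH` on `O(m)`. -/
def haarO (m : ℕ) : Measure (Matrix.orthogonalGroup (Fin m) ℝ) :=
  Measure.haarMeasure ⊤

/-- The symmetric matrix with prescribed entries on and above the diagonal. -/
def symOfUpper (m : ℕ) (x : {p : Fin m × Fin m // p.1 ≤ p.2} → ℝ) :
    Matrix (Fin m) (Fin m) ℝ :=
  Matrix.of fun i j => if h : i ≤ j then x ⟨(i, j), h⟩ else x ⟨(j, i), le_of_not_ge h⟩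

lemma measurable_symOfUpper (m : ℕ) : Measurable (symOfUpper m) := by
  refine measurable_pi_lambda _ fun i => measurable_pi_lambda _ fun j => ?_
  by_cases h : i ≤ j
  · simpa [symOfUpper, h] using measurable_pi_apply _
  · simpa [symOfUpper, h] using measurable_pi_apply _

/-- Lebesgue measure `dR = ∏_{i ≤ j} dr_{ij}` on the symmetric matrices, as a measure on all
matrices that is carried by the symmetric ones. -/
def symLebesgue (m : ℕ) : Measure (Matrix (Fin m) (Fin m) ℝ) :=
  (volume : Measure ({p : Fin m × Fin m // p.1 ≤ p.2} → ℝ)).map (symOfUpper m)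

/-- The cone of positive definite (symmetric) matrices. -/
def posDefCone (m : ℕ) : Set (Matrix (Fin m) (Fin m) ℝ) := {Y | Y.PosDef}

/-! ### The multivariate gamma function and the Wishart distribution -/

/-- `Γ_m(a) = ∫_{R > 0} (det R)^{a - (m+1)/2} etr(-R) dR`, for real `a > (m-1)/2`. -/
def multiGamma (m : ℕ) (a : ℝ) : ℝ :=
  ∫ R in posDefCone m, R.det ^ (a - ((m : ℝ) + 1) / 2) * Real.exp (-R.trace) ∂symLebesgue m

/-- The Wishart distribution `P₀ = W_m(α, I_m)`. -/
def P₀ (m : ℕ) (α : ℝ) : Measure (Matrix (Fin m) (Fin m) ℝ) :=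
  ((symLebesgue m).restrict (posDefCone m)).withDensity fun X =>
    ENNReal.ofReal ((multiGamma m α)⁻¹ * X.det ^ (α - ((m : ℝ) + 1) / 2) * Real.exp (-X.trace))

/-! ### Partitions and zonal polynomials

A partition is an antitone `κ : Fin m → ℕ`; indices start at `0`, so that `κ i` is the part `k_{i+1}`. -/

open Classical in
/-- The partitions of weight `k` into at most `m` parts. -/
def partitions (m k : ℕ) : Finset (Fin m → ℕ) :=
  (Finset.piAntidiag Finset.univ k).filter Antitone

/-- The number of non-zero parts. -/
def length {m : ℕ} (κ : Fin m → ℕ) : ℕ := (Finset.univ.filter fun i => κ i ≠ 0).card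

/-- The partitional shifted factorial `[a]_κ = ∏_j (a - (j-1)/2)_{k_j}`. -/
def shiftedFactorial {m : ℕ} (a : ℝ) (κ : Fin m → ℕ) : ℝ :=
  ∏ i : Fin m, (ascPochhammer ℝ (κ i)).eval (a - (i : ℕ) / 2)

/-- The value of the zonal polynomial at the identity,
`C_κ(I_m) = 2^{2|κ|} |κ|! [m/2]_κ ∏_{1 ≤ i < j ≤ ℓ} (2k_i - 2k_j - i + j) / ∏_{i=1}^ℓ (2k_i + ℓ - i)!`
with `ℓ = ℓ(κ)`. -/
def zonalAtOne {m : ℕ} (κ : Fin m → ℕ) : ℝ :=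
  2 ^ (2 * ∑ i, κ i) * ((∑ i, κ i)! : ℝ) * shiftedFactorial ((m : ℝ) / 2) κ *
    (∏ p : Fin m × Fin m with p.1 < p.2 ∧ (p.2 : ℕ) < length κ,
      (2 * (κ p.1 : ℝ) - 2 * (κ p.2 : ℝ) - ((p.1 : ℕ) : ℝ) + ((p.2 : ℕ) : ℝ))) /
    (∏ i : Fin m with ((i : Fin m) : ℕ) < length κ, ((2 * κ i + (length κ - ((i : ℕ) + 1)))! : ℝ))

/-- The leading principal minor of order `i + 1`. -/
def leadingMinor {m : ℕ} (Y : Matrix (Fin m) (Fin m) ℝ) (i : Fin m) : ℝ :=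
  (Y.submatrix (Fin.castLE (Nat.succ_le_of_lt i.isLt))
    (Fin.castLE (Nat.succ_le_of_lt i.isLt))).det

/-- `k_{i+1} - k_{i+2}`, where the part after the last one is `0`. -/
def partGap {m : ℕ} (κ : Fin m → ℕ) (i : Fin m) : ℕ :=
  κ i - if h : (i : ℕ) + 1 < m then κ ⟨(i : ℕ) + 1, h⟩ else 0

/-- The zonal polynomial
`C_κ(Y) = C_κ(I_m) (det Y)^{k_m} ∫_{O(m)} ∏_{j<m} det_j(H Y H⁻¹)^{k_j - k_{j+1}} dH`.
The factor `(det Y)^{k_m} = det_m(H Y H⁻¹)^{k_m}` is the last one of the product below. -/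
def zonal {m : ℕ} (κ : Fin m → ℕ) (Y : Matrix (Fin m) (Fin m) ℝ) : ℝ :=
  zonalAtOne κ * ∫ H : Matrix.orthogonalGroup (Fin m) ℝ,
    ∏ i : Fin m, leadingMinor ((H : Matrix (Fin m) (Fin m) ℝ) * Y *
      (H : Matrix (Fin m) (Fin m) ℝ)ᵀ) i ^ partGap κ i ∂haarO m

/-! ### Bessel function of two matrix arguments and the two kernels -/

/-- The Bessel function of order `ν` of two (symmetric) matrix arguments,
`A_ν(X, Y) = Γ_m(ν + (m+1)/2)⁻¹ ∑_k (-1)^k / k! ∑_{|κ| = k} C_κ(X) C_κ(Y) / ([ν + (m+1)/2]_κ C_κ(I_m))`. -/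
def bessel₂ {m : ℕ} (ν : ℝ) (X Y : Matrix (Fin m) (Fin m) ℝ) : ℝ :=
  (multiGamma m (ν + ((m : ℝ) + 1) / 2))⁻¹ *
    ∑' k : ℕ, (-1) ^ k / (k ! : ℝ) * ∑ κ ∈ partitions m k,
      zonal κ X * zonal κ Y / (shiftedFactorial (ν + ((m : ℝ) + 1) / 2) κ * zonal κ 1)

/-- `K₀(S, T) = Γ_m(α) etr(-α⁻¹(S + T)) A_ν(-α⁻² S, T)` with `ν = α - (m+1)/2`. -/
def K₀ (m : ℕ) (α : ℝ) (S T : Matrix (Fin m) (Fin m) ℝ) : ℝ :=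
  multiGamma m α * Real.exp (-(α⁻¹ * (S + T).trace)) *
    bessel₂ (α - ((m : ℝ) + 1) / 2) (-(α ^ 2)⁻¹ • S) T

/-- `K(S, T) = etr(-α⁻¹(S + T)) [Γ_m(α) A_ν(-α⁻² S, T) - (α³ m)⁻¹ (tr S)(tr T) - 1]`
with `ν = α - (m+1)/2`. -/
def K (m : ℕ) (α : ℝ) (S T : Matrix (Fin m) (Fin m) ℝ) : ℝ :=
  Real.exp (-(α⁻¹ * (S + T).trace)) *
    (multiGamma m α * bessel₂ (α - ((m : ℝ) + 1) / 2) (-(α ^ 2)⁻¹ • S) T -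
      1 / (α ^ 3 * m) * (S.trace * T.trace) - 1)

/-! ### The Hilbert space and integral operators on it -/

/-- `g(H Y Hᵀ) = g(Y)` for all `Y > 0` and all `H ∈ O(m)`. -/
def OrthInvariant {m : ℕ} (g : Matrix (Fin m) (Fin m) ℝ → ℂ) : Prop :=
  ∀ Y : Matrix (Fin m) (Fin m) ℝ, Y.PosDef →
    ∀ H ∈ Matrix.orthogonalGroup (Fin m) ℝ, g (H * Y * Hᵀ) = g Y

/-- `L² = L²(P₀)`: the classes of orthogonally invariant Borel functions that are square
integrable for `P₀`, as a subspace of Mathlib's `L²` space (with its inner product and norm). -/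
def L2 (m : ℕ) (α : ℝ) : Submodule ℂ (Lp ℂ 2 (P₀ m α)) where
  carrier := {f | ∃ g : Matrix (Fin m) (Fin m) ℝ → ℂ,
    Measurable g ∧ OrthInvariant g ∧ f =ᵐ[P₀ m α] g}
  zero_mem' := ⟨0, measurable_zero, fun _ _ _ _ => rfl, Lp.coeFn_zero _ _ _⟩
  add_mem' := by
    rintro a b ⟨g, hg, hgi, hag⟩ ⟨h, hh, hhi, hbh⟩
    refine ⟨g + h, hg.add hh, fun Y hY H hH => ?_, (Lp.coeFn_add a b).trans (hag.add hbh)⟩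
    simp [hgi Y hY H hH, hhi Y hY H hH]
  smul_mem' := by
    rintro c a ⟨g, hg, hgi, hag⟩
    refine ⟨c • g, hg.const_smul c, fun Y hY H hH => ?_,
      (Lp.coeFn_smul c a).trans (hag.const_smul c)⟩
    simp [hgi Y hY H hH]

/-- `A` is the integral operator on `L²(P₀)` with kernel `k`:
`(A f)(S) = ∫_{T > 0} k(S, T) f(T) dP₀(T)`, an integral that converges absolutely for every
`S > 0`. By `IsIntegralOperator.unique` there is at most one such operator. -/
def IsIntegralOperator {m : ℕ} {α : ℝ}
    (k : Matrix (Fin m) (Fin m) ℝ → Matrix (Fin m) (Fin m) ℝ → ℝ)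
    (A : L2 m α →L[ℂ] L2 m α) : Prop :=
  ∀ f : L2 m α,
    (∀ S : Matrix (Fin m) (Fin m) ℝ, S.PosDef →
      Integrable (fun T => (k S T : ℂ) * (f : Lp ℂ 2 (P₀ m α)) T) (P₀ m α)) ∧
    ((A f : L2 m α) : Lp ℂ 2 (P₀ m α)) =ᵐ[P₀ m α]
      fun S => ∫ T, (k S T : ℂ) * (f : Lp ℂ 2 (P₀ m α)) T ∂(P₀ m α)

theorem IsIntegralOperator.unique {m : ℕ} {α : ℝ}
    {k : Matrix (Fin m) (Fin m) ℝ → Matrix (Fin m) (Fin m) ℝ → ℝ}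
    {A B : L2 m α →L[ℂ] L2 m α} (hA : IsIntegralOperator k A) (hB : IsIntegralOperator k B) :
    A = B := by
  ext1 f
  exact Subtype.ext (Lp.ext ((hA f).2.trans (hB f).2.symm))

end

end Wishart

/-! Both kernels have an expansion of Mercer type. Write `u_κ(S) = etr(-α⁻¹S) C_κ(S)/C_κ(I)`
(`feature`). The signs `(-1)^k` of the Bessel series cancel against those from its argument `-α⁻²S`,
so `K₀(S,T) = ∑ c_κ u_κ(S) u_κ(T)` with all `c_κ > 0`. The terms subtracted in `K` are exactly those
of weight 0 and 1 (`hasSum_K₀`, `hasSum_K`).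

Boundedness: the kernels lie between 0 and 1 on the cone. Hadamard's inequality bounds the minors by
diagonal entries, and the explicit `C_κ(I)` bounds `c_κ` by coefficients of a product of hyperbolic
cosines (`kernelCoeff_le`). By AM-GM the resulting bound `exp(α⁻¹(tr S + tr T))` is exactly
cancelled by the exponential factors (`sum_feature_le_one`). Since `P₀` is finite in the nontrivial
case, a bounded kernel gives a bounded operator.

Injectivity: if the transform of `f` vanishes, pairing it with `f` gives `∑ c_κ |∫ u_κ f|² = 0`, so
`f` is orthogonal to every `u_κ` with `c_κ > 0`, in particular to all of weight at least 2
(`IsMercerSum.integral_mul_eq_zero`). These suffice to determine an invariant `f`. Zonal polynomials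
of weight `k` span the symmetric forms of degree `k` in the eigenvalues, by triangularity in the
lexicographic order (`mem_span_zonalPoly`). Hence the average over `O(m)` of `(tr T)² ℓ(HTHᵀ)^k`,
for a linear form `ℓ`, is a combination of zonal polynomials of weight `k + 2`, and all moments `∫ h
ℓ^k dP₀` of `h = etr(-α⁻¹T) (tr T)² f` vanish (`integral_moment_eq_zero`). As `h` is exponentially
integrable, its Fourier transform vanishes, so `h = 0`; and `tr T > 0` gives `f = 0`. The factor
`(tr T)²` is what makes the argument work for `K`, where the low weights are missing. -/

namespace Wishart

/-! ### Vanishing moments and the Fourier transform -/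

section Moments

variable {X : Type*} [MeasurableSpace X] {μ : Measure X}

lemma pow_le_const_mul_exp {ε : ℝ} (hε : 0 < ε) (k : ℕ) {x : ℝ} (hx : 0 ≤ x) :
    x ^ k ≤ (k ! / ε ^ k) * Real.exp (ε * x) := by
  have h := Real.pow_div_factorial_le_exp (ε * x) (by positivity) k
  rw [mul_pow] at h
  have hk : (0 : ℝ) < k ! := by positivity
  rw [div_le_iff₀ hk] at h
  rw [div_mul_eq_mul_div, le_div_iff₀ (by positivity)]
  linarith

/-- If all moments of `L` against the exponentially integrable density `h` vanish, so does its
characteristic function. -/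
lemma integral_mul_cexp_eq_zero {h L : X → ℝ} {ε : ℝ} (hε : 0 < ε)
    (hh : AEStronglyMeasurable h μ) (hL : Measurable L)
    (hi : Integrable (fun x => h x * Real.exp (ε * |L x|)) μ)
    (h0 : ∀ k : ℕ, ∫ x, h x * L x ^ k ∂μ = 0) (s : ℝ) :
    ∫ x, (h x : ℂ) * Complex.exp (s * L x * Complex.I) ∂μ = 0 := by
  -- Analytic continuation along the real line in steps of length `ε / 2`. The powers `L ^ k` are
  -- part of the induction because the Taylor expansion at the previous point produces them.
  have key : ∀ n : ℕ, ∀ s : ℝ, |s| ≤ n * (ε / 2) → ∀ k : ℕ,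
      ∫ x, (h x : ℂ) * (L x : ℂ) ^ k * Complex.exp (s * L x * Complex.I) ∂μ = 0 := by
    intro n
    induction n with
    | zero =>
      intro s hs k
      have hs0 : s = 0 := by simpa using hs
      subst hs0
      have : ∀ x, (h x : ℂ) * (L x : ℂ) ^ k * Complex.exp ((0 : ℝ) * L x * Complex.I)
          = ((h x * L x ^ k : ℝ) : ℂ) := by intro x; simp
      simp_rw [this]
      rw [integral_complex_ofReal, h0 k, Complex.ofReal_zero]
    | succ n ih =>
      intro s hs k
      -- Splitting `s` in the ratio `n : 1` puts `s'` in the range of the induction hypothesis and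
      -- makes the increment `d` at most `ε / 2`. Then `exp(i d L)` is expanded under the integral.
      set s' : ℝ := s * (n / (n + 1)) with hs'
      set d : ℝ := s * (1 / (n + 1)) with hd
      have hsd : s = s' + d := by rw [hs', hd]; field_simp
      have hn : (0 : ℝ) < n + 1 := by positivity
      push_cast at hs
      have hs'n : |s'| ≤ n * (ε / 2) := by
        rw [hs', abs_mul, abs_of_nonneg (by positivity : (0 : ℝ) ≤ n / (n + 1)), mul_div_assoc',
          div_le_iff₀ hn]
        nlinarith [Nat.cast_nonneg (α := ℝ) n]
      have hdn : |d| ≤ ε / 2 := by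
        rw [hd, abs_mul, abs_of_nonneg (by positivity : (0 : ℝ) ≤ 1 / (n + 1)), mul_div_assoc',
          div_le_iff₀ hn]
        linarith
      have hsum := hasSum_integral_of_dominated_convergence (μ := μ)
        (F := fun (j : ℕ) x => (h x : ℂ) * (L x : ℂ) ^ k * Complex.exp (s' * L x * Complex.I) *
          ((d * L x * Complex.I) ^ j / (j ! : ℂ)))
        (f := fun x => (h x : ℂ) * (L x : ℂ) ^ k * Complex.exp (s * L x * Complex.I))
        (fun j x => |h x| * |L x| ^ k * ((|d| * |L x|) ^ j / (j ! : ℝ)))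
        (fun j => by
          have h1 : AEStronglyMeasurable (fun x => (h x : ℂ)) μ :=
            Complex.continuous_ofReal.comp_aestronglyMeasurable hh
          have h2 : Measurable fun x => (L x : ℂ) := Complex.measurable_ofReal.comp hL
          refine AEStronglyMeasurable.mul (AEStronglyMeasurable.mul (h1.mul ?_) ?_) ?_
          · exact (h2.pow_const k).aestronglyMeasurable
          · exact (Complex.measurable_exp.comp
              ((h2.const_mul _).mul_const _)).aestronglyMeasurable
          · exact ((((h2.const_mul _).mul_const _).pow_const j).div_const _).aestronglyMeasurable)
        (fun j => Filter.Eventually.of_forall fun x => by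
          have : ‖Complex.exp (s' * L x * Complex.I)‖ = 1 := by
            rw [← Complex.ofReal_mul]; exact Complex.norm_exp_ofReal_mul_I _
          simp [this])
        (Filter.Eventually.of_forall fun x =>
          (Real.summable_pow_div_factorial _).mul_left _)
        (by
          have he : ∀ x, ∑' j : ℕ, |h x| * |L x| ^ k * ((|d| * |L x|) ^ j / (j ! : ℝ))
              = |h x| * |L x| ^ k * Real.exp (|d| * |L x|) := by
            intro x
            rw [tsum_mul_left]
            congr 1
            rw [Real.exp_eq_exp_ℝ, NormedSpace.exp_eq_tsum_div]
          simp_rw [he]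
          refine Integrable.mono' (hi.norm.const_mul (k ! / (ε / 2) ^ k)) ?_ ?_
          · have h1 : AEStronglyMeasurable (fun x => |h x|) μ := hh.norm
            have h2 : Measurable fun x => |L x| := hL.abs
            exact (h1.mul (h2.pow_const k).aestronglyMeasurable).mul
              (Real.measurable_exp.comp (h2.const_mul _)).aestronglyMeasurable
          · refine Filter.Eventually.of_forall fun x => ?_
            rw [Real.norm_of_nonneg (by positivity), norm_mul, Real.norm_eq_abs,
              Real.norm_of_nonneg (Real.exp_pos _).le]
            -- Half of the exponent `ε` absorbs `|L| ^ k`, the other half absorbs `exp(|d| |L|)`.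
            have h1 := pow_le_const_mul_exp (half_pos hε) k (abs_nonneg (L x))
            have h2 : Real.exp (|d| * |L x|) ≤ Real.exp (ε / 2 * |L x|) :=
              Real.exp_le_exp.mpr (mul_le_mul_of_nonneg_right hdn (abs_nonneg _))
            calc |h x| * |L x| ^ k * Real.exp (|d| * |L x|)
                ≤ |h x| * ((k ! / (ε / 2) ^ k) * Real.exp (ε / 2 * |L x|)) *
                    Real.exp (ε / 2 * |L x|) := by gcongr
              _ = k ! / (ε / 2) ^ k * (|h x| * Real.exp (ε * |L x|)) := by
                have : Real.exp (ε * |L x|) = Real.exp (ε / 2 * |L x|) *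
                    Real.exp (ε / 2 * |L x|) := by rw [← Real.exp_add]; congr 1; ring
                rw [this]; ring)
        (Filter.Eventually.of_forall fun x => by
          have h1 : Complex.exp (s * L x * Complex.I) =
              Complex.exp (s' * L x * Complex.I) * Complex.exp (d * L x * Complex.I) := by
            rw [← Complex.exp_add, hsd]; congr 1; push_cast; ring
          simp only [h1, ← mul_assoc]
          refine HasSum.mul_left _ ?_
          rw [Complex.exp_eq_exp_ℂ]
          exact NormedSpace.expSeries_div_hasSum_exp _)
      have hz : ∀ j : ℕ, ∫ x, (h x : ℂ) * (L x : ℂ) ^ k * Complex.exp (s' * L x * Complex.I) *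
          ((d * L x * Complex.I) ^ j / (j ! : ℂ)) ∂μ = 0 := by
        intro j
        have : ∀ x, (h x : ℂ) * (L x : ℂ) ^ k * Complex.exp (s' * L x * Complex.I) *
            ((d * L x * Complex.I) ^ j / (j ! : ℂ)) =
            ((d * Complex.I) ^ j / (j ! : ℂ)) *
              ((h x : ℂ) * (L x : ℂ) ^ (k + j) * Complex.exp (s' * L x * Complex.I)) := by
          intro x; rw [pow_add]; ring
        simp_rw [this]
        rw [integral_const_mul, ih s' hs'n (k + j), mul_zero]
      simp_rw [hz] at hsum
      exact hsum.unique hasSum_zero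
  obtain ⟨n, hn⟩ := exists_nat_ge (|s| / (ε / 2))
  have := key n s (by rwa [div_le_iff₀ (by positivity)] at hn) 0
  simpa using this

end Moments

/-! ### Injectivity of the Fourier transform on integrable densities -/

section Dual

variable {E : Type*} [NormedAddCommGroup E] [NormedSpace ℝ E] [CompleteSpace E]
  [MeasurableSpace E] [BorelSpace E] [SecondCountableTopology E]

/-- An integrable density with vanishing Fourier transform is zero. -/
lemma ae_eq_zero_of_fourier_eq_zero {μ : Measure E} {h : E → ℝ} (hm : Measurable h)
    (hi : Integrable h μ)
    (h0 : ∀ L : StrongDual ℝ E, ∫ x, (h x : ℂ) * Complex.exp (L x * Complex.I) ∂μ = 0) :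
    h =ᵐ[μ] 0 := by
  have hfin : ∀ g : E → ℝ, Integrable g μ →
      IsFiniteMeasure (μ.withDensity fun x => ENNReal.ofReal (g x)) := fun g hg =>
    isFiniteMeasure_withDensity_ofReal hg.2
  have := hfin h hi
  have := hfin (fun x => -h x) hi.neg
  -- `ENNReal.ofReal` truncates at 0, so these are the finite measures with densities `h⁺` and `h⁻`.
  -- The hypothesis says that their characteristic functions agree.
  have heq : (μ.withDensity fun x => ENNReal.ofReal (h x)) =
      μ.withDensity fun x => ENNReal.ofReal (-h x) := by
    refine Measure.ext_of_charFunDual (funext fun L => ?_)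
    have hexp : Measurable fun x => Complex.exp (L x * Complex.I) := by fun_prop
    have hnorm : ∀ x, ‖Complex.exp (L x * Complex.I)‖ = 1 := fun x =>
      Complex.norm_exp_ofReal_mul_I _
    have hI : ∀ g : E → ℝ, Integrable g μ → Integrable
        (fun x => ((max (g x) 0 : ℝ) : ℂ) * Complex.exp (L x * Complex.I)) μ := by
      intro g hg
      exact (hg.pos_part.ofReal).mul_bdd (c := 1) hexp.aestronglyMeasurable
        (Filter.Eventually.of_forall fun x => (hnorm x).le)
    have hrw : ∀ g : E → ℝ, Measurable g → charFunDual
        (μ.withDensity fun x => ENNReal.ofReal (g x)) L =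
        ∫ x, ((max (g x) 0 : ℝ) : ℂ) * Complex.exp (L x * Complex.I) ∂μ := by
      intro g hg
      rw [charFunDual_apply, integral_withDensity_eq_integral_toReal_smul
        (hg.ennreal_ofReal) (Filter.Eventually.of_forall fun x => ENNReal.ofReal_lt_top)]
      refine integral_congr_ae (Filter.Eventually.of_forall fun x => ?_)
      simp only [ENNReal.toReal_ofReal', Complex.real_smul]
    have hneg : Integrable (fun x => -h x) μ := hi.neg
    rw [hrw h hm, hrw (fun x => -h x) hm.neg, ← sub_eq_zero, ← integral_sub (hI h hi)
      (hI _ hneg), ← h0 L]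
    refine integral_congr_ae (Filter.Eventually.of_forall fun x => ?_)
    simp only [← sub_mul, ← Complex.ofReal_sub]
    congr 2
    rcases le_total (h x) 0 with hx | hx
    · rw [max_eq_right hx, max_eq_left (by linarith)]; ring
    · rw [max_eq_left hx, max_eq_right (by linarith)]; ring
  have hmn : Measurable fun x => ENNReal.ofReal (-h x) := hm.neg.ennreal_ofReal
  rw [withDensity_eq_iff hm.ennreal_ofReal.aemeasurable hmn.aemeasurable
    (by
      have := hi.2
      refine ne_of_lt (lt_of_le_of_lt (lintegral_mono fun x => ?_) this)
      exact Real.ofReal_le_enorm (h x))] at heq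
  filter_upwards [heq] with x hx
  simp only [Pi.zero_apply]
  rcases le_total (h x) 0 with h1 | h1
  · rw [ENNReal.ofReal_of_nonpos h1] at hx
    have := ENNReal.ofReal_eq_zero.mp hx.symm
    linarith
  · rw [ENNReal.ofReal_of_nonpos (by linarith : -h x ≤ 0)] at hx
    have := ENNReal.ofReal_eq_zero.mp hx
    linarith

end Dual

/-! ### Kernels with a non-negative Mercer-type expansion -/

section Mercer

variable {X : Type*} [MeasurableSpace X] {ι : Type*}

/-- The kernel `k` is the sum of the series `∑ c_i u_i ⊗ u_i` of non-negative terms on `P × P`, and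
is bounded by `1` there. -/
structure IsMercerSum (P : Set X) (c : ι → ℝ) (u : ι → X → ℝ) (k : X → X → ℝ) : Prop where
  measurable : ∀ i, Measurable (u i)
  coeff_nonneg : ∀ i, 0 ≤ c i
  nonneg : ∀ i, ∀ s ∈ P, 0 ≤ u i s
  hasSum : ∀ s ∈ P, ∀ t ∈ P, HasSum (fun i => c i * u i s * u i t) (k s t)
  le_one : ∀ s ∈ P, ∀ t ∈ P, k s t ≤ 1

namespace IsMercerSum

variable {P : Set X} {c : ι → ℝ} {u : ι → X → ℝ} {k : X → X → ℝ} {μ : Measure X}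
  {f : X → ℂ}

lemma kernel_nonneg (h : IsMercerSum P c u k) {s t : X} (hs : s ∈ P) (ht : t ∈ P) :
    0 ≤ k s t :=
  (h.hasSum s hs t ht).nonneg fun i =>
    mul_nonneg (mul_nonneg (h.coeff_nonneg i) (h.nonneg i s hs)) (h.nonneg i t ht)

lemma norm_kernel_mul_le (h : IsMercerSum P c u k) {s t : X} (hs : s ∈ P) (ht : t ∈ P) (z : ℂ) :
    ‖(k s t : ℂ) * z‖ ≤ ‖z‖ := by
  rw [norm_mul, Complex.norm_real, Real.norm_of_nonneg (h.kernel_nonneg hs ht)]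
  exact mul_le_of_le_one_left (norm_nonneg _) (h.le_one s hs t ht)

lemma norm_integral_kernel_mul_le (h : IsMercerSum P c u k) (hP : ∀ᵐ x ∂μ, x ∈ P)
    (hf : Integrable f μ) {s : X} (hs : s ∈ P) :
    ‖∫ t, (k s t : ℂ) * f t ∂μ‖ ≤ ∫ t, ‖f t‖ ∂μ := by
  refine norm_integral_le_of_norm_le hf.norm ?_
  filter_upwards [hP] with t ht
  exact h.norm_kernel_mul_le hs ht _

variable [Countable ι]

/-- Since all terms are non-negative, the dominating series sums to `k s t * ‖f t‖ ≤ ‖f t‖`, which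
is integrable. -/
lemma hasSum_integral (h : IsMercerSum P c u k) (hP : ∀ᵐ x ∂μ, x ∈ P) (hf : Integrable f μ)
    {s : X} (hs : s ∈ P) :
    HasSum (fun i => (c i * u i s : ℂ) * ∫ t, (u i t : ℂ) * f t ∂μ)
      (∫ t, (k s t : ℂ) * f t ∂μ) := by
  have key := hasSum_integral_of_dominated_convergence (μ := μ)
    (F := fun i t => ((c i * u i s * u i t : ℝ) : ℂ) * f t)
    (f := fun t => (k s t : ℂ) * f t)
    (fun i t => (c i * u i s * u i t) * ‖f t‖)
    (fun i => ((Complex.measurable_ofReal.comp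
      ((h.measurable i).const_mul _)).aestronglyMeasurable).mul hf.1)
    (fun i => by
      filter_upwards [hP] with t ht
      rw [norm_mul, Complex.norm_real, Real.norm_of_nonneg]
      exact mul_nonneg (mul_nonneg (h.coeff_nonneg i) (h.nonneg i s hs)) (h.nonneg i t ht))
    (by
      filter_upwards [hP] with t ht
      exact (h.hasSum s hs t ht).summable.mul_right _)
    (by
      have he : (fun t => ∑' i, c i * u i s * u i t * ‖f t‖) =ᵐ[μ] fun t => k s t * ‖f t‖ := by
        filter_upwards [hP] with t ht
        rw [tsum_mul_right, (h.hasSum s hs t ht).tsum_eq]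
      have hm : AEStronglyMeasurable (k s) μ := by
        refine aestronglyMeasurable_of_tendsto_ae (u := Filter.atTop) (fun F : Finset ι => ?_)
          (f := fun F t => ∑ i ∈ F, c i * u i s * u i t) ?_
        · exact (Finset.measurable_fun_sum F fun i _ =>
            (h.measurable i).const_mul _).aestronglyMeasurable
        · filter_upwards [hP] with t ht
          exact h.hasSum s hs t ht
      refine Integrable.congr ?_ he.symm
      refine Integrable.mono' hf.norm (hm.mul hf.1.norm) ?_
      filter_upwards [hP] with t ht
      have h0 : 0 ≤ k s t := (h.hasSum s hs t ht).nonneg fun i =>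
        mul_nonneg (mul_nonneg (h.coeff_nonneg i) (h.nonneg i s hs)) (h.nonneg i t ht)
      rw [norm_mul, norm_norm, Real.norm_of_nonneg h0]
      exact mul_le_of_le_one_left (norm_nonneg _) (h.le_one s hs t ht))
    (by
      filter_upwards [hP] with t ht
      exact (Complex.hasSum_ofReal.mpr (h.hasSum s hs t ht)).mul_right _)
  have e : ∀ i, (c i * u i s : ℂ) * ∫ t, (u i t : ℂ) * f t ∂μ =
      ∫ t, ((c i * u i s * u i t : ℝ) : ℂ) * f t ∂μ := by
    intro i
    rw [← integral_const_mul]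
    refine integral_congr_ae (Filter.Eventually.of_forall fun t => ?_)
    push_cast
    ring
  simpa only [e] using key

lemma integrable_kernel_mul (h : IsMercerSum P c u k) (hP : ∀ᵐ x ∂μ, x ∈ P)
    (hf : Integrable f μ) {s : X} (hs : s ∈ P) :
    Integrable (fun t => (k s t : ℂ) * f t) μ := by
  have hm : AEStronglyMeasurable (fun t => (k s t : ℂ)) μ := by
    refine aestronglyMeasurable_of_tendsto_ae (u := Filter.atTop) (fun F : Finset ι => ?_)
      (f := fun F t => ((∑ i ∈ F, c i * u i s * u i t : ℝ) : ℂ)) ?_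
    · exact (Complex.measurable_ofReal.comp (Finset.measurable_fun_sum F fun i _ =>
        (h.measurable i).const_mul _)).aestronglyMeasurable
    · filter_upwards [hP] with t ht
      exact (Complex.continuous_ofReal.tendsto _).comp (h.hasSum s hs t ht)
  refine Integrable.mono' hf.norm (hm.mul hf.1) ?_
  filter_upwards [hP] with t ht
  exact h.norm_kernel_mul_le hs ht _

/-- A function in the kernel of the integral operator is orthogonal to every `u_i` that occurs. -/
lemma integral_mul_eq_zero (h : IsMercerSum P c u k) (hP : ∀ᵐ x ∂μ, x ∈ P) (hf : Integrable f μ)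
    (h0 : ∀ᵐ s ∂μ, ∫ t, (k s t : ℂ) * f t ∂μ = 0) (i : ι) (hi : 0 < c i) :
    ∫ t, (u i t : ℂ) * f t ∂μ = 0 := by
  set a : ι → ℂ := fun i => ∫ t, (u i t : ℂ) * f t ∂μ with ha
  -- The expansion for `‖f‖` in place of `f` makes the series of the `a i` absolutely convergent,
  -- with sum at most `∫ ‖f‖` uniformly in `s`.
  have habs : ∀ s ∈ P, HasSum (fun i => c i * u i s * ∫ t, u i t * ‖f t‖ ∂μ)
      (∫ t, k s t * ‖f t‖ ∂μ) := by
    intro s hs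
    have := h.hasSum_integral hP (f := fun t => ((‖f t‖ : ℝ) : ℂ)) hf.norm.ofReal hs
    rw [← Complex.hasSum_ofReal]
    convert this using 2 with i
    · push_cast [← integral_complex_ofReal]; rfl
    · push_cast [← integral_complex_ofReal]; rfl
  have hale : ∀ i, ‖a i‖ ≤ ∫ t, u i t * ‖f t‖ ∂μ := by
    intro i
    refine (norm_integral_le_integral_norm _).trans_eq (integral_congr_ae ?_)
    filter_upwards [hP] with t ht
    rw [norm_mul, Complex.norm_real, Real.norm_of_nonneg (h.nonneg i t ht)]
  have hsm : ∀ s ∈ P, Summable (fun i => c i * u i s * ‖a i‖) := fun s hs =>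
    Summable.of_nonneg_of_le (fun i => mul_nonneg (mul_nonneg (h.coeff_nonneg i)
      (h.nonneg i s hs)) (norm_nonneg _)) (fun i => mul_le_mul_of_nonneg_left (hale i)
        (mul_nonneg (h.coeff_nonneg i) (h.nonneg i s hs))) (habs s hs).summable
  have hle : ∀ s ∈ P, ∑' i, c i * u i s * ‖a i‖ ≤ ∫ t, ‖f t‖ ∂μ := by
    intro s hs
    calc ∑' i, c i * u i s * ‖a i‖ ≤ ∑' i, c i * u i s * ∫ t, u i t * ‖f t‖ ∂μ :=
          (hsm s hs).tsum_le_tsum (fun i => mul_le_mul_of_nonneg_left (hale i)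
            (mul_nonneg (h.coeff_nonneg i) (h.nonneg i s hs))) (habs s hs).summable
      _ = ∫ t, k s t * ‖f t‖ ∂μ := (habs s hs).tsum_eq
      _ ≤ ∫ t, ‖f t‖ ∂μ := by
        refine integral_mono_of_nonneg ?_ hf.norm ?_
        · filter_upwards [hP] with t ht
          exact mul_nonneg (h.kernel_nonneg hs ht) (norm_nonneg _)
        · filter_upwards [hP] with t ht
          exact mul_le_of_le_one_left (norm_nonneg _) (h.le_one s hs t ht)
  -- Pairing the expansion of the transform with the conjugate of `f` yields `∑ c i * ‖a i‖ ^ 2`.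
  -- This must be 0, so each term is.
  have key := hasSum_integral_of_dominated_convergence (μ := μ)
    (F := fun i s => ((c i * u i s : ℝ) : ℂ) * a i * (starRingEnd ℂ) (f s))
    (f := fun s => (∫ t, (k s t : ℂ) * f t ∂μ) * (starRingEnd ℂ) (f s))
    (fun i s => c i * u i s * ‖a i‖ * ‖f s‖)
    (fun i => (((Complex.measurable_ofReal.comp
      ((h.measurable i).const_mul _)).mul_const _).aestronglyMeasurable).mul
        (Complex.continuous_conj.comp_aestronglyMeasurable hf.1))
    (fun i => by
      filter_upwards [hP] with s hs
      rw [norm_mul, norm_mul, Complex.norm_real, RCLike.norm_conj, Real.norm_of_nonneg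
        (mul_nonneg (h.coeff_nonneg i) (h.nonneg i s hs))])
    (by
      filter_upwards [hP] with s hs
      exact (hsm s hs).mul_right _)
    (by
      have he : (fun s => ∑' i, c i * u i s * ‖a i‖ * ‖f s‖) =ᵐ[μ]
          fun s => (∑' i, c i * u i s * ‖a i‖) * ‖f s‖ :=
        Filter.Eventually.of_forall fun s => tsum_mul_right
      have hm : AEStronglyMeasurable (fun s => ∑' i, c i * u i s * ‖a i‖) μ := by
        refine aestronglyMeasurable_of_tendsto_ae (u := Filter.atTop) (fun F : Finset ι => ?_)
          (f := fun F s => ∑ i ∈ F, c i * u i s * ‖a i‖) ?_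
        · exact (Finset.measurable_fun_sum F fun i _ =>
            ((h.measurable i).const_mul _).mul_const _).aestronglyMeasurable
        · filter_upwards [hP] with s hs
          exact (hsm s hs).hasSum
      refine Integrable.congr ?_ he.symm
      refine Integrable.mono' (hf.norm.const_mul (∫ t, ‖f t‖ ∂μ)) (hm.mul hf.1.norm) ?_
      filter_upwards [hP] with s hs
      rw [norm_mul, norm_norm, Real.norm_of_nonneg (tsum_nonneg fun i => mul_nonneg (mul_nonneg
        (h.coeff_nonneg i) (h.nonneg i s hs)) (norm_nonneg _))]
      exact mul_le_mul_of_nonneg_right (hle s hs) (norm_nonneg _))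
    (by
      filter_upwards [hP] with s hs
      have := (h.hasSum_integral hP hf hs).mul_right ((starRingEnd ℂ) (f s))
      simpa using this)
  have hz : ∫ s, (∫ t, (k s t : ℂ) * f t ∂μ) * (starRingEnd ℂ) (f s) ∂μ = 0 := by
    rw [integral_eq_zero_of_ae]
    filter_upwards [h0] with s hs
    simp [hs]
  have hterm : ∀ i, ∫ s, ((c i * u i s : ℝ) : ℂ) * a i * (starRingEnd ℂ) (f s) ∂μ
      = ((c i * ‖a i‖ ^ 2 : ℝ) : ℂ) := by
    intro i
    have : ∀ s, ((c i * u i s : ℝ) : ℂ) * a i * (starRingEnd ℂ) (f s)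
        = (c i * a i) * (starRingEnd ℂ) ((u i s : ℂ) * f s) := by
      intro s; simp only [map_mul, Complex.conj_ofReal]; push_cast; ring
    simp_rw [this]
    rw [integral_const_mul, integral_conj, mul_assoc, Complex.mul_conj]
    push_cast
    rw [← Complex.ofReal_pow, Complex.normSq_eq_norm_sq]
  simp_rw [hterm, hz] at key
  rw [← Complex.ofReal_zero, Complex.hasSum_ofReal,
    hasSum_zero_iff_of_nonneg (fun i => mul_nonneg (h.coeff_nonneg i) (sq_nonneg _))] at key
  have := congrFun key i
  simp only [Pi.zero_apply, mul_eq_zero, hi.ne', false_or] at this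
  simpa using this

end IsMercerSum

end Mercer

/-! ### Positive definite matrices -/

section PosDef

/-- Hadamard's inequality. -/
lemma det_le_prod_diag {n : Type*} [Fintype n] [DecidableEq n] {Y : Matrix n n ℝ}
    (hY : Y.PosDef) : Y.det ≤ ∏ i, Y i i := by
  have hd : ∀ i, 0 < Y i i := fun i => hY.diag_pos
  set d : n → ℝ := fun i => (√(Y i i))⁻¹ with hddef
  have hdpos : ∀ i, 0 < d i := fun i => inv_pos.mpr (Real.sqrt_pos.mpr (hd i))
  have hdd : ∀ i, d i * d i = (Y i i)⁻¹ := fun i => by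
    rw [hddef, ← mul_inv, Real.mul_self_sqrt (hd i).le]
  -- Rescaled to unit diagonal, the trace is the number of rows, and `x ≤ exp(x - 1)` at the
  -- eigenvalues bounds the determinant by `exp 0 = 1`.
  set Z : Matrix n n ℝ := Matrix.diagonal d * Y * (Matrix.diagonal d)ᴴ with hZ
  have hU : IsUnit (Matrix.diagonal d) := by
    rw [Matrix.isUnit_diagonal, Pi.isUnit_iff]
    exact fun i => (hdpos i).ne'.isUnit
  have hZpos : Z.PosDef := hY.mul_mul_conjTranspose_same (Matrix.vecMul_injective_of_isUnit hU)
  have hZii : ∀ i, Z i i = 1 := fun i => by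
    simp only [hZ, Matrix.diagonal_conjTranspose, Matrix.mul_diagonal, Matrix.diagonal_mul,
      star_trivial]
    rw [mul_right_comm, hdd, inv_mul_cancel₀ (hd i).ne']
  have hZdet : Z.det = Y.det * (∏ i, Y i i)⁻¹ := by
    rw [hZ, Matrix.det_mul, Matrix.det_mul, Matrix.diagonal_conjTranspose, Matrix.det_diagonal,
      Matrix.det_diagonal, mul_right_comm, ← Finset.prod_mul_distrib]
    simp only [Pi.star_apply, star_trivial, hdd, Finset.prod_inv_distrib]
    ring
  have hZ1 : Z.det ≤ 1 := by
    rw [hZpos.isHermitian.det_eq_prod_eigenvalues]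
    have htr := hZpos.isHermitian.trace_eq_sum_eigenvalues
    simp only [Matrix.trace, Matrix.diag_apply, hZii, RCLike.ofReal_real_eq_id, id_eq] at htr ⊢
    calc ∏ i, hZpos.isHermitian.eigenvalues i
        ≤ ∏ i, Real.exp (hZpos.isHermitian.eigenvalues i - 1) :=
          Finset.prod_le_prod (fun i _ => (hZpos.eigenvalues_pos i).le) fun i _ => by
            linarith [Real.add_one_le_exp (hZpos.isHermitian.eigenvalues i - 1)]
      _ = 1 := by rw [← Real.exp_sum, Finset.sum_sub_distrib, ← htr, sub_self, Real.exp_zero]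
  rw [hZdet] at hZ1
  have hP : 0 < ∏ i, Y i i := Finset.prod_pos fun i _ => hd i
  rwa [← div_eq_mul_inv, div_le_one hP] at hZ1

variable {m : ℕ}

lemma posDef_submatrix_castLE {Y : Matrix (Fin m) (Fin m) ℝ} (hY : Y.PosDef) (i : Fin m) :
    (Y.submatrix (Fin.castLE (Nat.succ_le_of_lt i.isLt))
      (Fin.castLE (Nat.succ_le_of_lt i.isLt))).PosDef :=
  hY.submatrix (Fin.castLE_injective _)

lemma leadingMinor_pos {Y : Matrix (Fin m) (Fin m) ℝ} (hY : Y.PosDef) (i : Fin m) :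
    0 < leadingMinor Y i :=
  (posDef_submatrix_castLE hY i).det_pos

lemma prod_castLE {M : Type*} [CommMonoid M] (f : Fin m → M) (i : Fin m) :
    ∏ l : Fin (i + 1), f (Fin.castLE (Nat.succ_le_of_lt i.isLt) l) =
      ∏ l : Fin m with l ≤ i, f l := by
  refine Finset.prod_bij (fun l _ => Fin.castLE (Nat.succ_le_of_lt i.isLt) l) ?_ ?_ ?_ ?_
  · intro l _
    simp only [Finset.mem_filter_univ, Fin.le_def, Fin.val_castLE]
    exact Nat.lt_succ_iff.mp l.isLt
  · intro a _ b _ h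
    exact Fin.castLE_injective _ h
  · intro l hl
    simp only [Finset.mem_filter_univ, Fin.le_def] at hl
    exact ⟨⟨l, Nat.lt_succ_iff.mpr hl⟩, Finset.mem_univ _, rfl⟩
  · intro _ _; rfl

lemma leadingMinor_le {Y : Matrix (Fin m) (Fin m) ℝ} (hY : Y.PosDef) (i : Fin m) :
    leadingMinor Y i ≤ ∏ l : Fin m with l ≤ i, Y l l := by
  rw [← prod_castLE (fun l => Y l l) i]
  exact det_le_prod_diag (posDef_submatrix_castLE hY i)

lemma leadingMinor_smul (c : ℝ) (Y : Matrix (Fin m) (Fin m) ℝ) (i : Fin m) :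
    leadingMinor (c • Y) i = c ^ ((i : ℕ) + 1) * leadingMinor Y i := by
  have h := Matrix.det_smul (Y.submatrix (Fin.castLE (Nat.succ_le_of_lt i.isLt))
    (Fin.castLE (Nat.succ_le_of_lt i.isLt))) c
  rw [Fintype.card_fin] at h
  exact h

lemma leadingMinor_one (i : Fin m) : leadingMinor (1 : Matrix (Fin m) (Fin m) ℝ) i = 1 := by
  rw [leadingMinor, Matrix.submatrix_one _ (Fin.castLE_injective _), Matrix.det_one]

lemma continuous_leadingMinor (i : Fin m) :
    Continuous fun Y : Matrix (Fin m) (Fin m) ℝ => leadingMinor Y i :=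
  Continuous.matrix_det (continuous_id.matrix_submatrix _ _)

lemma orthogonal_mul_transpose (H : Matrix.orthogonalGroup (Fin m) ℝ) :
    (H : Matrix (Fin m) (Fin m) ℝ) * (H : Matrix (Fin m) (Fin m) ℝ)ᵀ = 1 := by
  simpa [Matrix.star_eq_conjTranspose] using (Matrix.mem_orthogonalGroup_iff (Fin m) ℝ).mp H.2

lemma orthogonal_transpose_mul (H : Matrix.orthogonalGroup (Fin m) ℝ) :
    (H : Matrix (Fin m) (Fin m) ℝ)ᵀ * (H : Matrix (Fin m) (Fin m) ℝ) = 1 := by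
  simpa [Matrix.star_eq_conjTranspose] using (Matrix.mem_orthogonalGroup_iff' (Fin m) ℝ).mp H.2

lemma isUnit_orthogonal (H : Matrix.orthogonalGroup (Fin m) ℝ) :
    IsUnit (H : Matrix (Fin m) (Fin m) ℝ) :=
  ⟨⟨_, _, orthogonal_mul_transpose H, orthogonal_transpose_mul H⟩, rfl⟩

lemma posDef_conj {Y : Matrix (Fin m) (Fin m) ℝ} (hY : Y.PosDef)
    (H : Matrix.orthogonalGroup (Fin m) ℝ) :
    ((H : Matrix (Fin m) (Fin m) ℝ) * Y * (H : Matrix (Fin m) (Fin m) ℝ)ᵀ).PosDef := by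
  have := hY.mul_mul_conjTranspose_same (Matrix.vecMul_injective_of_isUnit (isUnit_orthogonal H))
  rwa [Matrix.conjTranspose_eq_transpose_of_trivial] at this

lemma trace_conj (Y : Matrix (Fin m) (Fin m) ℝ) (H : Matrix.orthogonalGroup (Fin m) ℝ) :
    ((H : Matrix (Fin m) (Fin m) ℝ) * Y * (H : Matrix (Fin m) (Fin m) ℝ)ᵀ).trace = Y.trace := by
  rw [Matrix.trace_mul_comm, ← Matrix.mul_assoc, orthogonal_transpose_mul, Matrix.one_mul]

lemma det_conj (Y : Matrix (Fin m) (Fin m) ℝ) (H : Matrix.orthogonalGroup (Fin m) ℝ) :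
    ((H : Matrix (Fin m) (Fin m) ℝ) * Y * (H : Matrix (Fin m) (Fin m) ℝ)ᵀ).det = Y.det := by
  rw [Matrix.det_mul_comm, ← Matrix.mul_assoc, orthogonal_transpose_mul, Matrix.one_mul]

lemma continuous_conj : Continuous fun p : Matrix (Fin m) (Fin m) ℝ ×
    Matrix.orthogonalGroup (Fin m) ℝ =>
      (p.2 : Matrix (Fin m) (Fin m) ℝ) * p.1 * (p.2 : Matrix (Fin m) (Fin m) ℝ)ᵀ := by
  have h : Continuous fun p : Matrix (Fin m) (Fin m) ℝ × Matrix.orthogonalGroup (Fin m) ℝ =>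
      (p.2 : Matrix (Fin m) (Fin m) ℝ) := continuous_subtype_val.comp continuous_snd
  exact (h.matrix_mul continuous_fst).matrix_mul h.matrix_transpose

lemma isClosed_posSemidef : IsClosed {Y : Matrix (Fin m) (Fin m) ℝ | Y.PosSemidef} := by
  have : {Y : Matrix (Fin m) (Fin m) ℝ | Y.PosSemidef} =
      {Y | Yᴴ = Y} ∩ ⋂ x : Fin m → ℝ, {Y | 0 ≤ star x ⬝ᵥ (Y *ᵥ x)} := by
    ext Y
    simp only [Set.mem_ofPred_eq, Set.mem_inter_iff, Set.mem_iInter,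
      Matrix.posSemidef_iff_dotProduct_mulVec, Matrix.IsHermitian]
  rw [this]
  refine IsClosed.inter ?_ (isClosed_iInter fun x => ?_)
  · exact isClosed_eq continuous_id.matrix_conjTranspose continuous_id
  · exact isClosed_le continuous_const
      (Continuous.dotProduct continuous_const (continuous_id.matrix_mulVec continuous_const))

lemma measurableSet_posDefCone : MeasurableSet (posDefCone m) := by
  have : posDefCone m = {Y | Y.PosSemidef} ∩ {Y | Y.det ≠ 0} := by
    ext Y
    refine ⟨fun h => ⟨h.posSemidef, h.det_pos.ne'⟩, fun ⟨h1, h2⟩ => ?_⟩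
    rw [posDefCone, Set.mem_ofPred_eq, h1.isHermitian.posDef_iff_eigenvalues_pos]
    intro i
    refine lt_of_le_of_ne (h1.eigenvalues_nonneg i) fun h => h2 ?_
    rw [h1.isHermitian.det_eq_prod_eigenvalues]
    exact Finset.prod_eq_zero (Finset.mem_univ i) (by simp [← h])
  rw [this]
  have hdet : Continuous fun Y : Matrix (Fin m) (Fin m) ℝ => Y.det :=
    Continuous.matrix_det continuous_id
  exact isClosed_posSemidef.measurableSet.inter
    (isOpen_ne_fun hdet continuous_const).measurableSet

end PosDef

variable {m : ℕ}

/-! ### Partitions -/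

section Partitions

lemma mem_partitions {k : ℕ} {κ : Fin m → ℕ} :
    κ ∈ partitions m k ↔ ∑ i, κ i = k ∧ Antitone κ := by
  simp [partitions]

/-- The gaps are `Fin.invAccumulate`, so the sum telescopes; monotonicity makes the truncated
subtraction exact. -/
lemma sum_partGap {κ : Fin m → ℕ} (hκ : Antitone κ) (j : Fin m) :
    ∑ i : Fin m with j ≤ i, partGap κ i = κ j := by
  have h := congrFun (Fin.accumulate_invAccumulate le_rfl hκ) j
  rw [Fin.accumulate_apply] at h
  rw [← h]
  refine Finset.sum_congr rfl fun i _ => ?_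
  simp [partGap, Fin.invAccumulate]

/-- Summation by parts in the exponents. It turns bounds of minors by products of diagonal entries
into monomials with exponent `κ`. -/
lemma prod_pow_partGap {M : Type*} [CommMonoid M] {κ : Fin m → ℕ} (hκ : Antitone κ)
    (y : Fin m → M) :
    ∏ i, (∏ l : Fin m with l ≤ i, y l) ^ partGap κ i = ∏ l, y l ^ κ l := by
  simp_rw [← Finset.prod_pow, Finset.prod_filter]
  rw [Finset.prod_comm]
  refine Finset.prod_congr rfl fun l _ => ?_
  rw [← sum_partGap hκ l, ← Finset.prod_pow_eq_pow_sum, Finset.prod_filter]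

/-- The minor with index `i` has degree `i + 1`, so this is the degree of the product of minors. -/
lemma sum_mul_partGap {κ : Fin m → ℕ} (hκ : Antitone κ) :
    ∑ i : Fin m, ((i : ℕ) + 1) * partGap κ i = ∑ i, κ i := by
  simp_rw [← sum_partGap hκ, Finset.sum_filter]
  rw [Finset.sum_comm]
  refine Finset.sum_congr rfl fun i _ => ?_
  rw [← Finset.sum_filter, Finset.sum_const, smul_eq_mul]
  congr 1
  have : (Finset.univ.filter fun l : Fin m => l ≤ i) = Finset.Iic i := by ext; simp
  rw [this, Fin.card_Iic]

lemma eq_zero_of_length_le {κ : Fin m → ℕ} (hκ : Antitone κ) {i : Fin m}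
    (hi : length κ ≤ i) : κ i = 0 := by
  by_contra h
  have : (Finset.Iic i).card ≤ length κ := by
    refine Finset.card_le_card fun l hl => ?_
    simp only [Finset.mem_filter_univ]
    have := hκ (Finset.mem_Iic.mp hl)
    omega
  rw [Fin.card_Iic] at this
  omega

lemma length_le (κ : Fin m → ℕ) : length κ ≤ m :=
  (Finset.card_filter_le _ _).trans_eq (by simp)

lemma ascPochhammer_eval_mono {a b : ℝ} (ha : 0 < a) (hab : a ≤ b) (n : ℕ) :
    (ascPochhammer ℝ n).eval a ≤ (ascPochhammer ℝ n).eval b := by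
  induction n with
  | zero => simp
  | succ n ih =>
    rw [ascPochhammer_succ_eval, ascPochhammer_succ_eval]
    exact mul_le_mul ih (by linarith) (by positivity)
      (ascPochhammer_pos n b (ha.trans_le hab)).le

lemma half_sub_half_pos (i : Fin m) : (0 : ℝ) < (m : ℝ) / 2 - ((i : ℕ) : ℝ) / 2 := by
  have : ((i : ℕ) : ℝ) < m := by exact_mod_cast i.isLt
  linarith

lemma shiftedFactorial_pos {a : ℝ} (ha : (m : ℝ) / 2 ≤ a) (κ : Fin m → ℕ) :
    0 < shiftedFactorial a κ :=
  Finset.prod_pos fun i _ => ascPochhammer_pos _ _ (by linarith [half_sub_half_pos i])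

lemma shiftedFactorial_mono {a : ℝ} (ha : (m : ℝ) / 2 ≤ a) (κ : Fin m → ℕ) :
    shiftedFactorial ((m : ℝ) / 2) κ ≤ shiftedFactorial a κ :=
  Finset.prod_le_prod (fun i _ => (ascPochhammer_pos _ _ (half_sub_half_pos i)).le) fun i _ =>
    ascPochhammer_eval_mono (half_sub_half_pos i) (by linarith) _

lemma hook_factor_pos {κ : Fin m → ℕ} (hκ : Antitone κ) {i j : Fin m} (hij : i < j) :
    (0 : ℝ) < 2 * (κ i : ℝ) - 2 * (κ j : ℝ) - ((i : ℕ) : ℝ) + ((j : ℕ) : ℝ) := by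
  have h1 : (κ j : ℝ) ≤ κ i := by exact_mod_cast hκ hij.le
  have h2 : ((i : ℕ) : ℝ) < ((j : ℕ) : ℝ) := by exact_mod_cast hij
  linarith

lemma zonalAtOne_pos {κ : Fin m → ℕ} (hκ : Antitone κ) : 0 < zonalAtOne κ := by
  unfold zonalAtOne
  refine div_pos (mul_pos (mul_pos (by positivity) (shiftedFactorial_pos le_rfl κ)) ?_) ?_
  · refine Finset.prod_pos fun p hp => hook_factor_pos hκ ?_
    exact (Finset.mem_filter.mp hp).2.1
  · exact Finset.prod_pos fun i _ => by positivity

/-- The quotient of the two factorials is a product of numbers `2 * κ i + (j - i)` over `i < j <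
length κ`, and each factor on the left is smaller than its counterpart by `2 * κ j`. -/
lemma prod_hook_le {κ : Fin m → ℕ} (hκ : Antitone κ) (i : Fin m)
    (hi : (i : ℕ) < length κ) :
    (∏ j : Fin m with i < j ∧ ((j : Fin m) : ℕ) < length κ,
      (2 * (κ i : ℝ) - 2 * (κ j : ℝ) - ((i : ℕ) : ℝ) + ((j : ℕ) : ℝ))) * ((2 * κ i)! : ℝ) ≤
      ((2 * κ i + (length κ - ((i : ℕ) + 1)))! : ℝ) := by
  rw [← Nat.factorial_mul_ascFactorial, Nat.cast_mul, mul_comm, Nat.ascFactorial_eq_prod_range,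
    Nat.cast_prod]
  refine mul_le_mul_of_nonneg_left ?_ (by positivity)
  have hb : ∏ t ∈ Finset.range (length κ - ((i : ℕ) + 1)), ((2 * κ i + 1 + t : ℕ) : ℝ) =
      ∏ j : Fin m with i < j ∧ ((j : Fin m) : ℕ) < length κ,
        (2 * (κ i : ℝ) - ((i : ℕ) : ℝ) + ((j : ℕ) : ℝ)) := by
    symm
    refine Finset.prod_bij (fun (j : Fin m) _ => (j : ℕ) - ((i : ℕ) + 1)) ?_ ?_ ?_ ?_
    · intro j hj
      simp only [Finset.mem_filter_univ, Fin.lt_def, Finset.mem_range] at hj ⊢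
      omega
    · intro a ha b hb hab
      simp only [Finset.mem_filter_univ, Fin.lt_def] at ha hb
      exact Fin.ext (by omega)
    · intro t ht
      rw [Finset.mem_range] at ht
      have := length_le κ
      refine ⟨⟨(i : ℕ) + 1 + t, by omega⟩, ?_, by simp⟩
      simp only [Finset.mem_filter_univ, Fin.lt_def]
      omega
    · intro j hj
      simp only [Finset.mem_filter_univ, Fin.lt_def] at hj
      have : ((j : ℕ) : ℝ) = (((j : ℕ) - ((i : ℕ) + 1) : ℕ) : ℝ) + (i : ℕ) + 1 := by
        norm_cast; omega
      rw [this]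
      push_cast
      ring
  rw [hb]
  refine Finset.prod_le_prod (fun j hj => (hook_factor_pos hκ (Finset.mem_filter.mp hj).2.1).le)
    fun j _ => ?_
  have : (0 : ℝ) ≤ κ j := by positivity
  linarith

/-- The coefficients of the kernel `K₀` in its expansion into products of spherical means. -/
noncomputable def kernelCoeff (α : ℝ) (κ : Fin m → ℕ) : ℝ :=
  zonalAtOne κ / (((∑ i, κ i)! : ℝ) * (α ^ 2) ^ (∑ i, κ i) * shiftedFactorial α κ)

lemma kernelCoeff_pos {α : ℝ} (hα0 : 0 < α) (hα : (m : ℝ) / 2 ≤ α) {κ : Fin m → ℕ}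
    (hκ : Antitone κ) : 0 < kernelCoeff α κ :=
  div_pos (zonalAtOne_pos hκ)
    (mul_pos (by positivity) (shiftedFactorial_pos hα κ))

lemma prod_pairs_eq (κ : Fin m → ℕ) :
    (∏ p : Fin m × Fin m with p.1 < p.2 ∧ (p.2 : ℕ) < length κ,
      (2 * (κ p.1 : ℝ) - 2 * (κ p.2 : ℝ) - ((p.1 : ℕ) : ℝ) + ((p.2 : ℕ) : ℝ))) =
    ∏ i : Fin m with ((i : Fin m) : ℕ) < length κ, ∏ j : Fin m with i < j ∧ ((j : Fin m) : ℕ) < length κ,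
      (2 * (κ i : ℝ) - 2 * (κ j : ℝ) - ((i : ℕ) : ℝ) + ((j : ℕ) : ℝ)) := by
  rw [Finset.prod_sigma']
  refine Finset.prod_bij (fun p _ => ⟨p.1, p.2⟩) ?_ ?_ ?_ ?_
  · intro p hp
    simp only [Finset.mem_filter_univ, Finset.mem_sigma, Fin.lt_def] at hp ⊢
    exact ⟨by omega, hp⟩
  · intro a _ b _ h
    simpa [Prod.ext_iff, Fin.ext_iff] using h
  · rintro ⟨i, j⟩ h
    simp only [Finset.mem_filter_univ, Finset.mem_sigma] at h
    exact ⟨(i, j), by simpa using h.2, rfl⟩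
  · intro _ _; rfl

/-- Two quotients are at most 1: `[m/2]_κ / [α]_κ`, because `m/2 ≤ α`, and the pair factors against
the excess of `(2k_i + ℓ - i)!` over `(2k_i)!`. What is left are coefficients of a product of cosh
series. -/
lemma kernelCoeff_le {α : ℝ} (hα0 : 0 < α) (hα : (m : ℝ) / 2 ≤ α) {κ : Fin m → ℕ}
    (hκ : Antitone κ) :
    kernelCoeff α κ ≤ ∏ i, ((2 / α) ^ (2 * κ i) / ((2 * κ i)! : ℝ)) := by
  have hN : (∏ p : Fin m × Fin m with p.1 < p.2 ∧ (p.2 : ℕ) < length κ,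
      (2 * (κ p.1 : ℝ) - 2 * (κ p.2 : ℝ) - ((p.1 : ℕ) : ℝ) + ((p.2 : ℕ) : ℝ))) *
      ∏ i, ((2 * κ i)! : ℝ) ≤
      ∏ i : Fin m with ((i : Fin m) : ℕ) < length κ,
        ((2 * κ i + (length κ - ((i : ℕ) + 1)))! : ℝ) := by
    -- The parts from index `length κ` on are 0 and contribute `0! = 1`.
    have h1 : ∏ i, ((2 * κ i)! : ℝ) =
        ∏ i : Fin m with ((i : Fin m) : ℕ) < length κ, ((2 * κ i)! : ℝ) := by
      symm
      refine Finset.prod_subset (Finset.subset_univ _) fun i _ hi => ?_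
      have hi' : length κ ≤ i := by simpa using hi
      simp [eq_zero_of_length_le hκ hi']
    rw [h1, prod_pairs_eq, ← Finset.prod_mul_distrib]
    refine Finset.prod_le_prod (fun i hi => mul_nonneg (Finset.prod_nonneg fun j hj =>
      (hook_factor_pos hκ (Finset.mem_filter.mp hj).2.1).le) (by positivity)) fun i hi => ?_
    exact prod_hook_le hκ i (Finset.mem_filter.mp hi).2
  set N := ∏ p : Fin m × Fin m with p.1 < p.2 ∧ (p.2 : ℕ) < length κ,
      (2 * (κ p.1 : ℝ) - 2 * (κ p.2 : ℝ) - ((p.1 : ℕ) : ℝ) + ((p.2 : ℕ) : ℝ)) with hNdef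
  set D := ∏ i : Fin m with ((i : Fin m) : ℕ) < length κ,
        ((2 * κ i + (length κ - ((i : ℕ) + 1)))! : ℝ) with hDdef
  have hDpos : 0 < D := Finset.prod_pos fun i _ => by positivity
  have hNpos : 0 < N := Finset.prod_pos fun p hp => hook_factor_pos hκ (Finset.mem_filter.mp hp).2.1
  have hFpos : 0 < ∏ i, ((2 * κ i)! : ℝ) := Finset.prod_pos fun i _ => by positivity
  have hs := shiftedFactorial_pos hα κ
  have hs' := shiftedFactorial_mono hα κ
  have hs0 := shiftedFactorial_pos (m := m) le_rfl κ
  have hpow : ∏ i, (2 / α) ^ (2 * κ i) = (2 ^ 2 / α ^ 2) ^ (∑ i, κ i) := by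
    simp_rw [pow_mul]
    rw [Finset.prod_pow_eq_pow_sum, div_pow]
  rw [Finset.prod_div_distrib, hpow]
  have hz : zonalAtOne κ = (2 ^ 2) ^ (∑ i, κ i) * ((∑ i, κ i)! : ℝ) *
      shiftedFactorial ((m : ℝ) / 2) κ * N / D := by
    rw [zonalAtOne, pow_mul]
  have hk : (0 : ℝ) < ((∑ i, κ i)! : ℝ) := by positivity
  have hα2 : 0 < (α ^ 2) ^ (∑ i, κ i) := by positivity
  rw [kernelCoeff, hz, div_pow, div_div, div_div, div_le_div_iff₀ (by positivity) (by positivity)]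
  have key : shiftedFactorial ((m : ℝ) / 2) κ * (N * ∏ i, ((2 * κ i)! : ℝ)) ≤
      shiftedFactorial α κ * D := mul_le_mul hs' hN (by positivity) hs.le
  have hc : (0 : ℝ) ≤ (2 ^ 2) ^ (∑ i, κ i) * ((∑ i, κ i)! : ℝ) * (α ^ 2) ^ (∑ i, κ i) := by
    positivity
  have := mul_le_mul_of_nonneg_left key hc
  linarith

end Partitions

/-! ### Haar measure on the orthogonal group -/

section Haar

instance : IsProbabilityMeasure (haarO m) :=
  ⟨by simpa [haarO] using Measure.haarMeasure_self (K₀ := (⊤ : TopologicalSpace.PositiveCompacts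
    (Matrix.orthogonalGroup (Fin m) ℝ)))⟩

instance : (haarO m).IsHaarMeasure := by
  unfold haarO; infer_instance

/-- A right translate of normalized Haar measure is again a Haar probability measure, hence the same
one by uniqueness. -/
instance : (haarO m).IsMulRightInvariant := ⟨fun g => by
  have : IsProbabilityMeasure (Measure.map (· * g) (haarO m)) :=
    Measure.isProbabilityMeasure_map (measurable_mul_const g).aemeasurable
  exact Measure.isHaarMeasure_eq_of_isProbabilityMeasure _ _⟩

end Haar

/-! ### Spherical means of products of leading minors -/

section SphericalMean

/-- The product of powers of leading minors attached to a partition. -/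
noncomputable def minorProd (κ : Fin m → ℕ) (Y : Matrix (Fin m) (Fin m) ℝ) : ℝ :=
  ∏ i, leadingMinor Y i ^ partGap κ i

/-- The normalized zonal polynomial. -/
noncomputable def sphericalMean (κ : Fin m → ℕ) (Y : Matrix (Fin m) (Fin m) ℝ) : ℝ :=
  ∫ H : Matrix.orthogonalGroup (Fin m) ℝ,
    minorProd κ ((H : Matrix (Fin m) (Fin m) ℝ) * Y * (H : Matrix (Fin m) (Fin m) ℝ)ᵀ) ∂haarO m

lemma zonal_eq (κ : Fin m → ℕ) (Y : Matrix (Fin m) (Fin m) ℝ) :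
    zonal κ Y = zonalAtOne κ * sphericalMean κ Y := rfl

lemma continuous_minorProd (κ : Fin m → ℕ) :
    Continuous fun Y : Matrix (Fin m) (Fin m) ℝ => minorProd κ Y :=
  continuous_finsetProd _ fun i _ => (continuous_leadingMinor i).pow _

lemma continuous_minorProd_conj (κ : Fin m → ℕ) (Y : Matrix (Fin m) (Fin m) ℝ) :
    Continuous fun H : Matrix.orthogonalGroup (Fin m) ℝ =>
      minorProd κ ((H : Matrix (Fin m) (Fin m) ℝ) * Y * (H : Matrix (Fin m) (Fin m) ℝ)ᵀ) :=
  (continuous_minorProd κ).comp (continuous_conj.comp (Continuous.prodMk_right Y))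

lemma integrable_haarO {E : Type*} [NormedAddCommGroup E]
    {g : Matrix.orthogonalGroup (Fin m) ℝ → E} (hg : Continuous g) : Integrable g (haarO m) :=
  hg.integrable_of_hasCompactSupport (HasCompactSupport.of_compactSpace g)

lemma integral_haarO_le {g : Matrix.orthogonalGroup (Fin m) ℝ → ℝ} (hg : Continuous g) {C : ℝ}
    (h : ∀ H, g H ≤ C) : ∫ H, g H ∂haarO m ≤ C := by
  calc ∫ H, g H ∂haarO m ≤ ∫ _, C ∂haarO m :=
        integral_mono (integrable_haarO hg) (integrable_const _) h
    _ = C := by simp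

lemma minorProd_pos (κ : Fin m → ℕ) {Y : Matrix (Fin m) (Fin m) ℝ} (hY : Y.PosDef) :
    0 < minorProd κ Y :=
  Finset.prod_pos fun i _ => pow_pos (leadingMinor_pos hY i) _

lemma minorProd_le {κ : Fin m → ℕ} (hκ : Antitone κ) {Y : Matrix (Fin m) (Fin m) ℝ}
    (hY : Y.PosDef) : minorProd κ Y ≤ ∏ i, Y i i ^ κ i := by
  rw [← prod_pow_partGap hκ]
  exact Finset.prod_le_prod (fun i _ => (pow_pos (leadingMinor_pos hY i) _).le) fun i _ =>
    pow_le_pow_left₀ (leadingMinor_pos hY i).le (leadingMinor_le hY i) _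

lemma minorProd_smul {κ : Fin m → ℕ} (hκ : Antitone κ) (c : ℝ) (Y : Matrix (Fin m) (Fin m) ℝ) :
    minorProd κ (c • Y) = c ^ (∑ i, κ i) * minorProd κ Y := by
  simp_rw [minorProd, leadingMinor_smul, mul_pow, ← pow_mul]
  rw [Finset.prod_mul_distrib, Finset.prod_pow_eq_pow_sum, sum_mul_partGap hκ]

lemma sphericalMean_nonneg (κ : Fin m → ℕ) {Y : Matrix (Fin m) (Fin m) ℝ} (hY : Y.PosDef) :
    0 ≤ sphericalMean κ Y :=
  integral_nonneg fun H => (minorProd_pos κ (posDef_conj hY H)).le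

lemma sphericalMean_one (κ : Fin m → ℕ) :
    sphericalMean κ (1 : Matrix (Fin m) (Fin m) ℝ) = 1 := by
  simp [sphericalMean, orthogonal_mul_transpose, minorProd, leadingMinor_one]

lemma sphericalMean_smul {κ : Fin m → ℕ} (hκ : Antitone κ) (c : ℝ)
    (Y : Matrix (Fin m) (Fin m) ℝ) :
    sphericalMean κ (c • Y) = c ^ (∑ i, κ i) * sphericalMean κ Y := by
  simp_rw [sphericalMean, Matrix.mul_smul, Matrix.smul_mul, minorProd_smul hκ]
  rw [integral_const_mul]

lemma sphericalMean_conj (κ : Fin m → ℕ) (Y : Matrix (Fin m) (Fin m) ℝ)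
    (G : Matrix.orthogonalGroup (Fin m) ℝ) :
    sphericalMean κ ((G : Matrix (Fin m) (Fin m) ℝ) * Y * (G : Matrix (Fin m) (Fin m) ℝ)ᵀ) =
      sphericalMean κ Y := by
  unfold sphericalMean
  rw [← integral_mul_right_eq_self (μ := haarO m) (fun H : Matrix.orthogonalGroup (Fin m) ℝ =>
    minorProd κ ((H : Matrix (Fin m) (Fin m) ℝ) * Y * (H : Matrix (Fin m) (Fin m) ℝ)ᵀ)) G]
  refine integral_congr_ae (Filter.Eventually.of_forall fun H => ?_)
  simp only [Submonoid.coe_mul, Matrix.transpose_mul, Matrix.mul_assoc]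

instance : SecondCountableTopology (Matrix (Fin m) (Fin m) ℝ) :=
  inferInstanceAs (SecondCountableTopology (Fin m → Fin m → ℝ))

lemma measurable_sphericalMean (κ : Fin m → ℕ) :
    Measurable fun Y : Matrix (Fin m) (Fin m) ℝ => sphericalMean κ Y := by
  have h : Continuous fun p : Matrix (Fin m) (Fin m) ℝ × Matrix.orthogonalGroup (Fin m) ℝ =>
      minorProd κ ((p.2 : Matrix (Fin m) (Fin m) ℝ) * p.1 *
        (p.2 : Matrix (Fin m) (Fin m) ℝ)ᵀ) :=
    (continuous_minorProd κ).comp continuous_conj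
  exact (h.stronglyMeasurable.integral_prod_right' (ν := haarO m)).measurable

/-- The permutation matrix of `σ`, as an element of the orthogonal group. -/
noncomputable def permOrthogonal (σ : Equiv.Perm (Fin m)) : Matrix.orthogonalGroup (Fin m) ℝ :=
  ⟨σ.permMatrix ℝ, by
    rw [Matrix.mem_orthogonalGroup_iff, Matrix.transpose_permMatrix, ← Matrix.permMatrix_mul]
    simp⟩

lemma permOrthogonal_conj (σ : Equiv.Perm (Fin m)) (Y : Matrix (Fin m) (Fin m) ℝ) :
    (permOrthogonal σ : Matrix (Fin m) (Fin m) ℝ) * Y *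
      (permOrthogonal σ : Matrix (Fin m) (Fin m) ℝ)ᵀ = Y.submatrix σ σ := by
  simp only [permOrthogonal, Matrix.transpose_permMatrix, Equiv.Perm.permMatrix]
  rw [PEquiv.toMatrix_toPEquiv_mul, PEquiv.mul_toMatrix_toPEquiv]
  rfl

/-- Transposition matrices belong to `O(m)`, so all diagonal entries have the same mean, and these
means add up to the trace. This evaluates the zonal polynomial of weight 1. -/
lemma integral_conj_diag (Y : Matrix (Fin m) (Fin m) ℝ) (i : Fin m) :
    ∫ H : Matrix.orthogonalGroup (Fin m) ℝ, ((H : Matrix (Fin m) (Fin m) ℝ) * Y *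
      (H : Matrix (Fin m) (Fin m) ℝ)ᵀ) i i ∂haarO m = Y.trace / m := by
  have hc : ∀ j : Fin m, Continuous fun H : Matrix.orthogonalGroup (Fin m) ℝ =>
      ((H : Matrix (Fin m) (Fin m) ℝ) * Y * (H : Matrix (Fin m) (Fin m) ℝ)ᵀ) j j := fun j =>
    (continuous_conj.comp (Continuous.prodMk_right Y)).matrix_elem j j
  have heq : ∀ j : Fin m, ∫ H : Matrix.orthogonalGroup (Fin m) ℝ,
      ((H : Matrix (Fin m) (Fin m) ℝ) * Y * (H : Matrix (Fin m) (Fin m) ℝ)ᵀ) j j ∂haarO m =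
      ∫ H : Matrix.orthogonalGroup (Fin m) ℝ,
      ((H : Matrix (Fin m) (Fin m) ℝ) * Y * (H : Matrix (Fin m) (Fin m) ℝ)ᵀ) i i ∂haarO m := by
    intro j
    rw [← integral_mul_left_eq_self (μ := haarO m) (fun H : Matrix.orthogonalGroup (Fin m) ℝ =>
      ((H : Matrix (Fin m) (Fin m) ℝ) * Y * (H : Matrix (Fin m) (Fin m) ℝ)ᵀ) i i)
      (permOrthogonal (Equiv.swap i j))]
    refine integral_congr_ae (Filter.Eventually.of_forall fun H => ?_)
    have h := congrFun (congrFun (permOrthogonal_conj (Equiv.swap i j)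
      ((H : Matrix (Fin m) (Fin m) ℝ) * Y * (H : Matrix (Fin m) (Fin m) ℝ)ᵀ)) i) i
    simp only [Matrix.submatrix_apply, Equiv.swap_apply_left] at h
    simp only [Submonoid.coe_mul, Matrix.transpose_mul, ← h, Matrix.mul_assoc]
  have hsum : ∑ j : Fin m, ∫ H : Matrix.orthogonalGroup (Fin m) ℝ,
      ((H : Matrix (Fin m) (Fin m) ℝ) * Y * (H : Matrix (Fin m) (Fin m) ℝ)ᵀ) j j ∂haarO m =
      Y.trace := by
    rw [← integral_finsetSum _ fun j _ => integrable_haarO (hc j)]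
    have : ∀ H : Matrix.orthogonalGroup (Fin m) ℝ, ∑ j : Fin m,
        ((H : Matrix (Fin m) (Fin m) ℝ) * Y * (H : Matrix (Fin m) (Fin m) ℝ)ᵀ) j j = Y.trace :=
      fun H => trace_conj Y H
    simp [this]
  simp_rw [heq] at hsum
  rw [Finset.sum_const, Finset.card_univ, Fintype.card_fin, nsmul_eq_mul] at hsum
  have hm : (m : ℝ) ≠ 0 := by
    have := i.pos
    positivity
  rw [← hsum, mul_div_cancel_left₀ _ hm]

end SphericalMean

/-! ### Bounds for the kernels -/

section Bounds

variable {α : ℝ}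

/-- Enlarged to a box, the sum factors into partial sums of cosh series, and `cosh x ≤ exp x` for `x
≥ 0`. -/
lemma sum_prod_le_exp {x : Fin m → ℝ} (hx : ∀ i, 0 ≤ x i) (F : Finset (Fin m → ℕ)) :
    ∑ κ ∈ F, ∏ i, (x i ^ (2 * κ i) / ((2 * κ i)! : ℝ)) ≤ Real.exp (∑ i, x i) := by
  obtain ⟨N, hN⟩ : ∃ N, F ⊆ Fintype.piFinset fun _ : Fin m => Finset.range N := by
    refine ⟨(F.sup fun κ => Finset.univ.sup κ) + 1, fun κ hκ => ?_⟩
    rw [Fintype.mem_piFinset]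
    intro i
    rw [Finset.mem_range, Nat.lt_succ_iff]
    exact (Finset.le_sup (f := κ) (Finset.mem_univ i)).trans
      (Finset.le_sup (f := fun κ : Fin m → ℕ => Finset.univ.sup κ) hκ)
  have hterm : ∀ i n, 0 ≤ x i ^ (2 * n) / ((2 * n)! : ℝ) := fun i n =>
    div_nonneg (pow_nonneg (hx i) _) (by positivity)
  calc ∑ κ ∈ F, ∏ i, (x i ^ (2 * κ i) / ((2 * κ i)! : ℝ))
      ≤ ∑ κ ∈ Fintype.piFinset fun _ : Fin m => Finset.range N,
          ∏ i, (x i ^ (2 * κ i) / ((2 * κ i)! : ℝ)) :=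
        Finset.sum_le_sum_of_subset_of_nonneg hN fun κ _ _ =>
          Finset.prod_nonneg fun i _ => hterm i _
    _ = ∏ i, ∑ n ∈ Finset.range N, x i ^ (2 * n) / ((2 * n)! : ℝ) :=
        (Finset.prod_univ_sum (fun _ : Fin m => Finset.range N)
          fun i n => x i ^ (2 * n) / ((2 * n)! : ℝ)).symm
    _ ≤ ∏ i, Real.exp (x i) := by
        refine Finset.prod_le_prod (fun i _ => Finset.sum_nonneg fun n _ => hterm i n)
          fun i _ => ?_
        refine (sum_le_hasSum _ (fun n _ => hterm i n) (Real.hasSum_cosh (x i))).trans ?_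
        rw [Real.cosh_eq]
        have : Real.exp (-x i) ≤ Real.exp (x i) := Real.exp_le_exp.mpr (by linarith [hx i])
        linarith
    _ = Real.exp (∑ i, x i) := (Real.exp_sum _ _).symm

lemma sum_kernelCoeff_minorProd_le (hα0 : 0 < α) (hα : (m : ℝ) / 2 ≤ α)
    (F : Finset (Fin m → ℕ)) (hF : ∀ κ ∈ F, Antitone κ) {Y Z : Matrix (Fin m) (Fin m) ℝ}
    (hY : Y.PosDef) (hZ : Z.PosDef) :
    ∑ κ ∈ F, kernelCoeff α κ * minorProd κ Y * minorProd κ Z ≤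
      Real.exp (α⁻¹ * (Y.trace + Z.trace)) := by
  have hy : ∀ i, 0 ≤ Y i i := fun i => hY.diag_pos.le
  have hz : ∀ i, 0 ≤ Z i i := fun i => hZ.diag_pos.le
  -- With this `x`, the even powers in the cosh series reproduce `(Y i i * Z i i) ^ κ i`. AM-GM then
  -- gives exactly the constant `α⁻¹` needed to cancel the exponential factors of the kernel.
  refine le_trans ?_ ((sum_prod_le_exp (x := fun i => 2 / α * √(Y i i * Z i i))
    (fun i => by positivity) F).trans (Real.exp_le_exp.mpr ?_))
  · refine Finset.sum_le_sum fun κ hκ => ?_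
    have h1 := kernelCoeff_le hα0 hα (hF κ hκ)
    have h2 := minorProd_le (hF κ hκ) hY
    have h3 := minorProd_le (hF κ hκ) hZ
    have p1 := (kernelCoeff_pos hα0 hα (hF κ hκ)).le
    have p2 := (minorProd_pos κ hY).le
    have p3 := (minorProd_pos κ hZ).le
    calc kernelCoeff α κ * minorProd κ Y * minorProd κ Z
        ≤ (∏ i, ((2 / α) ^ (2 * κ i) / ((2 * κ i)! : ℝ))) * (∏ i, Y i i ^ κ i) *
            ∏ i, Z i i ^ κ i :=
          mul_le_mul (mul_le_mul h1 h2 p2 (p1.trans h1)) h3 p3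
            (mul_nonneg (p1.trans h1) (p2.trans h2))
      _ = ∏ i, ((2 / α * √(Y i i * Z i i)) ^ (2 * κ i) / ((2 * κ i)! : ℝ)) := by
          rw [← Finset.prod_mul_distrib, ← Finset.prod_mul_distrib]
          refine Finset.prod_congr rfl fun i _ => ?_
          rw [mul_pow, pow_mul √(Y i i * Z i i), Real.sq_sqrt (mul_nonneg (hy i) (hz i)), mul_pow]
          ring
  · rw [Matrix.trace, Matrix.trace, ← Finset.sum_add_distrib, Finset.mul_sum]
    refine Finset.sum_le_sum fun i _ => ?_
    have h1 : √(Y i i * Z i i) ≤ (Y i i + Z i i) / 2 := by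
      rw [Real.sqrt_le_left (by linarith [hy i, hz i])]
      nlinarith [sq_nonneg (Y i i - Z i i)]
    simp only [Matrix.diag_apply]
    calc 2 / α * √(Y i i * Z i i) ≤ 2 / α * ((Y i i + Z i i) / 2) := by gcongr
      _ = α⁻¹ * (Y i i + Z i i) := by ring

/-- The previous bound depends on traces only, so it survives averaging over both orbits
independently. -/
lemma sum_kernelCoeff_sphericalMean_le (hα0 : 0 < α) (hα : (m : ℝ) / 2 ≤ α)
    (F : Finset (Fin m → ℕ)) (hF : ∀ κ ∈ F, Antitone κ) {S T : Matrix (Fin m) (Fin m) ℝ}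
    (hS : S.PosDef) (hT : T.PosDef) :
    ∑ κ ∈ F, kernelCoeff α κ * sphericalMean κ S * sphericalMean κ T ≤
      Real.exp (α⁻¹ * (S.trace + T.trace)) := by
  have h1 : ∀ Y : Matrix (Fin m) (Fin m) ℝ, Y.PosDef →
      ∑ κ ∈ F, kernelCoeff α κ * minorProd κ Y * sphericalMean κ T ≤
      Real.exp (α⁻¹ * (Y.trace + T.trace)) := by
    intro Y hY
    have : ∑ κ ∈ F, kernelCoeff α κ * minorProd κ Y * sphericalMean κ T =
        ∫ G : Matrix.orthogonalGroup (Fin m) ℝ, ∑ κ ∈ F, kernelCoeff α κ * minorProd κ Y *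
          minorProd κ ((G : Matrix (Fin m) (Fin m) ℝ) * T *
            (G : Matrix (Fin m) (Fin m) ℝ)ᵀ) ∂haarO m := by
      rw [integral_finsetSum _ fun κ _ =>
        (integrable_haarO (continuous_minorProd_conj κ T)).const_mul _]
      simp_rw [integral_const_mul]
      rfl
    rw [this]
    refine integral_haarO_le (continuous_finsetSum _ fun κ _ =>
      continuous_const.mul (continuous_minorProd_conj κ T)) fun G => ?_
    rw [← trace_conj T G]
    exact sum_kernelCoeff_minorProd_le hα0 hα F hF hY (posDef_conj hT G)
  have : ∑ κ ∈ F, kernelCoeff α κ * sphericalMean κ S * sphericalMean κ T =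
      ∫ H : Matrix.orthogonalGroup (Fin m) ℝ, ∑ κ ∈ F, kernelCoeff α κ *
        minorProd κ ((H : Matrix (Fin m) (Fin m) ℝ) * S *
            (H : Matrix (Fin m) (Fin m) ℝ)ᵀ) * sphericalMean κ T ∂haarO m := by
    rw [integral_finsetSum _ fun κ _ =>
      ((integrable_haarO (continuous_minorProd_conj κ S)).const_mul _).mul_const _]
    simp_rw [integral_mul_const, integral_const_mul]
    rfl
  rw [this]
  refine integral_haarO_le (continuous_finsetSum _ fun κ _ =>
    (continuous_const.mul (continuous_minorProd_conj κ S)).mul continuous_const) fun H => ?_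
  rw [← trace_conj S H]
  exact h1 _ (posDef_conj hS H)

end Bounds

/-! ### Expansion of the kernels -/

section Expansion

variable {α : ℝ}

/-- The partitions with at most `m` parts, sorted by weight. -/
abbrev PartIndex (m : ℕ) : Type := Σ k : ℕ, {κ // κ ∈ partitions m k}

lemma PartIndex.antitone (i : PartIndex m) : Antitone (i.2 : Fin m → ℕ) :=
  (mem_partitions.mp i.2.2).2

lemma PartIndex.injective : Function.Injective fun i : PartIndex m => (i.2 : Fin m → ℕ) := by
  rintro ⟨k, κ, hκ⟩ ⟨l, μ, hμ⟩ h
  simp only at h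
  subst h
  obtain rfl : k = l := (mem_partitions.mp hκ).1.symm.trans (mem_partitions.mp hμ).1
  rfl

/-- The functions in which the kernels are expanded. -/
noncomputable def feature (α : ℝ) (i : PartIndex m) (S : Matrix (Fin m) (Fin m) ℝ) : ℝ :=
  Real.exp (-(α⁻¹ * S.trace)) * sphericalMean (i.2 : Fin m → ℕ) S

lemma measurable_feature (i : PartIndex m) :
    Measurable (feature α i : Matrix (Fin m) (Fin m) ℝ → ℝ) := by
  refine Measurable.mul ?_ (measurable_sphericalMean _)
  have : Continuous fun S : Matrix (Fin m) (Fin m) ℝ => Real.exp (-(α⁻¹ * S.trace)) :=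
    Real.continuous_exp.comp (continuous_const.mul continuous_id.matrix_trace).neg
  exact this.measurable

lemma feature_nonneg (i : PartIndex m) {S : Matrix (Fin m) (Fin m) ℝ} (hS : S.PosDef) :
    0 ≤ feature α i S :=
  mul_nonneg (Real.exp_pos _).le (sphericalMean_nonneg _ hS)

lemma sum_feature_le_one (hα0 : 0 < α) (hα : (m : ℝ) / 2 ≤ α) (F : Finset (PartIndex m))
    {S T : Matrix (Fin m) (Fin m) ℝ} (hS : S.PosDef) (hT : T.PosDef) :
    ∑ i ∈ F, kernelCoeff α (i.2 : Fin m → ℕ) * feature α i S * feature α i T ≤ 1 := by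
  have h := sum_kernelCoeff_sphericalMean_le hα0 hα (F.map ⟨_, PartIndex.injective⟩) (by
    intro κ hκ
    obtain ⟨i, -, rfl⟩ := Finset.mem_map.mp hκ
    exact i.antitone) hS hT
  rw [Finset.sum_map] at h
  have he : ∀ i : PartIndex m, kernelCoeff α (i.2 : Fin m → ℕ) * feature α i S * feature α i T =
      Real.exp (-(α⁻¹ * (S.trace + T.trace))) * (kernelCoeff α (i.2 : Fin m → ℕ) *
        sphericalMean (i.2 : Fin m → ℕ) S * sphericalMean (i.2 : Fin m → ℕ) T) := by
    intro i
    rw [mul_add, neg_add, Real.exp_add, feature, feature]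
    ring
  simp_rw [he]
  rw [← Finset.mul_sum, Real.exp_neg]
  exact inv_mul_le_one_of_le₀ h (Real.exp_pos _).le

lemma summable_feature (hα0 : 0 < α) (hα : (m : ℝ) / 2 ≤ α)
    {S T : Matrix (Fin m) (Fin m) ℝ} (hS : S.PosDef) (hT : T.PosDef) :
    Summable fun i : PartIndex m =>
      kernelCoeff α (i.2 : Fin m → ℕ) * feature α i S * feature α i T :=
  summable_of_sum_le (fun i => mul_nonneg (mul_nonneg (kernelCoeff_pos hα0 hα i.antitone).le
    (feature_nonneg i hS)) (feature_nonneg i hT)) fun F => sum_feature_le_one hα0 hα F hS hT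

/-- By homogeneity the argument `-α⁻²S` produces a second factor `(-1) ^ k`, which removes the
alternating sign. -/
lemma bessel_term_eq (hα0 : 0 < α) (hα : (m : ℝ) / 2 ≤ α) (k : ℕ)
    (S T : Matrix (Fin m) (Fin m) ℝ) :
    (-1) ^ k / (k ! : ℝ) * ∑ κ ∈ partitions m k,
      zonal κ (-(α ^ 2)⁻¹ • S) * zonal κ T / (shiftedFactorial α κ * zonal κ 1) =
    ∑ κ ∈ partitions m k, kernelCoeff α κ * sphericalMean κ S * sphericalMean κ T := by
  rw [Finset.mul_sum]
  refine Finset.sum_congr rfl fun κ hκ => ?_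
  obtain ⟨hk, hκ⟩ := mem_partitions.mp hκ
  have h1 := (zonalAtOne_pos hκ).ne'
  have h2 := (shiftedFactorial_pos hα κ).ne'
  have h3 : (k ! : ℝ) ≠ 0 := by positivity
  have h5 : (-(α ^ 2)⁻¹) ^ k = (-1) ^ k * ((α ^ 2) ^ k)⁻¹ := by rw [neg_pow, inv_pow]
  rw [zonal_eq, zonal_eq, zonal_eq, sphericalMean_one, sphericalMean_smul hκ, kernelCoeff, hk, h5]
  have h4 : ((-1 : ℝ) ^ k) * (-1) ^ k = 1 := by rw [← mul_pow]; simp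
  field_simp
  linear_combination (sphericalMean κ S * sphericalMean κ T) * h4

/-- As `ν + (m+1)/2 = α`, the gamma factor of the kernel cancels that of the Bessel function.
Summability over all partitions allows grouping by weight. -/
lemma hasSum_K₀ (hα0 : 0 < α) (hα : (m : ℝ) / 2 ≤ α) (hΓ : multiGamma m α ≠ 0)
    {S T : Matrix (Fin m) (Fin m) ℝ} (hS : S.PosDef) (hT : T.PosDef) :
    HasSum (fun i : PartIndex m =>
      kernelCoeff α (i.2 : Fin m → ℕ) * feature α i S * feature α i T) (K₀ m α S T) := by
  have h := (summable_feature hα0 hα hS hT).hasSum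
  have hs := h.sigma fun k => hasSum_fintype _
  convert h using 1
  rw [← hs.tsum_eq, K₀, bessel₂, sub_add_cancel]
  simp_rw [bessel_term_eq hα0 hα]
  rw [show multiGamma m α * Real.exp (-(α⁻¹ * (S + T).trace)) * ((multiGamma m α)⁻¹ *
      ∑' k : ℕ, ∑ κ ∈ partitions m k, kernelCoeff α κ * sphericalMean κ S * sphericalMean κ T) =
      Real.exp (-(α⁻¹ * (S + T).trace)) *
      ∑' k : ℕ, ∑ κ ∈ partitions m k, kernelCoeff α κ * sphericalMean κ S * sphericalMean κ T by
    field_simp, ← tsum_mul_left]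
  refine tsum_congr fun k => ?_
  rw [← Finset.sum_coe_sort, Finset.mul_sum]
  refine Finset.sum_congr rfl fun κ _ => ?_
  rw [Matrix.trace_add, mul_add, neg_add, Real.exp_add, feature, feature]
  ring

lemma partitions_zero : partitions m 0 = {0} := by
  ext κ
  rw [mem_partitions, Finset.mem_singleton, Finset.sum_eq_zero_iff]
  constructor
  · rintro ⟨h, -⟩
    exact funext fun i => h i (Finset.mem_univ i)
  · rintro rfl
    exact ⟨fun _ _ => rfl, fun _ _ _ => le_rfl⟩

lemma partitions_one (hm : 0 < m) : partitions m 1 = {Pi.single ⟨0, hm⟩ 1} := by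
  ext κ
  rw [mem_partitions, Finset.mem_singleton]
  constructor
  · rintro ⟨hs, ha⟩
    have h0 : κ ⟨0, hm⟩ ≠ 0 := by
      intro h0
      have : ∑ i, κ i = 0 := Finset.sum_eq_zero fun i _ =>
        Nat.le_zero.mp ((ha (Fin.mk_le_of_le_val (Nat.zero_le _))).trans_eq h0)
      omega
    rw [← Finset.add_sum_erase _ _ (Finset.mem_univ (⟨0, hm⟩ : Fin m))] at hs
    have h1 : ∑ i ∈ Finset.univ.erase (⟨0, hm⟩ : Fin m), κ i = 0 := by omega
    rw [Finset.sum_eq_zero_iff] at h1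
    funext i
    by_cases hi : i = ⟨0, hm⟩
    · subst hi
      rw [Pi.single_eq_same]
      omega
    · rw [Pi.single_eq_of_ne hi]
      exact h1 i (Finset.mem_erase.mpr ⟨hi, Finset.mem_univ i⟩)
  · rintro rfl
    refine ⟨by simp, fun i j hij => ?_⟩
    by_cases hj : j = ⟨0, hm⟩
    · subst hj
      have : i = ⟨0, hm⟩ := Fin.ext (Nat.le_zero.mp hij)
      rw [this]
    · rw [Pi.single_eq_of_ne hj]
      exact Nat.zero_le _

lemma length_zero : length (0 : Fin m → ℕ) = 0 := by simp [length]

lemma length_single (hm : 0 < m) : length (Pi.single ⟨0, hm⟩ 1 : Fin m → ℕ) = 1 := by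
  rw [length, Finset.card_eq_one]
  refine ⟨⟨0, hm⟩, ?_⟩
  ext i
  simp [Pi.single_apply]

lemma kernelCoeff_zero : kernelCoeff α (0 : Fin m → ℕ) = 1 := by
  simp [kernelCoeff, zonalAtOne, length_zero, shiftedFactorial]

lemma shiftedFactorial_single (hm : 0 < m) (a : ℝ) :
    shiftedFactorial a (Pi.single ⟨0, hm⟩ 1 : Fin m → ℕ) = a := by
  rw [shiftedFactorial, Finset.prod_eq_single (⟨0, hm⟩ : Fin m)]
  · simp
  · intro i _ hi
    simp [Pi.single_eq_of_ne hi]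
  · simp

lemma zonalAtOne_single (hm : 0 < m) :
    zonalAtOne (Pi.single ⟨0, hm⟩ 1 : Fin m → ℕ) = m := by
  have h1 : (Finset.univ.filter fun p : Fin m × Fin m => p.1 < p.2 ∧ (p.2 : ℕ) < 1) = ∅ := by
    ext p
    simp only [Finset.mem_filter_univ, Fin.lt_def, Finset.notMem_empty, iff_false]
    omega
  have h2 : (Finset.univ.filter fun i : Fin m => (i : ℕ) < 1) = {⟨0, hm⟩} := by
    ext i
    simp [Fin.ext_iff]
  rw [zonalAtOne, length_single, shiftedFactorial_single, h1, h2]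
  simp
  ring

lemma sphericalMean_single (hm : 0 < m) (Y : Matrix (Fin m) (Fin m) ℝ) :
    sphericalMean (Pi.single ⟨0, hm⟩ 1 : Fin m → ℕ) Y = Y.trace / m := by
  rw [← integral_conj_diag Y ⟨0, hm⟩, sphericalMean]
  have h : ∀ Z : Matrix (Fin m) (Fin m) ℝ,
      minorProd (Pi.single ⟨0, hm⟩ 1 : Fin m → ℕ) Z = Z ⟨0, hm⟩ ⟨0, hm⟩ := by
    intro Z
    rw [minorProd, Finset.prod_eq_single (⟨0, hm⟩ : Fin m)]
    · have : partGap (Pi.single ⟨0, hm⟩ 1 : Fin m → ℕ) ⟨0, hm⟩ = 1 := by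
        rw [partGap, Pi.single_eq_same]
        split_ifs with h
        · rw [Pi.single_eq_of_ne (by simp), Nat.sub_zero]
        · rfl
      rw [this, pow_one, leadingMinor]
      exact Matrix.det_fin_one _
    · intro i _ hi
      rw [partGap, Pi.single_eq_of_ne hi, Nat.zero_sub, pow_zero]
    · simp
  simp_rw [h]

lemma kernelCoeff_single (hm : 0 < m) :
    kernelCoeff α (Pi.single ⟨0, hm⟩ 1 : Fin m → ℕ) = m / α ^ 3 := by
  rw [kernelCoeff, zonalAtOne_single, shiftedFactorial_single]
  simp [pow_succ]

/-- The coefficients of the kernel `K`. -/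
noncomputable def kernelCoeffTail (α : ℝ) (i : PartIndex m) : ℝ :=
  if 2 ≤ i.1 then kernelCoeff α (i.2 : Fin m → ℕ) else 0

/-- Apart from the exponential factor, the terms of weight 0 and 1 of `K₀` are `1` and `(m/α³)(tr
S/m)(tr T/m)`, precisely what is subtracted in `K`. -/
lemma hasSum_K (hm : 0 < m) (hα0 : 0 < α) (hα : (m : ℝ) / 2 ≤ α) (hΓ : multiGamma m α ≠ 0)
    {S T : Matrix (Fin m) (Fin m) ℝ} (hS : S.PosDef) (hT : T.PosDef) :
    HasSum (fun i : PartIndex m =>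
      kernelCoeffTail α i * feature α i S * feature α i T) (K m α S T) := by
  have h := hasSum_K₀ hα0 hα hΓ hS hT
  set s : Finset (PartIndex m) := (Finset.range 2).sigma fun k => Finset.univ with hs
  have hhead : HasSum (fun i : PartIndex m => if i.1 < 2 then
      kernelCoeff α (i.2 : Fin m → ℕ) * feature α i S * feature α i T else 0)
      (∑ i ∈ s, if i.1 < 2 then
        kernelCoeff α (i.2 : Fin m → ℕ) * feature α i S * feature α i T else 0) := by
    refine hasSum_sum_of_ne_finset_zero fun i hi => if_neg fun h2 => hi ?_
    rw [hs, Finset.mem_sigma]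
    exact ⟨Finset.mem_range.mpr h2, Finset.mem_univ _⟩
  have hsum : (∑ i ∈ s, if i.1 < 2 then
      kernelCoeff α (i.2 : Fin m → ℕ) * feature α i S * feature α i T else 0) =
      Real.exp (-(α⁻¹ * (S + T).trace)) * (1 + 1 / (α ^ 3 * m) * (S.trace * T.trace)) := by
    have hk : ∀ k, k < 2 → ∑ κ : {κ // κ ∈ partitions m k}, (if k < 2 then
        kernelCoeff α (κ : Fin m → ℕ) * feature α ⟨k, κ⟩ S * feature α ⟨k, κ⟩ T else 0) =
        Real.exp (-(α⁻¹ * (S + T).trace)) * ∑ κ ∈ partitions m k,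
          kernelCoeff α κ * sphericalMean κ S * sphericalMean κ T := by
      intro k hk
      rw [← Finset.sum_coe_sort (partitions m k), Finset.mul_sum]
      refine Finset.sum_congr rfl fun κ _ => ?_
      rw [if_pos hk, Matrix.trace_add, mul_add, neg_add, Real.exp_add, feature, feature]
      ring
    have hm' : (m : ℝ) ≠ 0 := by positivity
    rw [hs, Finset.sum_sigma, Finset.sum_range_succ, Finset.sum_range_one, hk 0 (by norm_num),
      hk 1 (by norm_num), partitions_zero, partitions_one hm, Finset.sum_singleton,
      Finset.sum_singleton, kernelCoeff_zero, kernelCoeff_single, sphericalMean_single,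
      sphericalMean_single]
    have h0 : ∀ Y : Matrix (Fin m) (Fin m) ℝ, sphericalMean (0 : Fin m → ℕ) Y = 1 := by
      intro Y
      simp [sphericalMean, minorProd, partGap]
    rw [h0, h0]
    field_simp
  have hd := h.sub hhead
  rw [hsum] at hd
  have hK : K m α S T = K₀ m α S T -
      Real.exp (-(α⁻¹ * (S + T).trace)) * (1 + 1 / (α ^ 3 * m) * (S.trace * T.trace)) := by
    simp only [K, K₀]; ring
  rw [hK]
  have he : ∀ i : PartIndex m, kernelCoeffTail α i * feature α i S * feature α i T =
      kernelCoeff α (i.2 : Fin m → ℕ) * feature α i S * feature α i T -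
        if i.1 < 2 then kernelCoeff α (i.2 : Fin m → ℕ) * feature α i S * feature α i T
        else 0 := by
    intro i
    rw [kernelCoeffTail]
    by_cases hi : i.1 < 2
    · rw [if_neg (by omega), if_pos hi]; ring
    · rw [if_pos (by omega), if_neg hi]; ring
  simpa only [he] using hd

lemma isMercerSum_K₀ (hα0 : 0 < α) (hα : (m : ℝ) / 2 ≤ α) (hΓ : multiGamma m α ≠ 0) :
    IsMercerSum (posDefCone m) (fun i : PartIndex m => kernelCoeff α (i.2 : Fin m → ℕ))
      (feature α) (K₀ m α) where
  measurable := measurable_feature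
  coeff_nonneg i := (kernelCoeff_pos hα0 hα i.antitone).le
  nonneg i _ hs := feature_nonneg i hs
  hasSum _ hs _ ht := hasSum_K₀ hα0 hα hΓ hs ht
  le_one _ hs _ ht := le_of_tendsto' (hasSum_K₀ hα0 hα hΓ hs ht) fun F =>
    sum_feature_le_one hα0 hα F hs ht

lemma kernelCoeffTail_le (hα0 : 0 < α) (hα : (m : ℝ) / 2 ≤ α) (i : PartIndex m) :
    0 ≤ kernelCoeffTail α i ∧ kernelCoeffTail α i ≤ kernelCoeff α (i.2 : Fin m → ℕ) := by
  have := (kernelCoeff_pos hα0 hα i.antitone).le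
  rw [kernelCoeffTail]
  split_ifs
  · exact ⟨this, le_rfl⟩
  · exact ⟨le_rfl, this⟩

lemma isMercerSum_K (hm : 0 < m) (hα0 : 0 < α) (hα : (m : ℝ) / 2 ≤ α)
    (hΓ : multiGamma m α ≠ 0) :
    IsMercerSum (posDefCone m) (kernelCoeffTail α : PartIndex m → ℝ) (feature α) (K m α) where
  measurable := measurable_feature
  coeff_nonneg i := (kernelCoeffTail_le hα0 hα i).1
  nonneg i _ hs := feature_nonneg i hs
  hasSum _ hs _ ht := hasSum_K hm hα0 hα hΓ hs ht
  le_one _ hs _ ht := le_of_tendsto' (hasSum_K hm hα0 hα hΓ hs ht) fun F =>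
    (Finset.sum_le_sum fun i _ => mul_le_mul_of_nonneg_right (mul_le_mul_of_nonneg_right
      (kernelCoeffTail_le hα0 hα i).2 (feature_nonneg i hs)) (feature_nonneg i ht)).trans
        (sum_feature_le_one hα0 hα F hs ht)

end Expansion

/-! ### Lexicographic leading terms -/

section Lex

open MvPolynomial

/-- Every exponent of `p` is lexicographically at most `n`. -/
def LexLe (p : MvPolynomial (Fin m) ℝ) (n : Fin m →₀ ℕ) : Prop :=
  ∀ k, coeff k p ≠ 0 → toLex k ≤ toLex n

lemma LexLe.one : LexLe (1 : MvPolynomial (Fin m) ℝ) 0 := by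
  intro k hk
  rw [coeff_one] at hk
  have : (0 : Fin m →₀ ℕ) = k := by
    by_contra h
    exact hk (if_neg h)
  rw [this]

lemma LexLe.mul {p q : MvPolynomial (Fin m) ℝ} {a b : Fin m →₀ ℕ} (hp : LexLe p a)
    (hq : LexLe q b) : LexLe (p * q) (a + b) := by
  intro k hk
  rw [coeff_mul] at hk
  obtain ⟨x, hx, hne⟩ := Finset.exists_ne_zero_of_sum_ne_zero hk
  rw [Finset.HasAntidiagonal.mem_antidiagonal] at hx
  rw [← hx, toLex_add, toLex_add]
  exact add_le_add (hp _ (left_ne_zero_of_mul hne)) (hq _ (right_ne_zero_of_mul hne))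

/-- Addition is strictly monotone for the lexicographic order, so `a + b` arises from exponents
bounded by `a` and `b` only as `(a, b)`. -/
lemma LexLe.coeff_mul {p q : MvPolynomial (Fin m) ℝ} {a b : Fin m →₀ ℕ} (hp : LexLe p a)
    (hq : LexLe q b) : coeff (a + b) (p * q) = coeff a p * coeff b q := by
  rw [MvPolynomial.coeff_mul]
  refine Finset.sum_eq_single_of_mem (a, b) (Finset.HasAntidiagonal.mem_antidiagonal.mpr rfl) fun x hx hne => ?_
  by_contra h
  have h1 := hp _ (left_ne_zero_of_mul h)
  have h2 := hq _ (right_ne_zero_of_mul h)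
  rw [Finset.HasAntidiagonal.mem_antidiagonal] at hx
  have hx' : toLex x.1 + toLex x.2 = toLex a + toLex b := by
    rw [← toLex_add, ← toLex_add, hx]
  have e1 : toLex x.1 = toLex a := by
    refine le_antisymm h1 (not_lt.mp fun h => ?_)
    exact absurd hx' (add_lt_add_of_lt_of_le h h2).ne
  rw [e1] at hx'
  exact hne (Prod.ext (toLex.injective e1) (toLex.injective (add_left_cancel hx')))

lemma LexLe.pow {p : MvPolynomial (Fin m) ℝ} {a : Fin m →₀ ℕ} (hp : LexLe p a) (n : ℕ) :
    LexLe (p ^ n) (n • a) ∧ coeff (n • a) (p ^ n) = coeff a p ^ n := by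
  induction n with
  | zero => simpa using LexLe.one
  | succ n ih =>
    rw [pow_succ, succ_nsmul, pow_succ]
    exact ⟨ih.1.mul hp, by rw [ih.1.coeff_mul hp, ih.2]⟩

lemma LexLe.prod {ι : Type*} (s : Finset ι) {p : ι → MvPolynomial (Fin m) ℝ}
    {a : ι → Fin m →₀ ℕ} (hp : ∀ i, LexLe (p i) (a i)) :
    LexLe (∏ i ∈ s, p i) (∑ i ∈ s, a i) ∧
      coeff (∑ i ∈ s, a i) (∏ i ∈ s, p i) = ∏ i ∈ s, coeff (a i) (p i) := by
  classical
  induction s using Finset.induction_on with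
  | empty => simpa using LexLe.one
  | insert i s hi ih =>
    rw [Finset.prod_insert hi, Finset.sum_insert hi, Finset.prod_insert hi]
    exact ⟨(hp i).mul ih.1, by rw [(hp i).coeff_mul ih.1, ih.2]⟩

end Lex

/-! ### Polynomials depending continuously on a parameter -/

section ContCoeff

open MvPolynomial

variable {X : Type*} [TopologicalSpace X]

/-- The coefficients of `Q x` depend continuously on `x`. -/
def ContCoeff (Q : X → MvPolynomial (Fin m) ℝ) : Prop :=
  ∀ n, Continuous fun x => coeff n (Q x)

lemma ContCoeff.const (p : MvPolynomial (Fin m) ℝ) : ContCoeff fun _ : X => p :=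
  fun _ => continuous_const

lemma ContCoeff.C_mul {g : X → ℝ} (hg : Continuous g) (p : MvPolynomial (Fin m) ℝ) :
    ContCoeff fun x => C (g x) * p := fun n => by
  simp_rw [coeff_C_mul]
  exact hg.mul continuous_const

lemma ContCoeff.mul {P Q : X → MvPolynomial (Fin m) ℝ} (hP : ContCoeff P) (hQ : ContCoeff Q) :
    ContCoeff fun x => P x * Q x := fun n => by
  simp_rw [coeff_mul]
  exact continuous_finsetSum _ fun i _ => (hP _).mul (hQ _)

lemma ContCoeff.sum {ι : Type*} (s : Finset ι) {Q : ι → X → MvPolynomial (Fin m) ℝ}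
    (hQ : ∀ i, ContCoeff (Q i)) : ContCoeff fun x => ∑ i ∈ s, Q i x := fun n => by
  simp_rw [coeff_sum]
  exact continuous_finsetSum _ fun i _ => hQ i n

lemma ContCoeff.prod {ι : Type*} (s : Finset ι) {Q : ι → X → MvPolynomial (Fin m) ℝ}
    (hQ : ∀ i, ContCoeff (Q i)) : ContCoeff fun x => ∏ i ∈ s, Q i x := by
  classical
  induction s using Finset.induction_on with
  | empty => simpa using ContCoeff.const 1
  | insert i s hi ih =>
    simp_rw [Finset.prod_insert hi]
    exact (hQ i).mul ih

lemma ContCoeff.pow {Q : X → MvPolynomial (Fin m) ℝ} (hQ : ContCoeff Q) (n : ℕ) :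
    ContCoeff fun x => Q x ^ n := by
  induction n with
  | zero => simpa using ContCoeff.const 1
  | succ n ih => simpa only [pow_succ] using ih.mul hQ

end ContCoeff

/-! ### Averages of polynomials over the orthogonal group -/

section Average

open MvPolynomial

/-- The average of a family of homogeneous polynomials of degree `k` over the orthogonal group. -/
noncomputable def avgPoly (k : ℕ)
    (Q : Matrix.orthogonalGroup (Fin m) ℝ → MvPolynomial (Fin m) ℝ) : MvPolynomial (Fin m) ℝ :=
  ∑ n ∈ Finset.univ.finsuppAntidiag k, monomial n (∫ H, coeff n (Q H) ∂haarO m)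

variable {k : ℕ} {Q : Matrix.orthogonalGroup (Fin m) ℝ → MvPolynomial (Fin m) ℝ}

lemma mem_finsuppAntidiag_of_coeff_ne_zero {p : MvPolynomial (Fin m) ℝ} (hp : p.IsHomogeneous k)
    {n : Fin m →₀ ℕ} (hn : coeff n p ≠ 0) : n ∈ Finset.univ.finsuppAntidiag k := by
  have h := hp.degree_eq_sum_deg_support (mem_support_iff.mpr hn)
  rw [Finset.mem_finsuppAntidiag]
  refine ⟨?_, Finset.subset_univ _⟩
  rw [h]
  exact (Finset.sum_subset (Finset.subset_univ _) fun i _ hi => by simpa using hi).symm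

lemma eval_eq_sum_of_isHomogeneous {p : MvPolynomial (Fin m) ℝ} (hp : p.IsHomogeneous k)
    (y : Fin m → ℝ) :
    eval y p = ∑ n ∈ Finset.univ.finsuppAntidiag k, coeff n p * ∏ i, y i ^ n i := by
  rw [eval_eq']
  refine Finset.sum_subset (fun n hn =>
    mem_finsuppAntidiag_of_coeff_ne_zero hp (mem_support_iff.mp hn)) fun n _ hn => ?_
  rw [notMem_support_iff.mp hn, zero_mul]

lemma coeff_avgPoly (hQ : ∀ H, (Q H).IsHomogeneous k) (n : Fin m →₀ ℕ) :
    coeff n (avgPoly k Q) = ∫ H, coeff n (Q H) ∂haarO m := by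
  classical
  rw [avgPoly, coeff_sum]
  simp_rw [coeff_monomial]
  rw [Finset.sum_ite_eq']
  split_ifs with h
  · rfl
  · have : ∀ H, coeff n (Q H) = 0 := fun H => by
      by_contra h'
      exact h (mem_finsuppAntidiag_of_coeff_ne_zero (hQ H) h')
    simp [this]

lemma isHomogeneous_avgPoly : (avgPoly k Q).IsHomogeneous k := by
  refine IsHomogeneous.sum _ _ _ fun n hn => isHomogeneous_monomial _ ?_
  rw [Finset.mem_finsuppAntidiag] at hn
  rw [Finsupp.degree_eq_sum]
  exact hn.1

lemma eval_avgPoly (hc : ContCoeff Q) (hQ : ∀ H, (Q H).IsHomogeneous k) (y : Fin m → ℝ) :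
    eval y (avgPoly k Q) = ∫ H, eval y (Q H) ∂haarO m := by
  simp_rw [fun H => eval_eq_sum_of_isHomogeneous (hQ H) y]
  rw [integral_finsetSum _ fun n _ => (integrable_haarO (hc n)).mul_const _,
    eval_eq_sum_of_isHomogeneous isHomogeneous_avgPoly]
  refine Finset.sum_congr rfl fun n _ => ?_
  rw [integral_mul_const, coeff_avgPoly hQ]

lemma integral_conj_submatrix (F : Matrix (Fin m) (Fin m) ℝ → ℝ) (σ : Equiv.Perm (Fin m))
    (Y : Matrix (Fin m) (Fin m) ℝ) :
    ∫ H : Matrix.orthogonalGroup (Fin m) ℝ, F ((H : Matrix (Fin m) (Fin m) ℝ) *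
      Y.submatrix σ σ * (H : Matrix (Fin m) (Fin m) ℝ)ᵀ) ∂haarO m =
    ∫ H : Matrix.orthogonalGroup (Fin m) ℝ, F ((H : Matrix (Fin m) (Fin m) ℝ) *
      Y * (H : Matrix (Fin m) (Fin m) ℝ)ᵀ) ∂haarO m := by
  rw [← permOrthogonal_conj, ← integral_mul_right_eq_self (μ := haarO m)
    (fun H : Matrix.orthogonalGroup (Fin m) ℝ => F ((H : Matrix (Fin m) (Fin m) ℝ) *
      Y * (H : Matrix (Fin m) (Fin m) ℝ)ᵀ)) (permOrthogonal σ)]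
  refine integral_congr_ae (Filter.Eventually.of_forall fun H => ?_)
  simp only [Submonoid.coe_mul, Matrix.transpose_mul, Matrix.mul_assoc]

/-- Permuting the variables conjugates `diag(y)` by a permutation matrix, which the average over
`O(m)` absorbs. -/
lemma isSymmetric_avgPoly (hc : ContCoeff Q) (hQ : ∀ H, (Q H).IsHomogeneous k)
    {F : Matrix (Fin m) (Fin m) ℝ → ℝ}
    (hF : ∀ (H : Matrix.orthogonalGroup (Fin m) ℝ) y, eval y (Q H) =
      F ((H : Matrix (Fin m) (Fin m) ℝ) * Matrix.diagonal y *
        (H : Matrix (Fin m) (Fin m) ℝ)ᵀ)) : (avgPoly k Q).IsSymmetric := by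
  intro σ
  refine MvPolynomial.funext fun y => ?_
  rw [eval_rename, eval_avgPoly hc hQ, eval_avgPoly hc hQ]
  simp_rw [hF]
  rw [← integral_conj_submatrix F σ (Matrix.diagonal y)]
  simp only [Matrix.submatrix_diagonal_equiv]

end Average

/-! ### Leading minors as polynomials in the eigenvalues -/

section MinorPoly

open MvPolynomial

/-- The leading minor of `H diag(X) Hᵀ` as a polynomial in the diagonal entries. -/
noncomputable def minorPoly (H : Matrix (Fin m) (Fin m) ℝ) (i : Fin m) :
    MvPolynomial (Fin m) ℝ :=
  (Matrix.of fun a b : Fin (i + 1) =>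
    ∑ l, C (H (Fin.castLE (Nat.succ_le_of_lt i.isLt) a) l *
      H (Fin.castLE (Nat.succ_le_of_lt i.isLt) b) l) * X l).det

lemma eval_minorPoly (H : Matrix (Fin m) (Fin m) ℝ) (i : Fin m) (y : Fin m → ℝ) :
    eval y (minorPoly H i) = leadingMinor (H * Matrix.diagonal y * Hᵀ) i := by
  rw [minorPoly, RingHom.map_det, leadingMinor]
  congr 1
  ext a b
  simp only [RingHom.mapMatrix_apply, Matrix.map_apply, Matrix.of_apply, map_sum, map_mul, eval_C,
    eval_X, Matrix.submatrix_apply]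
  rw [Matrix.mul_apply]
  refine Finset.sum_congr rfl fun l _ => ?_
  rw [Matrix.mul_diagonal, Matrix.transpose_apply]
  ring

lemma contCoeff_minorPoly (i : Fin m) :
    ContCoeff fun H : Matrix.orthogonalGroup (Fin m) ℝ =>
      minorPoly (H : Matrix (Fin m) (Fin m) ℝ) i := by
  have he : ∀ a b : Fin m, Continuous fun H : Matrix.orthogonalGroup (Fin m) ℝ =>
      (H : Matrix (Fin m) (Fin m) ℝ) a b := fun a b =>
    continuous_subtype_val.matrix_elem a b
  have : ∀ H : Matrix.orthogonalGroup (Fin m) ℝ, minorPoly (H : Matrix (Fin m) (Fin m) ℝ) i =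
      ∑ σ : Equiv.Perm (Fin (i + 1)), C (((Equiv.Perm.sign σ : ℤˣ) : ℤ) : ℝ) *
        ∏ a, ∑ l, C ((H : Matrix (Fin m) (Fin m) ℝ)
          (Fin.castLE (Nat.succ_le_of_lt i.isLt) (σ a)) l * (H : Matrix (Fin m) (Fin m) ℝ)
            (Fin.castLE (Nat.succ_le_of_lt i.isLt) a) l) * X l := by
    intro H
    rw [minorPoly, Matrix.det_apply']
    simp
  simp_rw [this]
  refine ContCoeff.sum _ fun σ => (ContCoeff.const _).mul (ContCoeff.prod _ fun a =>
    ContCoeff.sum _ fun l => ContCoeff.C_mul ((he _ _).mul (he _ _)) _)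

lemma isHomogeneous_minorPoly (H : Matrix (Fin m) (Fin m) ℝ) (i : Fin m) :
    (minorPoly H i).IsHomogeneous (i + 1) := by
  rw [minorPoly, Matrix.det_apply']
  refine IsHomogeneous.sum _ _ _ fun σ _ => ?_
  have hd : 0 + ∑ _a : Fin ((i : ℕ) + 1), 1 = (i : ℕ) + 1 := by simp
  have h0 : ((((Equiv.Perm.sign σ : ℤˣ) : ℤ) : MvPolynomial (Fin m) ℝ)).IsHomogeneous 0 := by
    rw [← map_intCast (C : ℝ →+* MvPolynomial (Fin m) ℝ)]
    exact isHomogeneous_C _ _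
  have h := h0.mul (IsHomogeneous.prod Finset.univ (fun a : Fin ((i : ℕ) + 1) =>
      (∑ l, C (H (Fin.castLE (Nat.succ_le_of_lt i.isLt) (σ a)) l *
        H (Fin.castLE (Nat.succ_le_of_lt i.isLt) a) l) * X l : MvPolynomial (Fin m) ℝ))
      (fun _ => 1) fun a _ => IsHomogeneous.sum _ _ _ fun l _ => isHomogeneous_C_mul_X _ _)
  rw [hd] at h
  exact h

/-- The exponent of `x_0 ⋯ x_i`. -/
noncomputable def leadExp (i : Fin m) : Fin m →₀ ℕ :=
  Finsupp.equivFunOnFinite.symm fun l => if l ≤ i then 1 else 0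

/-- The exponent of `∏ a, x_{f a}`. -/
noncomputable def imageExp {n : ℕ} (f : Fin n → Fin m) : Fin m →₀ ℕ :=
  ∑ a, Finsupp.single (f a) 1

/-- The expansion behind Cauchy–Binet: each row is a sum over `l`, the determinant is expanded
multilinearly, and a choice `f` that repeats an index gives equal rows. Thus all monomials are
squarefree. -/
lemma minorPoly_eq_sum (H : Matrix (Fin m) (Fin m) ℝ) (i : Fin m) :
    ∃ c : (Fin (i + 1) → Fin m) → ℝ, minorPoly H i =
      ∑ f : Fin (i + 1) → Fin m with Function.Injective f, monomial (imageExp f) (c f) := by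
  classical
  set e := Fin.castLE (Nat.succ_le_of_lt i.isLt) with he
  refine ⟨fun f => (∏ a, H (e a) (f a)) * (Matrix.of fun a b => H (e b) (f a)).det, ?_⟩
  have h1 : minorPoly H i = Matrix.detRowAlternating (fun a => ∑ l,
      (C (H (e a) l) * X l : MvPolynomial (Fin m) ℝ) •
        (fun b => C (H (e b) l) : Fin (i + 1) → MvPolynomial (Fin m) ℝ)) := by
    rw [minorPoly]
    refine congrArg Matrix.detRowAlternating ?_
    funext a
    funext b
    simp only [Matrix.of_apply, Finset.sum_apply, Pi.smul_apply, smul_eq_mul, C_mul]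
    exact Finset.sum_congr rfl fun l _ => by ring
  rw [h1, ← AlternatingMap.coe_multilinearMap, MultilinearMap.map_sum]
  simp_rw [MultilinearMap.map_smul_univ]
  rw [Finset.sum_filter]
  refine Finset.sum_congr rfl fun f _ => ?_
  split_ifs with hf
  · have hd : (Matrix.detRowAlternating : _ [⋀^Fin (i + 1)]→ₗ[MvPolynomial (Fin m) ℝ] _).toMultilinearMap
        (fun a b => C (H (e b) (f a)) : Fin (i + 1) → Fin (i + 1) → MvPolynomial (Fin m) ℝ) =
        C (Matrix.of fun a b => H (e b) (f a)).det := by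
      rw [RingHom.map_det]
      rfl
    rw [hd, Finset.prod_mul_distrib, ← map_prod, smul_eq_mul, imageExp, monomial_sum_index,
      C_mul]
    simp only [X]
    ring
  · have : (Matrix.detRowAlternating : _ [⋀^Fin (i + 1)]→ₗ[MvPolynomial (Fin m) ℝ] _).toMultilinearMap
        (fun a b => C (H (e b) (f a)) : Fin (i + 1) → Fin (i + 1) → MvPolynomial (Fin m) ℝ) =
        0 := by
      refine AlternatingMap.map_eq_zero_of_not_injective _ _ fun hinj => hf fun a b hab =>
        hinj ?_
      simp only [hab]
    rw [this, smul_zero]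

lemma imageExp_apply {n : ℕ} {f : Fin n → Fin m} (hf : Function.Injective f) (l : Fin m) :
    imageExp f l = if l ∈ Finset.univ.image f then 1 else 0 := by
  classical
  rw [imageExp, Finsupp.finsetSum_apply]
  simp_rw [Finsupp.single_apply]
  rw [← Finset.card_filter]
  split_ifs with h
  · obtain ⟨a, -, rfl⟩ := Finset.mem_image.mp h
    rw [Finset.card_eq_one]
    exact ⟨a, by ext b; simp [hf.eq_iff]⟩
  · rw [Finset.card_eq_zero, Finset.filter_eq_empty_iff]
    exact fun a _ ha => h (Finset.mem_image.mpr ⟨a, Finset.mem_univ a, ha⟩)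

lemma leadExp_apply (i l : Fin m) : leadExp i l = if l ≤ i then 1 else 0 := rfl

lemma card_image_eq {i : Fin m} {f : Fin (i + 1) → Fin m} (hf : Function.Injective f) :
    (Finset.univ.image f).card = (Finset.Iic i).card := by
  rw [Finset.card_image_of_injective _ hf, Fin.card_Iic, Finset.card_univ, Fintype.card_fin]

lemma imageExp_eq_leadExp_iff {i : Fin m} {f : Fin (i + 1) → Fin m}
    (hf : Function.Injective f) : imageExp f = leadExp i ↔ ∀ a, f a ≤ i := by
  constructor
  · intro h a
    have := DFunLike.congr_fun h (f a)
    rw [imageExp_apply hf, leadExp_apply,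
      if_pos (Finset.mem_image_of_mem f (Finset.mem_univ a))] at this
    by_contra h'
    rw [if_neg h'] at this
    exact one_ne_zero this
  · intro h
    have hs : Finset.univ.image f = Finset.Iic i := by
      refine Finset.eq_of_subset_of_card_le (fun l hl => ?_) (card_image_eq hf).ge
      obtain ⟨a, -, rfl⟩ := Finset.mem_image.mp hl
      exact Finset.mem_Iic.mpr (h a)
    ext l
    rw [imageExp_apply hf, leadExp_apply, hs]
    simp

/-- At the first index `≤ i` missed by `f` the exponents are 0 and 1, while before it both are 1. -/
lemma imageExp_le_leadExp {i : Fin m} {f : Fin (i + 1) → Fin m} (hf : Function.Injective f) :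
    toLex (imageExp f) ≤ toLex (leadExp i) := by
  by_cases h : ∀ a, f a ≤ i
  · rw [(imageExp_eq_leadExp_iff hf).mpr h]
  have hne : (Finset.Iic i \ Finset.univ.image f).Nonempty := by
    rw [Finset.sdiff_nonempty]
    intro hs
    have := Finset.eq_of_subset_of_card_le hs (card_image_eq hf).le
    exact h fun a => Finset.mem_Iic.mp
      (this ▸ Finset.mem_image_of_mem f (Finset.mem_univ a))
  have hmin := Finset.mem_sdiff.mp (Finset.min'_mem _ hne)
  have hle := Finset.mem_Iic.mp hmin.1
  refine le_of_lt ⟨Finset.min' _ hne, fun l hl => ?_, ?_⟩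
  · simp only [ofLex_toLex]
    rw [imageExp_apply hf, leadExp_apply, if_pos (hl.le.trans hle), if_pos]
    by_contra hn
    exact absurd hl (not_lt.mpr (Finset.min'_le _ _
      (Finset.mem_sdiff.mpr ⟨Finset.mem_Iic.mpr (hl.le.trans hle), hn⟩)))
  · simp only [ofLex_toLex]
    rw [imageExp_apply hf, leadExp_apply, if_pos hle, if_neg hmin.2]
    exact Nat.zero_lt_one

lemma lexLe_minorPoly (H : Matrix (Fin m) (Fin m) ℝ) (i : Fin m) :
    LexLe (minorPoly H i) (leadExp i) := by
  classical
  obtain ⟨c, hc⟩ := minorPoly_eq_sum H i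
  intro k hk
  rw [hc, coeff_sum] at hk
  obtain ⟨f, hf, hne⟩ := Finset.exists_ne_zero_of_sum_ne_zero hk
  rw [coeff_monomial] at hne
  have : imageExp f = k := by
    by_contra h
    exact hne (if_neg h)
  rw [← this]
  exact imageExp_le_leadExp (Finset.mem_filter.mp hf).2

/-- All monomials are squarefree of degree `i + 1`, so evaluation at the indicator of `l ≤ i`
retains only `x_0 ⋯ x_i`. The right side is a minor of a positive semidefinite matrix, which reveals
the sign. -/
lemma coeff_leadExp_minorPoly (H : Matrix (Fin m) (Fin m) ℝ) (i : Fin m) :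
    coeff (leadExp i) (minorPoly H i) =
      leadingMinor (H * Matrix.diagonal (fun l => if l ≤ i then 1 else 0) * Hᵀ) i := by
  classical
  rw [← eval_minorPoly]
  obtain ⟨c, hc⟩ := minorPoly_eq_sum H i
  rw [hc, coeff_sum, map_sum]
  refine Finset.sum_congr rfl fun f hf => ?_
  have hf := (Finset.mem_filter.mp hf).2
  rw [coeff_monomial, imageExp, monomial_sum_index, map_mul, eval_C, map_prod]
  rw [← imageExp]
  by_cases h : ∀ a, f a ≤ i
  · rw [if_pos ((imageExp_eq_leadExp_iff hf).mpr h), Finset.prod_eq_one, mul_one]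
    intro a _
    simp [eval_monomial, h a]
  · rw [if_neg fun h' => h ((imageExp_eq_leadExp_iff hf).mp h')]
    push Not at h
    obtain ⟨a, ha⟩ := h
    rw [Finset.prod_eq_zero (Finset.mem_univ a), mul_zero]
    simp [eval_monomial, not_le.mpr ha]

lemma coeff_leadExp_minorPoly_nonneg (H : Matrix (Fin m) (Fin m) ℝ) (i : Fin m) :
    0 ≤ coeff (leadExp i) (minorPoly H i) := by
  rw [coeff_leadExp_minorPoly]
  have h1 : (Matrix.diagonal fun l : Fin m => if l ≤ i then (1 : ℝ) else 0).PosSemidef :=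
    Matrix.PosSemidef.diagonal fun l => by
      simp only [Pi.zero_apply]
      split_ifs <;> norm_num
  have h2 := h1.mul_mul_conjTranspose_same H
  rw [Matrix.conjTranspose_eq_transpose_of_trivial] at h2
  exact (h2.submatrix _).det_nonneg

lemma coeff_leadExp_minorPoly_one (i : Fin m) :
    coeff (leadExp i) (minorPoly (1 : Matrix (Fin m) (Fin m) ℝ) i) = 1 := by
  rw [coeff_leadExp_minorPoly, Matrix.one_mul, Matrix.transpose_one, Matrix.mul_one, leadingMinor]
  rw [Matrix.submatrix_diagonal _ _ (Fin.castLE_injective _), Matrix.det_diagonal]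
  refine Finset.prod_eq_one fun a _ => if_pos ?_
  rw [Fin.le_def, Fin.val_castLE]
  exact Nat.lt_succ_iff.mp a.isLt

end MinorPoly

/-! ### Zonal polynomials span the symmetric polynomials -/

section Span

open MvPolynomial

/-- The product of powers of leading minors of `H diag(X) Hᵀ`, as a polynomial. -/
noncomputable def minorProdPoly (κ : Fin m → ℕ) (H : Matrix.orthogonalGroup (Fin m) ℝ) :
    MvPolynomial (Fin m) ℝ :=
  ∏ i, minorPoly (H : Matrix (Fin m) (Fin m) ℝ) i ^ partGap κ i

lemma contCoeff_minorProdPoly (κ : Fin m → ℕ) : ContCoeff (minorProdPoly κ) :=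
  ContCoeff.prod _ fun i => (contCoeff_minorPoly i).pow _

lemma isHomogeneous_minorProdPoly {κ : Fin m → ℕ} (hκ : Antitone κ)
    (H : Matrix.orthogonalGroup (Fin m) ℝ) :
    (minorProdPoly κ H).IsHomogeneous (∑ i, κ i) := by
  rw [← sum_mul_partGap hκ]
  exact IsHomogeneous.prod _ _ _ fun i _ => (isHomogeneous_minorPoly _ i).pow _

lemma eval_minorProdPoly (κ : Fin m → ℕ) (H : Matrix.orthogonalGroup (Fin m) ℝ)
    (y : Fin m → ℝ) : eval y (minorProdPoly κ H) =
      minorProd κ ((H : Matrix (Fin m) (Fin m) ℝ) * Matrix.diagonal y *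
        (H : Matrix (Fin m) (Fin m) ℝ)ᵀ) := by
  rw [minorProdPoly, map_prod, minorProd]
  simp_rw [map_pow, eval_minorPoly]

lemma sum_partGap_smul_leadExp {κ : Fin m → ℕ} (hκ : Antitone κ) :
    ∑ i, partGap κ i • leadExp i = Finsupp.equivFunOnFinite.symm κ := by
  ext j
  rw [Finsupp.finsetSum_apply]
  simp only [Finsupp.smul_apply, leadExp_apply, smul_eq_mul, mul_ite, mul_one, mul_zero]
  rw [← Finset.sum_filter, sum_partGap hκ]
  rfl

lemma lexLe_minorProdPoly {κ : Fin m → ℕ} (hκ : Antitone κ)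
    (H : Matrix.orthogonalGroup (Fin m) ℝ) :
    LexLe (minorProdPoly κ H) (Finsupp.equivFunOnFinite.symm κ) ∧
      coeff (Finsupp.equivFunOnFinite.symm κ) (minorProdPoly κ H) =
        ∏ i, coeff (leadExp i) (minorPoly (H : Matrix (Fin m) (Fin m) ℝ) i) ^ partGap κ i := by
  rw [← sum_partGap_smul_leadExp hκ]
  have h := LexLe.prod Finset.univ (p := fun i =>
    minorPoly (H : Matrix (Fin m) (Fin m) ℝ) i ^ partGap κ i)
    (a := fun i => partGap κ i • leadExp i) fun i => ((lexLe_minorPoly _ i).pow _).1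
  refine ⟨h.1, h.2.trans (Finset.prod_congr rfl fun i _ => ((lexLe_minorPoly _ i).pow _).2)⟩

/-- The normalized zonal polynomial as a polynomial in the eigenvalues. -/
noncomputable def zonalPoly (κ : Fin m → ℕ) : MvPolynomial (Fin m) ℝ :=
  avgPoly (∑ i, κ i) (minorProdPoly κ)

lemma eval_zonalPoly {κ : Fin m → ℕ} (hκ : Antitone κ) (y : Fin m → ℝ) :
    eval y (zonalPoly κ) = sphericalMean κ (Matrix.diagonal y) := by
  rw [zonalPoly, eval_avgPoly (contCoeff_minorProdPoly κ) (isHomogeneous_minorProdPoly hκ)]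
  simp_rw [eval_minorProdPoly]
  rfl

lemma isSymmetric_zonalPoly {κ : Fin m → ℕ} (hκ : Antitone κ) : (zonalPoly κ).IsSymmetric :=
  isSymmetric_avgPoly (contCoeff_minorProdPoly κ) (isHomogeneous_minorProdPoly hκ)
    (eval_minorProdPoly κ)

lemma lexLe_zonalPoly {κ : Fin m → ℕ} (hκ : Antitone κ) :
    LexLe (zonalPoly κ) (Finsupp.equivFunOnFinite.symm κ) := by
  intro k hk
  by_contra h
  refine hk ?_
  rw [zonalPoly, coeff_avgPoly (isHomogeneous_minorProdPoly hκ)]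
  have : ∀ H, coeff k (minorProdPoly κ H) = 0 := fun H => by
    by_contra h'
    exact h ((lexLe_minorProdPoly hκ H).1 k h')
  simp [this]

/-- The leading coefficient is the Haar integral of a continuous non-negative function of `H` whose
value at `H = 1` is 1. -/
lemma coeff_zonalPoly_pos {κ : Fin m → ℕ} (hκ : Antitone κ) :
    0 < coeff (Finsupp.equivFunOnFinite.symm κ) (zonalPoly κ) := by
  rw [zonalPoly, coeff_avgPoly (isHomogeneous_minorProdPoly hκ)]
  refine Continuous.integral_pos_of_hasCompactSupport_nonneg_nonzero (x := 1)
    (contCoeff_minorProdPoly κ _) (HasCompactSupport.of_compactSpace _) (fun H => ?_) ?_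
  · rw [(lexLe_minorProdPoly hκ H).2]
    exact Finset.prod_nonneg fun i _ => pow_nonneg (coeff_leadExp_minorPoly_nonneg _ i) _
  · rw [(lexLe_minorProdPoly hκ 1).2, Submonoid.coe_one]
    simp [coeff_leadExp_minorPoly_one]

/-- Zonal polynomials of weight `k` span the symmetric homogeneous polynomials of degree `k`. -/
lemma mem_span_zonalPoly {k : ℕ} {p : MvPolynomial (Fin m) ℝ} (hs : p.IsSymmetric)
    (hh : p.IsHomogeneous k) :
    p ∈ Submodule.span ℝ (zonalPoly '' (partitions m k : Set (Fin m → ℕ))) := by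
  -- Well-founded induction on a lexicographic bound for the exponents. The leading exponent of a
  -- symmetric polynomial is antitone, hence a partition, and subtracting a multiple of its zonal
  -- polynomial lowers the bound.
  suffices H : ∀ t : Lex (Fin m →₀ ℕ), ∀ p : MvPolynomial (Fin m) ℝ, p.IsSymmetric →
      p.IsHomogeneous k → (∀ n, coeff n p ≠ 0 → toLex n ≤ t) →
      p ∈ Submodule.span ℝ (zonalPoly '' (partitions m k : Set (Fin m → ℕ))) by
    refine H (p.support.sup toLex) p hs hh fun n hn => ?_
    exact Finset.le_sup (f := toLex) (mem_support_iff.mpr hn)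
  intro t
  induction t using WellFoundedLT.induction with
  | _ t ih =>
    intro p hs hh ht
    by_cases hp : p = 0
    · rw [hp]; exact Submodule.zero_mem _
    obtain ⟨n, hn, hmax⟩ := AddMonoidAlgebra.exists_supDegree_mem_support
      (D := (toLex : (Fin m →₀ ℕ) → Lex (Fin m →₀ ℕ))) hp
    have hanti : Antitone (n : Fin m → ℕ) := by
      have := hs.antitone_supDegree
      rwa [hmax] at this
    have hn' : coeff n p ≠ 0 := Finsupp.mem_support_iff.mp hn
    have hle : ∀ k, coeff k p ≠ 0 → toLex k ≤ toLex n := fun k hk => by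
      rw [← hmax]
      exact Finset.le_sup (f := toLex) (Finsupp.mem_support_iff.mpr hk)
    have hpart : (n : Fin m → ℕ) ∈ partitions m k :=
      mem_partitions.mpr ⟨(Finset.mem_finsuppAntidiag.mp
        (mem_finsuppAntidiag_of_coeff_ne_zero hh hn')).1, hanti⟩
    have hnn : Finsupp.equivFunOnFinite.symm (n : Fin m → ℕ) = n := by ext; rfl
    have hpos := coeff_zonalPoly_pos hanti
    have hlez := lexLe_zonalPoly hanti
    rw [hnn] at hpos hlez
    set c := coeff n p / coeff n (zonalPoly (n : Fin m → ℕ)) with hc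
    have hz : zonalPoly (n : Fin m → ℕ) ∈
        Submodule.span ℝ (zonalPoly '' (partitions m k : Set (Fin m → ℕ))) :=
      Submodule.subset_span ⟨_, hpart, rfl⟩
    have hzh : (zonalPoly (n : Fin m → ℕ)).IsHomogeneous k := by
      have : (zonalPoly (n : Fin m → ℕ)).IsHomogeneous (∑ i, n i) := isHomogeneous_avgPoly
      rwa [(mem_partitions.mp hpart).1] at this
    have hq0 : coeff n (p - c • zonalPoly (n : Fin m → ℕ)) = 0 := by
      rw [coeff_sub, coeff_smul, smul_eq_mul, hc, div_mul_cancel₀ _ hpos.ne', sub_self]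
    have hqle : ∀ k, coeff k (p - c • zonalPoly (n : Fin m → ℕ)) ≠ 0 → toLex k < toLex n := by
      intro k hk
      refine lt_of_le_of_ne ?_ fun h => ?_
      · by_contra h
        rw [coeff_sub, coeff_smul, smul_eq_mul] at hk
        have h1 : coeff k p = 0 := by by_contra h'; exact h (hle k h')
        have h2 : coeff k (zonalPoly (n : Fin m → ℕ)) = 0 := by
          by_contra h'; exact h (hlez k h')
        rw [h1, h2] at hk
        simp at hk
      · rw [toLex.injective h] at hk
        exact hk hq0
    have hq : p - c • zonalPoly (n : Fin m → ℕ) ∈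
        Submodule.span ℝ (zonalPoly '' (partitions m k : Set (Fin m → ℕ))) := by
      by_cases hq : p - c • zonalPoly (n : Fin m → ℕ) = 0
      · rw [hq]; exact Submodule.zero_mem _
      obtain ⟨l, hl, hlmax⟩ := AddMonoidAlgebra.exists_supDegree_mem_support
        (D := (toLex : (Fin m →₀ ℕ) → Lex (Fin m →₀ ℕ))) hq
      refine ih (toLex l) ((hqle l (Finsupp.mem_support_iff.mp hl)).trans_le (ht n hn')) _ ?_ ?_ ?_
      · exact hs.sub ((isSymmetric_zonalPoly hanti).smul c)
      · refine hh.sub ?_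
        rw [smul_eq_C_mul]
        simpa using (isHomogeneous_C (Fin m) c).mul hzh
      · intro k hk
        rw [← hlmax]
        exact Finset.le_sup (f := toLex) (Finsupp.mem_support_iff.mpr hk)
    have := Submodule.add_mem _ hq (Submodule.smul_mem _ c hz)
    rwa [sub_add_cancel] at this

lemma exists_orthogonal_diagonal {T : Matrix (Fin m) (Fin m) ℝ} (hT : T.IsHermitian) :
    ∃ (U : Matrix.orthogonalGroup (Fin m) ℝ) (y : Fin m → ℝ),
      T = (U : Matrix (Fin m) (Fin m) ℝ) * Matrix.diagonal y *
        (U : Matrix (Fin m) (Fin m) ℝ)ᵀ := by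
  refine ⟨hT.eigenvectorUnitary, hT.eigenvalues, ?_⟩
  have h := hT.spectral_theorem
  rw [Unitary.conjStarAlgAut_apply] at h
  simpa [Matrix.star_eq_conjTranspose, Function.comp_def] using h

/-- The spherical mean of a homogeneous polynomial is a combination of zonal polynomials. -/
lemma exists_sum_sphericalMean {k : ℕ}
    {Q : Matrix.orthogonalGroup (Fin m) ℝ → MvPolynomial (Fin m) ℝ} (hc : ContCoeff Q)
    (hQ : ∀ H, (Q H).IsHomogeneous k) {F : Matrix (Fin m) (Fin m) ℝ → ℝ}
    (hF : ∀ (H : Matrix.orthogonalGroup (Fin m) ℝ) y, eval y (Q H) =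
      F ((H : Matrix (Fin m) (Fin m) ℝ) * Matrix.diagonal y *
        (H : Matrix (Fin m) (Fin m) ℝ)ᵀ)) :
    ∃ a : (Fin m → ℕ) → ℝ, ∀ T : Matrix (Fin m) (Fin m) ℝ, T.IsHermitian →
      ∫ H : Matrix.orthogonalGroup (Fin m) ℝ, F ((H : Matrix (Fin m) (Fin m) ℝ) * T *
        (H : Matrix (Fin m) (Fin m) ℝ)ᵀ) ∂haarO m =
      ∑ κ ∈ partitions m k, a κ * sphericalMean κ T := by
  have hmem := mem_span_zonalPoly (isSymmetric_avgPoly hc hQ hF)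
    (isHomogeneous_avgPoly (k := k) (Q := Q))
  obtain ⟨a, ha⟩ := Submodule.mem_span_image_finset_iff_exists_fun ℝ |>.mp hmem
  classical
  refine ⟨fun κ => if h : κ ∈ partitions m k then a ⟨κ, h⟩ else 0, fun T hT => ?_⟩
  obtain ⟨U, y, rfl⟩ := exists_orthogonal_diagonal hT
  have h1 := eval_avgPoly hc hQ y
  simp_rw [hF] at h1
  have h2 : ∫ H : Matrix.orthogonalGroup (Fin m) ℝ, F ((H : Matrix (Fin m) (Fin m) ℝ) *
      ((U : Matrix (Fin m) (Fin m) ℝ) * Matrix.diagonal y * (U : Matrix (Fin m) (Fin m) ℝ)ᵀ) *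
        (H : Matrix (Fin m) (Fin m) ℝ)ᵀ) ∂haarO m = eval y (avgPoly k Q) := by
    rw [h1, ← integral_mul_right_eq_self (μ := haarO m)
      (fun H : Matrix.orthogonalGroup (Fin m) ℝ => F ((H : Matrix (Fin m) (Fin m) ℝ) *
        Matrix.diagonal y * (H : Matrix (Fin m) (Fin m) ℝ)ᵀ)) U]
    refine integral_congr_ae (Filter.Eventually.of_forall fun H => ?_)
    simp only [Submonoid.coe_mul, Matrix.transpose_mul, Matrix.mul_assoc]
  rw [h2, ← ha, map_sum, ← Finset.sum_coe_sort (partitions m k)]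
  refine Finset.sum_congr rfl fun κ _ => ?_
  rw [smul_eval, eval_zonalPoly (mem_partitions.mp κ.2).2, sphericalMean_conj]
  simp only [dif_pos κ.2]

/-- The linear form `Y ↦ ∑ A_ij Y_ij`. -/
def linForm (A Y : Matrix (Fin m) (Fin m) ℝ) : ℝ := ∑ i, ∑ j, A i j * Y i j

/-- The factor `T.trace ^ 2` raises the weight to at least 2, so that only partitions occurring in
`K` appear. -/
lemma exists_sum_sphericalMean_linForm (A : Matrix (Fin m) (Fin m) ℝ) (k : ℕ) :
    ∃ a : (Fin m → ℕ) → ℝ, ∀ T : Matrix (Fin m) (Fin m) ℝ, T.IsHermitian →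
      ∫ H : Matrix.orthogonalGroup (Fin m) ℝ, T.trace ^ 2 *
        linForm A ((H : Matrix (Fin m) (Fin m) ℝ) * T *
          (H : Matrix (Fin m) (Fin m) ℝ)ᵀ) ^ k ∂haarO m =
      ∑ κ ∈ partitions m (2 + k), a κ * sphericalMean κ T := by
  set b : Matrix.orthogonalGroup (Fin m) ℝ → Fin m → ℝ := fun H l =>
    ∑ i, ∑ j, A i j * ((H : Matrix (Fin m) (Fin m) ℝ) i l * (H : Matrix (Fin m) (Fin m) ℝ) j l)
    with hb
  have hbc : ∀ l, Continuous fun H => b H l := fun l =>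
    continuous_finsetSum _ fun i _ => continuous_finsetSum _ fun j _ => continuous_const.mul
      ((continuous_subtype_val.matrix_elem i l).mul (continuous_subtype_val.matrix_elem j l))
  obtain ⟨a, ha⟩ := exists_sum_sphericalMean (k := 2 + k)
    (Q := fun H => (∑ l, X l) ^ 2 * (∑ l, C (b H l) * X l) ^ k)
    (F := fun Y => Y.trace ^ 2 * linForm A Y ^ k)
    ((ContCoeff.const _).mul ((ContCoeff.sum _ fun l => ContCoeff.C_mul (hbc l) _).pow k))
    (fun H => by
      have h1 : (∑ l : Fin m, (X l : MvPolynomial (Fin m) ℝ)).IsHomogeneous 1 :=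
        IsHomogeneous.sum _ _ _ fun l _ => isHomogeneous_X _ l
      have h2 : (∑ l : Fin m, (C (b H l) * X l : MvPolynomial (Fin m) ℝ)).IsHomogeneous 1 :=
        IsHomogeneous.sum _ _ _ fun l _ => isHomogeneous_C_mul_X _ l
      simpa using (h1.pow 2).mul (h2.pow k))
    (fun H y => by
      have htr := trace_conj (Matrix.diagonal y) H
      rw [Matrix.trace_diagonal] at htr
      have hlin : linForm A ((H : Matrix (Fin m) (Fin m) ℝ) * Matrix.diagonal y *
          (H : Matrix (Fin m) (Fin m) ℝ)ᵀ) = ∑ l, b H l * y l := by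
        have he : ∀ i j, ((H : Matrix (Fin m) (Fin m) ℝ) * Matrix.diagonal y *
            (H : Matrix (Fin m) (Fin m) ℝ)ᵀ) i j = ∑ l, (H : Matrix (Fin m) (Fin m) ℝ) i l *
              y l * (H : Matrix (Fin m) (Fin m) ℝ) j l := fun i j => by
          rw [Matrix.mul_apply]
          simp_rw [Matrix.mul_diagonal, Matrix.transpose_apply]
        simp_rw [linForm, hb, he, Finset.mul_sum, Finset.sum_mul]
        rw [Finset.sum_comm_cycle]
        refine Finset.sum_congr rfl fun l _ => Finset.sum_congr rfl fun i _ =>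
          Finset.sum_congr rfl fun j _ => by ring
      simp only [map_mul, map_pow, map_sum, eval_X, eval_C]
      rw [htr, hlin])
  refine ⟨a, fun T hT => ?_⟩
  rw [← ha T hT]
  simp_rw [trace_conj]

end Span

/-! ### Orthogonal invariance of the Wishart distribution -/

section Invariance

lemma symOfUpper_apply_of_le (x : {p : Fin m × Fin m // p.1 ≤ p.2} → ℝ)
    (p : {p : Fin m × Fin m // p.1 ≤ p.2}) : symOfUpper m x p.1.1 p.1.2 = x p := by
  simp [symOfUpper, p.2]

lemma symOfUpper_symm (x : {p : Fin m × Fin m // p.1 ≤ p.2} → ℝ) (i j : Fin m) :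
    symOfUpper m x i j = symOfUpper m x j i := by
  rcases lt_trichotomy i j with h | h | h
  · simp [symOfUpper, h.le, not_le.mpr h]
  · rw [h]
  · simp [symOfUpper, h.le, not_le.mpr h]

lemma symOfUpper_transpose (x : {p : Fin m × Fin m // p.1 ≤ p.2} → ℝ) :
    (symOfUpper m x)ᵀ = symOfUpper m x := by
  ext i j
  exact symOfUpper_symm x j i

lemma symOfUpper_of_symm {Y : Matrix (Fin m) (Fin m) ℝ} (hY : Yᵀ = Y) :
    symOfUpper m (fun p => Y p.1.1 p.1.2) = Y := by
  ext i j
  by_cases h : i ≤ j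
  · simp [symOfUpper, h]
  · simp only [symOfUpper, Matrix.of_apply, dif_neg h]
    exact congrFun (congrFun hY i) j

lemma symOfUpper_add (x y : {p : Fin m × Fin m // p.1 ≤ p.2} → ℝ) :
    symOfUpper m (x + y) = symOfUpper m x + symOfUpper m y := by
  ext i j
  by_cases h : i ≤ j <;> simp [symOfUpper, h]

lemma symOfUpper_smul (c : ℝ) (x : {p : Fin m × Fin m // p.1 ≤ p.2} → ℝ) :
    symOfUpper m (c • x) = c • symOfUpper m x := by
  ext i j
  by_cases h : i ≤ j <;> simp [symOfUpper, h]

/-- Conjugation by an orthogonal matrix in the coordinates on and above the diagonal. -/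
def conjUpper (H : Matrix.orthogonalGroup (Fin m) ℝ) :
    ({p : Fin m × Fin m // p.1 ≤ p.2} → ℝ) →ₗ[ℝ] ({p : Fin m × Fin m // p.1 ≤ p.2} → ℝ) where
  toFun x := fun p => ((H : Matrix (Fin m) (Fin m) ℝ) * symOfUpper m x *
    (H : Matrix (Fin m) (Fin m) ℝ)ᵀ) p.1.1 p.1.2
  map_add' x y := by
    funext p
    rw [symOfUpper_add, Matrix.mul_add, Matrix.add_mul]
    rfl
  map_smul' c x := by
    funext p
    rw [symOfUpper_smul, Matrix.mul_smul, Matrix.smul_mul]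
    rfl

lemma symOfUpper_conjUpper (H : Matrix.orthogonalGroup (Fin m) ℝ)
    (x : {p : Fin m × Fin m // p.1 ≤ p.2} → ℝ) :
    symOfUpper m (conjUpper H x) = (H : Matrix (Fin m) (Fin m) ℝ) * symOfUpper m x *
      (H : Matrix (Fin m) (Fin m) ℝ)ᵀ := by
  refine symOfUpper_of_symm (Y := (H : Matrix (Fin m) (Fin m) ℝ) * symOfUpper m x *
      (H : Matrix (Fin m) (Fin m) ℝ)ᵀ) ?_
  rw [Matrix.transpose_mul, Matrix.transpose_mul, Matrix.transpose_transpose,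
    symOfUpper_transpose, Matrix.mul_assoc]

lemma symOfUpper_injective : Function.Injective (symOfUpper m) := fun x y h => by
  funext p
  rw [← symOfUpper_apply_of_le x, h, symOfUpper_apply_of_le]

lemma conjUpper_inv (H : Matrix.orthogonalGroup (Fin m) ℝ) :
    (conjUpper H⁻¹) ∘ₗ (conjUpper H) = LinearMap.id := by
  refine LinearMap.ext fun x => symOfUpper_injective ?_
  rw [LinearMap.comp_apply, symOfUpper_conjUpper, symOfUpper_conjUpper, LinearMap.id_apply]
  have h1 : ((H⁻¹ : Matrix.orthogonalGroup (Fin m) ℝ) : Matrix (Fin m) (Fin m) ℝ) *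
      (H : Matrix (Fin m) (Fin m) ℝ) = 1 := by
    rw [← Submonoid.coe_mul, inv_mul_cancel, Submonoid.coe_one]
  have h2 : (H : Matrix (Fin m) (Fin m) ℝ)ᵀ *
      ((H⁻¹ : Matrix.orthogonalGroup (Fin m) ℝ) : Matrix (Fin m) (Fin m) ℝ)ᵀ = 1 := by
    rw [← Matrix.transpose_mul, h1, Matrix.transpose_one]
  rw [Matrix.mul_assoc, Matrix.mul_assoc _ _ ((H : Matrix (Fin m) (Fin m) ℝ)ᵀ), Matrix.mul_assoc,
    Matrix.mul_assoc, h2, ← Matrix.mul_assoc, h1, Matrix.one_mul, Matrix.mul_one]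

lemma trace_sq_symOfUpper (x : {p : Fin m × Fin m // p.1 ≤ p.2} → ℝ) :
    (symOfUpper m x * symOfUpper m x).trace = ∑ i, ∑ j, symOfUpper m x i j ^ 2 := by
  rw [Matrix.trace]
  refine Finset.sum_congr rfl fun i _ => ?_
  rw [Matrix.diag_apply, Matrix.mul_apply]
  exact Finset.sum_congr rfl fun j _ => by rw [symOfUpper_symm x j i, sq]

/-- A linear bijection scales Lebesgue measure by a constant. The unit ball of the invariant
quadratic form `tr(X²)` has finite positive volume and is mapped to itself, so the constant is 1. -/
lemma map_conjUpper (H : Matrix.orthogonalGroup (Fin m) ℝ) :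
    Measure.map (conjUpper H) volume = volume := by
  have hdet : LinearMap.det (conjUpper H) ≠ 0 := fun h => by
    have := congrArg LinearMap.det (conjUpper_inv H)
    rw [LinearMap.det_comp, h, mul_zero, LinearMap.det_id] at this
    exact zero_ne_one this
  have hmap := Real.map_linearMap_volume_pi_eq_smul_volume_pi hdet
  set c := ENNReal.ofReal |(LinearMap.det (conjUpper H))⁻¹| with hc
  set q : ({p : Fin m × Fin m // p.1 ≤ p.2} → ℝ) → ℝ :=
    fun x => (symOfUpper m x * symOfUpper m x).trace with hq
  have hqc : Continuous q := by
    have h1 : Continuous fun x => symOfUpper m x := by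
      refine continuous_matrix fun i j => ?_
      by_cases h : i ≤ j
      · simpa [symOfUpper, h] using continuous_apply _
      · simpa [symOfUpper, h] using continuous_apply _
    exact (h1.matrix_mul h1).matrix_trace
  have hqinv : ∀ x, q (conjUpper H x) = q x := by
    intro x
    simp only [hq, symOfUpper_conjUpper]
    rw [← trace_conj (symOfUpper m x * symOfUpper m x) H]
    congr 1
    rw [Matrix.mul_assoc ((H : Matrix (Fin m) (Fin m) ℝ) * symOfUpper m x),
      ← Matrix.mul_assoc ((H : Matrix (Fin m) (Fin m) ℝ)ᵀ),
      ← Matrix.mul_assoc ((H : Matrix (Fin m) (Fin m) ℝ)ᵀ), orthogonal_transpose_mul,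
      Matrix.one_mul]
    simp only [Matrix.mul_assoc]
  set B : Set ({p : Fin m × Fin m // p.1 ≤ p.2} → ℝ) := {x | q x < 1} with hB
  have hBo : IsOpen B := isOpen_lt hqc continuous_const
  have hB0 : volume B ≠ 0 := by
    refine (hBo.measure_pos volume ⟨0, ?_⟩).ne'
    have h0 : symOfUpper m (0 : {p : Fin m × Fin m // p.1 ≤ p.2} → ℝ) = 0 := by
      simpa using symOfUpper_smul 0 (0 : {p : Fin m × Fin m // p.1 ≤ p.2} → ℝ)
    change q 0 < 1
    simp [hq, h0]
  have hBfin : volume B ≠ ∞ := by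
    refine ((measure_mono ?_).trans_lt
      (isCompact_univ_pi fun _ => isCompact_Icc (a := (-1 : ℝ)) (b := 1)).measure_lt_top).ne
    intro x hx p _
    have hx1 : ∑ i, ∑ j, symOfUpper m x i j ^ 2 < 1 := by
      rw [← trace_sq_symOfUpper]; exact hx
    have h1 : symOfUpper m x p.1.1 p.1.2 ^ 2 ≤ ∑ i, ∑ j, symOfUpper m x i j ^ 2 :=
      (Finset.single_le_sum (f := fun j => symOfUpper m x p.1.1 j ^ 2)
        (fun j _ => sq_nonneg _) (Finset.mem_univ p.1.2)).trans
        (Finset.single_le_sum (f := fun i => ∑ j, symOfUpper m x i j ^ 2)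
          (fun i _ => Finset.sum_nonneg fun j _ => sq_nonneg _) (Finset.mem_univ p.1.1))
    rw [symOfUpper_apply_of_le] at h1
    exact abs_le.mp ((sq_le_one_iff_abs_le_one _).mp (h1.trans hx1.le))
  have hpre : (conjUpper H) ⁻¹' B = B := by
    ext x
    change q (conjUpper H x) < 1 ↔ q x < 1
    rw [hqinv]
  have hmeas : Measurable (conjUpper H) := (LinearMap.continuous_of_finiteDimensional _).measurable
  have hBeq : volume B = c * volume B := by
    conv_lhs => rw [← hpre, ← Measure.map_apply hmeas hBo.measurableSet, hmap]
    rfl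
  have hc1 : c = 1 := by
    have : 1 * volume B = c * volume B := by rw [one_mul]; exact hBeq
    exact ((ENNReal.mul_left_inj hB0 hBfin).mp this).symm
  rw [hmap, hc1, one_smul]

lemma measurable_conj (H : Matrix.orthogonalGroup (Fin m) ℝ) :
    Measurable fun Y : Matrix (Fin m) (Fin m) ℝ =>
      (H : Matrix (Fin m) (Fin m) ℝ) * Y * (H : Matrix (Fin m) (Fin m) ℝ)ᵀ :=
  (continuous_conj.comp (Continuous.prodMk_left H)).measurable

lemma measurePreserving_symLebesgue (H : Matrix.orthogonalGroup (Fin m) ℝ) :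
    MeasurePreserving (fun Y : Matrix (Fin m) (Fin m) ℝ =>
      (H : Matrix (Fin m) (Fin m) ℝ) * Y * (H : Matrix (Fin m) (Fin m) ℝ)ᵀ)
      (symLebesgue m) (symLebesgue m) := by
  refine ⟨measurable_conj H, ?_⟩
  have hmeas : Measurable (conjUpper H) := (LinearMap.continuous_of_finiteDimensional _).measurable
  rw [symLebesgue, Measure.map_map (measurable_conj H) (measurable_symOfUpper m)]
  have : (fun Y : Matrix (Fin m) (Fin m) ℝ =>
      (H : Matrix (Fin m) (Fin m) ℝ) * Y * (H : Matrix (Fin m) (Fin m) ℝ)ᵀ) ∘ symOfUpper m =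
      symOfUpper m ∘ conjUpper H := funext fun x => (symOfUpper_conjUpper H x).symm
  rw [this, ← Measure.map_map (measurable_symOfUpper m) hmeas, map_conjUpper]

lemma mem_posDefCone_conj_iff (H : Matrix.orthogonalGroup (Fin m) ℝ)
    (Y : Matrix (Fin m) (Fin m) ℝ) :
    (H : Matrix (Fin m) (Fin m) ℝ) * Y * (H : Matrix (Fin m) (Fin m) ℝ)ᵀ ∈ posDefCone m ↔
      Y ∈ posDefCone m := by
  have := Matrix.IsUnit.posDef_star_right_conjugate_iff (x := Y) (isUnit_orthogonal H)
  rwa [Matrix.star_eq_conjTranspose, Matrix.conjTranspose_eq_transpose_of_trivial] at this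

/-- The density depends on determinant and trace only, and both the cone and `symLebesgue` are
invariant. -/
lemma measurePreserving_P₀ (α : ℝ) (H : Matrix.orthogonalGroup (Fin m) ℝ) :
    MeasurePreserving (fun Y : Matrix (Fin m) (Fin m) ℝ =>
      (H : Matrix (Fin m) (Fin m) ℝ) * Y * (H : Matrix (Fin m) (Fin m) ℝ)ᵀ)
      (P₀ m α) (P₀ m α) := by
  refine ⟨measurable_conj H, Measure.ext fun s hs => ?_⟩
  have hpre : (fun Y : Matrix (Fin m) (Fin m) ℝ =>
      (H : Matrix (Fin m) (Fin m) ℝ) * Y * (H : Matrix (Fin m) (Fin m) ℝ)ᵀ) ⁻¹' posDefCone m =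
      posDefCone m := Set.ext fun Y => mem_posDefCone_conj_iff H Y
  have hres := (measurePreserving_symLebesgue H).restrict_preimage
    (measurableSet_posDefCone (m := m))
  rw [hpre] at hres
  have hdet : Measurable fun Y : Matrix (Fin m) (Fin m) ℝ => Y.det :=
    (Continuous.matrix_det continuous_id).measurable
  have htr : Measurable fun Y : Matrix (Fin m) (Fin m) ℝ => Y.trace :=
    continuous_id.matrix_trace.measurable
  have hd : Measurable fun X : Matrix (Fin m) (Fin m) ℝ =>
      ENNReal.ofReal ((multiGamma m α)⁻¹ * X.det ^ (α - ((m : ℝ) + 1) / 2) *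
        Real.exp (-X.trace)) :=
    (((hdet.pow_const _).const_mul _).mul (Real.measurable_exp.comp htr.neg)).ennreal_ofReal
  rw [Measure.map_apply (measurable_conj H) hs, P₀, withDensity_apply _ hs,
    withDensity_apply _ (measurable_conj H hs), ← hres.setLIntegral_comp_preimage hs hd]
  simp only [trace_conj, det_conj]

lemma ae_mem_posDefCone (α : ℝ) : ∀ᵐ Y ∂P₀ m α, Y ∈ posDefCone m :=
  (withDensity_absolutelyContinuous _ _).ae_le (ae_restrict_mem measurableSet_posDefCone)

/-- The integral of a non-integrable function is 0 by convention, so a non-zero gamma value already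
entails integrability of the density. -/
lemma isFiniteMeasure_P₀ {α : ℝ} (hΓ : multiGamma m α ≠ 0) : IsFiniteMeasure (P₀ m α) := by
  refine isFiniteMeasure_withDensity_ofReal ?_
  have hi : Integrable (fun R : Matrix (Fin m) (Fin m) ℝ =>
      R.det ^ (α - ((m : ℝ) + 1) / 2) * Real.exp (-R.trace))
      ((symLebesgue m).restrict (posDefCone m)) := by
    by_contra h
    exact hΓ (integral_undef h)
  simpa only [mul_assoc] using (hi.const_mul (multiGamma m α)⁻¹).2

/-- The convention `0⁻¹ = 0` makes the density vanish. Separating this case spares a proof that the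
gamma integral converges and is positive. -/
lemma P₀_eq_zero {α : ℝ} (hΓ : multiGamma m α = 0) : P₀ m α = 0 := by
  rw [P₀, hΓ]
  simp

end Invariance

/-! ### Completeness of the features of weight at least two -/

section Completeness

/-- The principal `2 × 2` minor at `i, j` gives `Y i j ^ 2 ≤ Y i i * Y j j`. -/
lemma posSemidef_abs_apply_le_trace {Y : Matrix (Fin m) (Fin m) ℝ} (hY : Y.PosSemidef)
    (i j : Fin m) : |Y i j| ≤ Y.trace := by
  have hdiag : ∀ l, Y l l ≤ Y.trace := fun l =>
    Finset.single_le_sum (f := fun l => Y l l) (fun l _ => hY.diag_nonneg) (Finset.mem_univ l)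
  have h := (hY.submatrix ![i, j]).det_nonneg
  rw [Matrix.det_fin_two] at h
  simp only [Matrix.submatrix_apply, Matrix.cons_val_zero, Matrix.cons_val_one] at h
  have hs : Y j i = Y i j := by
    have := hY.isHermitian.apply i j
    simpa using this
  rw [hs] at h
  refine abs_le_of_sq_le_sq ?_ hY.trace_nonneg
  have := mul_le_mul (hdiag i) (hdiag j) hY.diag_nonneg hY.trace_nonneg
  nlinarith

lemma abs_linForm_le (A : Matrix (Fin m) (Fin m) ℝ) {Y : Matrix (Fin m) (Fin m) ℝ}
    (hY : Y.PosSemidef) : |linForm A Y| ≤ (∑ i, ∑ j, |A i j|) * Y.trace := by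
  rw [linForm, Finset.sum_mul]
  refine (Finset.abs_sum_le_sum_abs _ _).trans (Finset.sum_le_sum fun i _ => ?_)
  rw [Finset.sum_mul]
  refine (Finset.abs_sum_le_sum_abs _ _).trans (Finset.sum_le_sum fun j _ => ?_)
  rw [abs_mul]
  exact mul_le_mul_of_nonneg_left (posSemidef_abs_apply_le_trace hY i j) (abs_nonneg _)

lemma continuous_linForm (A : Matrix (Fin m) (Fin m) ℝ) :
    Continuous fun Y : Matrix (Fin m) (Fin m) ℝ => linForm A Y :=
  continuous_finsetSum _ fun i _ => continuous_finsetSum _ fun j _ =>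
    continuous_const.mul (continuous_id.matrix_elem i j)

lemma continuous_exp_neg_trace (α : ℝ) :
    Continuous fun S : Matrix (Fin m) (Fin m) ℝ => Real.exp (-(α⁻¹ * S.trace)) :=
  Real.continuous_exp.comp (continuous_const.mul continuous_id.matrix_trace).neg

variable {α : ℝ} {g : Matrix (Fin m) (Fin m) ℝ → ℝ}

/-- A single term of the kernel series on the diagonal `S = T` is at most 1. -/
lemma norm_feature_le (hα0 : 0 < α) (hα : (m : ℝ) / 2 ≤ α) (i : PartIndex m)
    {T : Matrix (Fin m) (Fin m) ℝ} (hT : T.PosDef) :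
    ‖feature α i T‖ ≤ √(kernelCoeff α (i.2 : Fin m → ℕ))⁻¹ := by
  have hc := kernelCoeff_pos hα0 hα i.antitone
  have h := sum_feature_le_one hα0 hα {i} hT hT
  rw [Finset.sum_singleton] at h
  refine Real.le_sqrt_of_sq_le ?_
  rw [Real.norm_eq_abs, sq_abs, ← one_div, le_div_iff₀ hc]
  linarith

/-- By invariance of `P₀` and `g`, `T` may be replaced by `H T Hᵀ` inside the linear form. Averaging
over `H` and exchanging integrals turns the integrand into a combination of features of weight `2 +
k`, times `g`. -/
lemma integral_moment_eq_zero [IsFiniteMeasure (P₀ m α)] (hα0 : 0 < α)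
    (hα : (m : ℝ) / 2 ≤ α) (hg : Measurable g)
    (hinv : ∀ Y : Matrix (Fin m) (Fin m) ℝ, Y.PosDef →
      ∀ H : Matrix.orthogonalGroup (Fin m) ℝ, g ((H : Matrix (Fin m) (Fin m) ℝ) * Y *
        (H : Matrix (Fin m) (Fin m) ℝ)ᵀ) = g Y)
    (hi : Integrable g (P₀ m α))
    (h0 : ∀ i : PartIndex m, 2 ≤ i.1 → ∫ T, feature α i T * g T ∂P₀ m α = 0)
    (A : Matrix (Fin m) (Fin m) ℝ) (k : ℕ) :
    ∫ T : Matrix (Fin m) (Fin m) ℝ, (Real.exp (-(α⁻¹ * T.trace)) * T.trace ^ 2 * g T) *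
      linForm A T ^ k ∂P₀ m α = 0 := by
  have hP := ae_mem_posDefCone (m := m) α
  set C := ∑ i, ∑ j, |A i j| with hC
  have hC0 : 0 ≤ C := Finset.sum_nonneg fun i _ => Finset.sum_nonneg fun j _ => abs_nonneg _
  set ψ : Matrix (Fin m) (Fin m) ℝ → Matrix.orthogonalGroup (Fin m) ℝ → ℝ := fun T H =>
    (Real.exp (-(α⁻¹ * T.trace)) * T.trace ^ 2 * g T) * linForm A
      ((H : Matrix (Fin m) (Fin m) ℝ) * T * (H : Matrix (Fin m) (Fin m) ℝ)ᵀ) ^ k with hψ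
  have hconst : ∀ H, ∫ T, ψ T H ∂P₀ m α =
      ∫ T : Matrix (Fin m) (Fin m) ℝ, (Real.exp (-(α⁻¹ * T.trace)) * T.trace ^ 2 * g T) *
        linForm A T ^ k ∂P₀ m α := by
    intro H
    have htr : Measurable fun Y : Matrix (Fin m) (Fin m) ℝ => Y.trace :=
      continuous_id.matrix_trace.measurable
    have h := integral_map (μ := P₀ m α) (measurable_conj H).aemeasurable
      (f := fun T : Matrix (Fin m) (Fin m) ℝ =>
        (Real.exp (-(α⁻¹ * T.trace)) * T.trace ^ 2 * g T) * linForm A T ^ k)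
      ((((continuous_exp_neg_trace α).measurable.mul (htr.pow_const 2)).mul hg).mul
        ((continuous_linForm A).measurable.pow_const k)).aestronglyMeasurable
    rw [(measurePreserving_P₀ α H).map_eq] at h
    rw [h]
    refine integral_congr_ae ?_
    filter_upwards [hP] with T hT
    simp only [hψ, trace_conj, hinv T hT H]
  have hbound : ∀ T ∈ posDefCone m, ∀ H,
      ‖ψ T H‖ ≤ (((2 + k) ! : ℝ) / α⁻¹ ^ (2 + k) * C ^ k) * ‖g T‖ := by
    intro T hT H
    have hTr : 0 ≤ T.trace := hT.posSemidef.trace_nonneg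
    have h1 : |linForm A ((H : Matrix (Fin m) (Fin m) ℝ) * T *
        (H : Matrix (Fin m) (Fin m) ℝ)ᵀ)| ≤ C * T.trace := by
      have := abs_linForm_le A (posDef_conj hT H).posSemidef
      rwa [trace_conj] at this
    have h2 := pow_le_const_mul_exp (inv_pos.mpr hα0) (2 + k) hTr
    have h3 : Real.exp (-(α⁻¹ * T.trace)) * T.trace ^ (2 + k) ≤
        ((2 + k) ! : ℝ) / α⁻¹ ^ (2 + k) := by
      rw [Real.exp_neg, inv_mul_le_iff₀ (Real.exp_pos _), mul_comm]
      exact h2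
    simp only [hψ, norm_mul, norm_pow, Real.norm_eq_abs, abs_of_nonneg (Real.exp_pos _).le,
      abs_of_nonneg hTr]
    calc Real.exp (-(α⁻¹ * T.trace)) * T.trace ^ 2 * |g T| * |linForm A _| ^ k
        ≤ Real.exp (-(α⁻¹ * T.trace)) * T.trace ^ 2 * |g T| * (C * T.trace) ^ k := by
          gcongr
      _ = (Real.exp (-(α⁻¹ * T.trace)) * T.trace ^ (2 + k)) * C ^ k * |g T| := by
          rw [mul_pow, pow_add]; ring
      _ ≤ ((2 + k) ! : ℝ) / α⁻¹ ^ (2 + k) * C ^ k * |g T| := by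
          gcongr
  have hmeas : Measurable (Function.uncurry ψ) := by
    have htr : Measurable fun p : Matrix (Fin m) (Fin m) ℝ × Matrix.orthogonalGroup (Fin m) ℝ =>
        p.1.trace := continuous_fst.matrix_trace.measurable
    exact (((((continuous_exp_neg_trace α).comp continuous_fst).measurable.mul
      (htr.pow_const 2)).mul (hg.comp measurable_fst)).mul
        (((continuous_linForm A).comp continuous_conj).measurable.pow_const k))
  have hint : Integrable (Function.uncurry ψ) ((P₀ m α).prod (haarO m)) := by
    refine Integrable.mono' ((hi.norm.comp_fst (haarO m)).const_mul
      (((2 + k) ! : ℝ) / α⁻¹ ^ (2 + k) * C ^ k)) hmeas.aestronglyMeasurable ?_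
    have hP' : ∀ᵐ p ∂(P₀ m α).prod (haarO m), p.1 ∈ posDefCone m :=
      Measure.quasiMeasurePreserving_fst.ae hP
    filter_upwards [hP'] with p hp
    exact hbound p.1 hp p.2
  have hswap := integral_integral_swap (f := ψ) hint
  simp_rw [hconst] at hswap
  rw [integral_const, probReal_univ, one_smul] at hswap
  rw [← hswap]
  obtain ⟨a, ha⟩ := exists_sum_sphericalMean_linForm A k
  have hin : ∀ᵐ T ∂P₀ m α, ∫ H, ψ T H ∂haarO m =
      ∑ κ : {κ // κ ∈ partitions m (2 + k)},
        a κ * (feature α (⟨2 + k, κ⟩ : PartIndex m) T * g T) := by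
    filter_upwards [hP] with T hT
    have h := ha T hT.isHermitian
    rw [← Finset.sum_coe_sort (partitions m (2 + k))] at h
    have : ∀ H, ψ T H = (Real.exp (-(α⁻¹ * T.trace)) * g T) * (T.trace ^ 2 * linForm A
      ((H : Matrix (Fin m) (Fin m) ℝ) * T * (H : Matrix (Fin m) (Fin m) ℝ)ᵀ) ^ k) := fun H => by
      simp only [hψ]; ring
    simp_rw [this]
    rw [integral_const_mul, h, Finset.mul_sum]
    refine Finset.sum_congr rfl fun κ _ => ?_
    rw [feature]
    ring
  rw [integral_congr_ae hin, integral_finsetSum]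
  · refine Finset.sum_eq_zero fun κ _ => ?_
    rw [integral_const_mul, h0 ⟨2 + k, κ⟩ (Nat.le_add_right 2 k), mul_zero]
  · intro κ _
    refine Integrable.const_mul ?_ _
    refine hi.bdd_mul (c := √(kernelCoeff α (κ : Fin m → ℕ))⁻¹)
      (measurable_feature _).aestronglyMeasurable ?_
    filter_upwards [hP] with T hT
    exact norm_feature_le hα0 hα _ hT

end Completeness

variable {α : ℝ}

/-! ### From vanishing moments to vanishing functions -/

section Density

variable {g : Matrix (Fin m) (Fin m) ℝ → ℝ}

/-- An orthogonally invariant integrable function that is orthogonal to all features of weight at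
least two vanishes. -/
lemma ae_eq_zero_of_integral_feature_mul_eq_zero [IsFiniteMeasure (P₀ m α)] (hm : 0 < m)
    (hα0 : 0 < α) (hα : (m : ℝ) / 2 ≤ α) (hg : Measurable g)
    (hinv : ∀ Y : Matrix (Fin m) (Fin m) ℝ, Y.PosDef →
      ∀ H : Matrix.orthogonalGroup (Fin m) ℝ, g ((H : Matrix (Fin m) (Fin m) ℝ) * Y *
        (H : Matrix (Fin m) (Fin m) ℝ)ᵀ) = g Y)
    (hi : Integrable g (P₀ m α))
    (h0 : ∀ i : PartIndex m, 2 ≤ i.1 → ∫ T, feature α i T * g T ∂P₀ m α = 0) :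
    g =ᵐ[P₀ m α] 0 := by
  have hP := ae_mem_posDefCone (m := m) α
  have htr : Measurable fun Y : Matrix (Fin m) (Fin m) ℝ => Y.trace :=
    continuous_id.matrix_trace.measurable
  set h : Matrix (Fin m) (Fin m) ℝ → ℝ := fun T =>
    Real.exp (-(α⁻¹ * T.trace)) * T.trace ^ 2 * g T with hh
  have hhm : Measurable h :=
    ((continuous_exp_neg_trace α).measurable.mul (htr.pow_const 2)).mul hg
  have hexp : ∀ A : Matrix (Fin m) (Fin m) ℝ, ∃ ε > 0,
      Integrable (fun T => h T * Real.exp (ε * |linForm A T|)) (P₀ m α) := by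
    intro A
    set C := ∑ i, ∑ j, |A i j| with hC
    have hC0 : 0 ≤ C := Finset.sum_nonneg fun i _ => Finset.sum_nonneg fun j _ => abs_nonneg _
    -- Half of the decay `exp(-α⁻¹ tr T)` absorbs `(tr T)²`, the other half absorbs the exponential
    -- of the linear form. Below, `C + 1` instead of `C` covers the case `A = 0`.
    set δ : ℝ := (2 * α)⁻¹ with hδ
    have hδ0 : 0 < δ := by positivity
    refine ⟨δ / (C + 1), by positivity, ?_⟩
    refine Integrable.mono' (hi.norm.const_mul (((2)! : ℝ) / δ ^ 2)) ?_ ?_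
    · exact (hhm.mul (Real.measurable_exp.comp
        (((continuous_linForm A).measurable.abs).const_mul _))).aestronglyMeasurable
    · filter_upwards [hP] with T hT
      have hTr : 0 ≤ T.trace := hT.posSemidef.trace_nonneg
      have h1 : δ / (C + 1) * |linForm A T| ≤ δ * T.trace := by
        calc δ / (C + 1) * |linForm A T| ≤ δ / (C + 1) * (C * T.trace) := by
              gcongr; exact abs_linForm_le A hT.posSemidef
          _ ≤ δ / (C + 1) * ((C + 1) * T.trace) := by gcongr; linarith
          _ = δ * T.trace := by field_simp
      have h2 := pow_le_const_mul_exp hδ0 2 hTr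
      have h3 : Real.exp (-(α⁻¹ * T.trace)) = Real.exp (-(δ * T.trace)) *
          Real.exp (-(δ * T.trace)) := by
        rw [← Real.exp_add]
        congr 1
        rw [hδ]
        field_simp
        ring
      have h4 : Real.exp (-(δ * T.trace)) * Real.exp (δ * T.trace) = 1 := by
        rw [← Real.exp_add]; simp
      rw [hh, norm_mul, norm_mul, Real.norm_of_nonneg (Real.exp_pos _).le,
        Real.norm_of_nonneg (by positivity)]
      calc Real.exp (-(α⁻¹ * T.trace)) * T.trace ^ 2 * ‖g T‖ *
            Real.exp (δ / (C + 1) * |linForm A T|)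
          ≤ Real.exp (-(α⁻¹ * T.trace)) * (((2)! : ℝ) / δ ^ 2 * Real.exp (δ * T.trace)) *
              ‖g T‖ * Real.exp (δ * T.trace) := by gcongr
        _ = ((2)! : ℝ) / δ ^ 2 * ‖g T‖ *
              (Real.exp (-(δ * T.trace)) * Real.exp (δ * T.trace)) ^ 2 := by rw [h3]; ring
        _ = ((2)! : ℝ) / δ ^ 2 * ‖g T‖ := by rw [h4]; ring
  have hint : Integrable h (P₀ m α) := by
    obtain ⟨ε, -, he⟩ := hexp 0
    simpa [linForm] using he
  have hzero : h =ᵐ[P₀ m α] 0 := by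
    refine ae_eq_zero_of_fourier_eq_zero (E := Fin m → Fin m → ℝ) hhm hint fun L => ?_
    -- Every continuous functional on matrices is a `linForm`, with its values on the matrix units
    -- as coefficients.
    set A : Matrix (Fin m) (Fin m) ℝ := Matrix.of fun i j => L (Matrix.single i j 1) with hA
    have hL : ∀ T : Matrix (Fin m) (Fin m) ℝ, L T = linForm A T := by
      intro T
      calc L T = L (∑ i, ∑ j, T i j • Matrix.single i j (1 : ℝ)) := by
            conv_lhs => rw [Matrix.matrix_eq_sum_single T]
            simp only [Matrix.smul_single, smul_eq_mul, mul_one]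
            rfl
        _ = ∑ i, ∑ j, T i j * L (Matrix.single i j (1 : ℝ)) := by
            refine (map_sum L _ _).trans (Finset.sum_congr rfl fun i _ => ?_)
            refine (map_sum L _ _).trans (Finset.sum_congr rfl fun j _ => ?_)
            exact map_smul L _ _
        _ = linForm A T := by simp only [linForm, hA, Matrix.of_apply, mul_comm]
    obtain ⟨ε, hε, he⟩ := hexp A
    have := integral_mul_cexp_eq_zero hε hhm.aestronglyMeasurable
      (continuous_linForm A).measurable he
      (fun k => integral_moment_eq_zero hα0 hα hg hinv hi h0 A k) 1
    simp only [Complex.ofReal_one, one_mul] at this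
    rw [← this]
    exact integral_congr_ae (Filter.Eventually.of_forall fun T =>
      congrArg (fun x : ℝ => (h T : ℂ) * Complex.exp (x * Complex.I)) (hL T))
  have : Nonempty (Fin m) := ⟨⟨0, hm⟩⟩
  filter_upwards [hzero, hP] with T hT hTP
  have h1 : (0 : ℝ) < T.trace := Matrix.PosDef.trace_pos hTP
  have h2 : Real.exp (-(α⁻¹ * T.trace)) * T.trace ^ 2 ≠ 0 := by positivity
  exact (mul_eq_zero.mp hT).resolve_left h2

/-- The features are real, so the real case applies to the real and imaginary parts separately. -/
lemma ae_eq_zero_of_integral_feature_mul_eq_zero_complex [IsFiniteMeasure (P₀ m α)] (hm : 0 < m)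
    (hα0 : 0 < α) (hα : (m : ℝ) / 2 ≤ α) {f : Matrix (Fin m) (Fin m) ℝ → ℂ} (hf : Measurable f)
    (hinv : OrthInvariant f) (hi : Integrable f (P₀ m α))
    (h0 : ∀ i : PartIndex m, 2 ≤ i.1 → ∫ T, (feature α i T : ℂ) * f T ∂P₀ m α = 0) :
    f =ᵐ[P₀ m α] 0 := by
  have hfi : ∀ i : PartIndex m, Integrable (fun T => (feature α i T : ℂ) * f T) (P₀ m α) := by
    intro i
    refine hi.bdd_mul (c := √(kernelCoeff α (i.2 : Fin m → ℕ))⁻¹)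
      (Complex.measurable_ofReal.comp (measurable_feature i)).aestronglyMeasurable ?_
    filter_upwards [ae_mem_posDefCone (m := m) α] with T hT
    rw [Complex.norm_real]
    exact norm_feature_le hα0 hα i hT
  have hre : (fun T => (f T).re) =ᵐ[P₀ m α] 0 := by
    refine ae_eq_zero_of_integral_feature_mul_eq_zero hm hα0 hα (Complex.measurable_re.comp hf)
      (fun Y hY H => by rw [hinv Y hY H H.2]) hi.re fun i hi2 => ?_
    have h := integral_re (hfi i)
    rw [h0 i hi2] at h
    simpa using h
  have him : (fun T => (f T).im) =ᵐ[P₀ m α] 0 := by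
    refine ae_eq_zero_of_integral_feature_mul_eq_zero hm hα0 hα (Complex.measurable_im.comp hf)
      (fun Y hY H => by rw [hinv Y hY H H.2]) hi.im fun i hi2 => ?_
    have h := integral_im (hfi i)
    rw [h0 i hi2] at h
    simpa using h
  filter_upwards [hre, him] with T h1 h2
  exact Complex.ext h1 h2

end Density

/-! ### The integral operators -/

section Operators

lemma integrable_L2 [IsFiniteMeasure (P₀ m α)] (f : L2 m α) :
    Integrable (f : Lp ℂ 2 (P₀ m α)) (P₀ m α) :=
  (Lp.memLp (f : Lp ℂ 2 (P₀ m α))).integrable one_le_two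

lemma integral_norm_le_mul_norm [IsFiniteMeasure (P₀ m α)] (f : L2 m α) :
    ∫ T, ‖(f : Lp ℂ 2 (P₀ m α)) T‖ ∂P₀ m α ≤
      ((P₀ m α Set.univ) ^ (1 / (1 : ℝ≥0∞).toReal - 1 / (2 : ℝ≥0∞).toReal)).toReal * ‖f‖ := by
  have hm := (Lp.memLp (f : Lp ℂ 2 (P₀ m α))).1
  have h := eLpNorm_le_eLpNorm_mul_rpow_measure_univ (p := 1) (q := 2) one_le_two hm
  rw [integral_norm_eq_lintegral_enorm hm, ← eLpNorm_one_eq_lintegral_enorm, mul_comm,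
    Submodule.coe_norm, Lp.norm_def, ← ENNReal.toReal_mul]
  refine ENNReal.toReal_mono (ENNReal.mul_ne_top (Lp.eLpNorm_ne_top _) ?_) h
  refine ENNReal.rpow_ne_top_of_nonneg ?_ (measure_ne_top _ _)
  norm_num

lemma feature_conj (i : PartIndex m) (Y : Matrix (Fin m) (Fin m) ℝ)
    (H : Matrix.orthogonalGroup (Fin m) ℝ) :
    feature α i ((H : Matrix (Fin m) (Fin m) ℝ) * Y * (H : Matrix (Fin m) (Fin m) ℝ)ᵀ) =
      feature α i Y := by
  rw [feature, feature, trace_conj, sphericalMean_conj]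

variable {c : PartIndex m → ℝ} {k : Matrix (Fin m) (Fin m) ℝ → Matrix (Fin m) (Fin m) ℝ → ℝ}

open Classical in
/-- The integral transform with kernel `k`, extended by zero outside of the cone. -/
noncomputable def kernelTransform
    (k : Matrix (Fin m) (Fin m) ℝ → Matrix (Fin m) (Fin m) ℝ → ℝ) (f : L2 m α)
    (S : Matrix (Fin m) (Fin m) ℝ) : ℂ :=
  if S ∈ posDefCone m then ∫ T, (k S T : ℂ) * (f : Lp ℂ 2 (P₀ m α)) T ∂P₀ m α else 0

lemma kernelTransform_of_mem (f : L2 m α) {S : Matrix (Fin m) (Fin m) ℝ} (hS : S ∈ posDefCone m) :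
    kernelTransform k f S = ∫ T, (k S T : ℂ) * (f : Lp ℂ 2 (P₀ m α)) T ∂P₀ m α := if_pos hS

variable [IsFiniteMeasure (P₀ m α)]

lemma hasSum_kernelTransform (h : IsMercerSum (posDefCone m) c (feature α) k) (f : L2 m α)
    {S : Matrix (Fin m) (Fin m) ℝ} (hS : S ∈ posDefCone m) :
    HasSum (fun i => (c i * feature α i S : ℂ) *
      ∫ T, (feature α i T : ℂ) * (f : Lp ℂ 2 (P₀ m α)) T ∂P₀ m α) (kernelTransform k f S) := by
  rw [kernelTransform_of_mem f hS]
  exact h.hasSum_integral (ae_mem_posDefCone α) (integrable_L2 f) hS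

lemma measurable_kernelTransform (h : IsMercerSum (posDefCone m) c (feature α) k) (f : L2 m α) :
    Measurable (kernelTransform k f) := by
  classical
  refine measurable_of_tendsto_metrizable' (Filter.atTop : Filter (Finset (PartIndex m)))
    (f := fun F => (posDefCone m).indicator fun S => ∑ i ∈ F, (c i * feature α i S : ℂ) *
      ∫ T, (feature α i T : ℂ) * (f : Lp ℂ 2 (P₀ m α)) T ∂P₀ m α) (fun F => ?_) ?_
  · exact (Finset.measurable_fun_sum F fun i _ => ((Complex.measurable_ofReal.comp
      (measurable_feature i)).const_mul _).mul_const _).indicator measurableSet_posDefCone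
  · rw [tendsto_pi_nhds]
    intro S
    by_cases hS : S ∈ posDefCone m
    · simp only [Set.indicator_of_mem hS]
      exact hasSum_kernelTransform h f hS
    · simp only [Set.indicator_of_notMem hS, kernelTransform, if_neg hS]
      exact tendsto_const_nhds

/-- Invariance is required at every point of the cone; it is inherited from the features through the
pointwise expansion. -/
lemma orthInvariant_kernelTransform (h : IsMercerSum (posDefCone m) c (feature α) k)
    (f : L2 m α) : OrthInvariant (kernelTransform k f) := by
  intro Y hY H hH
  have h1 := hasSum_kernelTransform h f (posDef_conj hY ⟨H, hH⟩)
  simp only [fun i => feature_conj (α := α) i Y ⟨H, hH⟩] at h1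
  exact h1.unique (hasSum_kernelTransform h f hY)

lemma norm_kernelTransform_le (h : IsMercerSum (posDefCone m) c (feature α) k) (f : L2 m α)
    (S : Matrix (Fin m) (Fin m) ℝ) :
    ‖kernelTransform k f S‖ ≤ ∫ T, ‖(f : Lp ℂ 2 (P₀ m α)) T‖ ∂P₀ m α := by
  by_cases hS : S ∈ posDefCone m
  · rw [kernelTransform_of_mem f hS]
    exact h.norm_integral_kernel_mul_le (ae_mem_posDefCone α) (integrable_L2 f) hS
  · rw [kernelTransform, if_neg hS, norm_zero]
    exact integral_nonneg fun _ => norm_nonneg _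

lemma memLp_kernelTransform (h : IsMercerSum (posDefCone m) c (feature α) k) (f : L2 m α) :
    MemLp (kernelTransform k f) 2 (P₀ m α) :=
  MemLp.of_bound (measurable_kernelTransform h f).aestronglyMeasurable _
    (Filter.Eventually.of_forall (norm_kernelTransform_le h f))

lemma exists_isIntegralOperator (h : IsMercerSum (posDefCone m) c (feature α) k) :
    ∃ A : L2 m α →L[ℂ] L2 m α, IsIntegralOperator k A := by
  have hP := ae_mem_posDefCone (m := m) α
  let op : L2 m α → L2 m α := fun f => ⟨(memLp_kernelTransform h f).toLp _,
    kernelTransform k f, measurable_kernelTransform h f, orthInvariant_kernelTransform h f,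
    MemLp.coeFn_toLp _⟩
  have hop : ∀ f, ((op f : L2 m α) : Lp ℂ 2 (P₀ m α)) =ᵐ[P₀ m α] kernelTransform k f :=
    fun f => MemLp.coeFn_toLp (memLp_kernelTransform h f)
  have hint : ∀ f : L2 m α, ∀ S ∈ posDefCone m,
      Integrable (fun T => (k S T : ℂ) * (f : Lp ℂ 2 (P₀ m α)) T) (P₀ m α) := fun f S hS =>
    h.integrable_kernel_mul hP (integrable_L2 f) hS
  let opL : L2 m α →ₗ[ℂ] L2 m α :=
    { toFun := op
      map_add' := fun f g => by
        refine Subtype.ext (Lp.ext ?_)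
        rw [Submodule.coe_add]
        filter_upwards [hop (f + g), hop f, hop g,
          Lp.coeFn_add (op f : Lp ℂ 2 (P₀ m α)) (op g : Lp ℂ 2 (P₀ m α)), hP]
          with S h1 h2 h3 h4 hS
        rw [h1, h4, Pi.add_apply, h2, h3, kernelTransform_of_mem _ hS, kernelTransform_of_mem _ hS,
          kernelTransform_of_mem _ hS, ← integral_add (hint f S hS) (hint g S hS)]
        refine integral_congr_ae ?_
        filter_upwards [Lp.coeFn_add (f : Lp ℂ 2 (P₀ m α)) (g : Lp ℂ 2 (P₀ m α))] with T hT
        rw [Submodule.coe_add, hT, Pi.add_apply, mul_add]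
      map_smul' := fun a f => by
        refine Subtype.ext (Lp.ext ?_)
        rw [RingHom.id_apply, Submodule.coe_smul]
        filter_upwards [hop (a • f), hop f, Lp.coeFn_smul a (op f : Lp ℂ 2 (P₀ m α)), hP]
          with S h1 h2 h4 hS
        rw [h1, h4, Pi.smul_apply, h2, kernelTransform_of_mem _ hS, kernelTransform_of_mem _ hS,
          smul_eq_mul, ← integral_const_mul]
        refine integral_congr_ae ?_
        filter_upwards [Lp.coeFn_smul a (f : Lp ℂ 2 (P₀ m α))] with T hT
        rw [Submodule.coe_smul, hT, Pi.smul_apply, smul_eq_mul]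
        ring }
  -- The transform is bounded pointwise by the `L¹` norm of `f`. The first factor passes from this
  -- bound to the `L²` norm of the transform, the second is Hölder's constant from `L²` to `L¹`.
  refine ⟨opL.mkContinuous ((measureUnivNNReal (P₀ m α) : ℝ) ^ (2 : ℝ≥0∞).toReal⁻¹ *
    ((P₀ m α Set.univ) ^ (1 / (1 : ℝ≥0∞).toReal - 1 / (2 : ℝ≥0∞).toReal)).toReal)
    fun f => ?_, fun f => ⟨fun S hS => hint f S hS, ?_⟩⟩
  · rw [mul_assoc]
    refine (Lp.norm_le_of_ae_bound (f := (op f : Lp ℂ 2 (P₀ m α)))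
      (C := ∫ T, ‖(f : Lp ℂ 2 (P₀ m α)) T‖ ∂P₀ m α)
      (integral_nonneg fun _ => norm_nonneg _) ?_).trans
      (mul_le_mul_of_nonneg_left (integral_norm_le_mul_norm f) (by positivity))
    filter_upwards [hop f] with S hS
    rw [hS]
    exact norm_kernelTransform_le h f S
  · filter_upwards [hop f, hP] with S h1 hS
    rw [← kernelTransform_of_mem f hS]
    exact h1

lemma IsIntegralOperator.injective (hm : 0 < m) (hα0 : 0 < α) (hα : (m : ℝ) / 2 ≤ α)
    (h : IsMercerSum (posDefCone m) c (feature α) k) (hc : ∀ i : PartIndex m, 2 ≤ i.1 → 0 < c i)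
    {A : L2 m α →L[ℂ] L2 m α} (hA : IsIntegralOperator k A) : Function.Injective A := by
  rw [injective_iff_map_eq_zero]
  intro f hf
  have hP := ae_mem_posDefCone (m := m) α
  have h0 : ∀ᵐ S ∂P₀ m α, ∫ T, (k S T : ℂ) * (f : Lp ℂ 2 (P₀ m α)) T ∂P₀ m α = 0 := by
    have h1 := (hA f).2
    rw [hf, Submodule.coe_zero] at h1
    filter_upwards [h1, Lp.coeFn_zero ℂ 2 (P₀ m α)] with S h2 h3
    rw [← h2, h3, Pi.zero_apply]
  -- Completeness needs a representative that is invariant everywhere on the cone.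
  obtain ⟨g, hg, hgi, hfg⟩ := f.2
  have hg0 : g =ᵐ[P₀ m α] 0 := by
    refine ae_eq_zero_of_integral_feature_mul_eq_zero_complex hm hα0 hα hg hgi
      ((integrable_congr hfg).mp (integrable_L2 f)) fun i hi => ?_
    rw [← h.integral_mul_eq_zero hP (integrable_L2 f) h0 i (hc i hi)]
    refine integral_congr_ae ?_
    filter_upwards [hfg] with T hT
    rw [hT]
  refine Subtype.ext ?_
  rw [Submodule.coe_zero, Lp.eq_zero_iff_ae_eq_zero]
  exact hfg.trans hg0

end Operators

/-! ### Eigenvalue zero, the degenerate measure and the conclusion -/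

lemma not_hasEigenvalue_zero_of_injective {A : L2 m α →L[ℂ] L2 m α} (hA : Function.Injective A) :
    ¬ Module.End.HasEigenvalue (A : Module.End ℂ (L2 m α)) 0 := by
  intro h
  obtain ⟨v, hv⟩ := h.exists_hasEigenvector
  refine hv.2 (hA ?_)
  have := hv.apply_eq_smul
  rw [zero_smul] at this
  rw [map_zero]
  exact this

lemma ae_of_eq_zero {X : Type*} [MeasurableSpace X] {μ : Measure X} (hμ : μ = 0) (p : X → Prop) :
    ∀ᵐ x ∂μ, p x := by
  rw [hμ, ae_zero]
  exact Filter.eventually_bot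

lemma subsingleton_L2 (hP : P₀ m α = 0) : Subsingleton (L2 m α) :=
  ⟨fun _ _ => Subtype.ext (Lp.ext (ae_of_eq_zero hP _))⟩

lemma isIntegralOperator_zero (hP : P₀ m α = 0)
    (k : Matrix (Fin m) (Fin m) ℝ → Matrix (Fin m) (Fin m) ℝ → ℝ) :
    IsIntegralOperator k (0 : L2 m α →L[ℂ] L2 m α) := by
  refine fun f => ⟨fun S _ => ?_, ae_of_eq_zero hP _⟩
  exact (integrable_zero _ ℂ _).congr (ae_of_eq_zero hP _)

lemma exists_injective_isIntegralOperator (hm : 0 < m) (hα0 : 0 < α) (hα : (m : ℝ) / 2 ≤ α) :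
    ∃ S S₀ : L2 m α →L[ℂ] L2 m α, IsIntegralOperator (K m α) S ∧ IsIntegralOperator (K₀ m α) S₀ ∧
      Function.Injective S ∧ Function.Injective S₀ := by
  by_cases hΓ : multiGamma m α = 0
  · have hP := P₀_eq_zero hΓ
    have := subsingleton_L2 hP
    exact ⟨0, 0, isIntegralOperator_zero hP _, isIntegralOperator_zero hP _,
      Function.injective_of_subsingleton _, Function.injective_of_subsingleton _⟩
  · have := isFiniteMeasure_P₀ hΓ
    have hK := isMercerSum_K hm hα0 hα hΓ
    have hK₀ := isMercerSum_K₀ hα0 hα hΓ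
    obtain ⟨S, hS⟩ := exists_isIntegralOperator hK
    obtain ⟨S₀, hS₀⟩ := exists_isIntegralOperator hK₀
    refine ⟨S, S₀, hS, hS₀, hS.injective hm hα0 hα hK fun i hi => ?_,
      hS₀.injective hm hα0 hα hK₀ fun i _ => kernelCoeff_pos hα0 hα i.antitone⟩
    rw [kernelCoeffTail, if_pos hi]
    exact kernelCoeff_pos hα0 hα i.antitone

end Wishart

theorem proposition3p6 (m : ℕ) (hm : 2 ≤ m) (α : ℝ)
    (hα : max ((2 * (m : ℝ) - 1) / 2) (((m : ℝ) + 3) / 2) < α) :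
    ∃ S S₀ : Wishart.L2 m α →L[ℂ] Wishart.L2 m α,
      Wishart.IsIntegralOperator (Wishart.K m α) S ∧
      Wishart.IsIntegralOperator (Wishart.K₀ m α) S₀ ∧
      (∀ f g : Wishart.L2 m α, S f = S g ↔ f = g) ∧
      (∀ f g : Wishart.L2 m α, S₀ f = S₀ g ↔ f = g) ∧
      ¬ Module.End.HasEigenvalue (S : Module.End ℂ (Wishart.L2 m α)) 0 ∧
      ¬ Module.End.HasEigenvalue (S₀ : Module.End ℂ (Wishart.L2 m α)) 0 := by
  -- This gives both `0 < α` and `m / 2 ≤ α`.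
  have h1 : ((m : ℝ) + 3) / 2 < α := (le_max_right _ _).trans_lt hα
  have h2 : (0 : ℝ) ≤ m := Nat.cast_nonneg m
  obtain ⟨S, S₀, hS, hS₀, hi, hi₀⟩ := Wishart.exists_injective_isIntegralOperator (m := m) (α := α)
    (by omega) (by linarith) (by linarith)
  exact ⟨S, S₀, hS, hS₀, fun f g => hi.eq_iff, fun f g => hi₀.eq_iff,
    Wishart.not_hasEigenvalue_zero_of_injective hi,
    Wishart.not_hasEigenvalue_zero_of_injective hi₀⟩
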